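/- Theorem 1. Let $1\le N_t<N_r$, let $\Sigma=W\Lambda W^H$ be an $N_t\times N_t$ Hermitian positive definite matrix with $W$ unitary and $\Lambda=\mathrm{diag}(\lambda_1,\dots,\lambda_{N_t})$, $0<\lambda_1\le\dots\le\lambda_{N_t}$, and let $\eta=1/\sigma^2$ with $\sigma>0$. Consider $r=HFs+\xi$, where $H\in\mathbb C^{N_r\times N_t}$ is zero-mean circularly-symmetric complex Gaussian with $\mathbb E[\overline{h_{\ell i}}\,h_{mj}]=\delta_{\ell m}\Sigma_{ij}$, $\xi$ is circularly-symmetric complex Gaussian noise with covariance $\sigma^2I$, the entries of $s$ are independent and uniform on an $M$-ary PAM, PSK or square QAM constellation ($M\ge2$) with zero mean and unit average energy, and $H,s,\xi$ are independent. The receiver forms $r'=(HF)^+r$ with $(HF)^+=(F^HH^HHF)^{-1}F^HH^H$, and decides $\hat s_k$ as a constellation point nearest to $r'_k$. Let $P(F)=\frac1{N_t}\sum_{k=1}^{N_t}\Pr(\hat s_k\ne s_k)$ be the average symbol error probability (SEP). With $q=N_r-N_t+1$ put, according to the modulation, - PAM: $G(x)=\frac{2(M-1)}{M\pi}\int_0^{\pi/2}\bigl(1+\frac{3\eta}{(M^2-1)x\sin^2\theta}\bigr)^{-q}d\theta$,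 $\;T=\frac{3\eta(N_r-N_t)}{2(M^2-1)}$; - PSK: $G(x)=\frac1\pi\int_0^{(M-1)\pi/M}\bigl(1+\frac{\eta\sin^2(\pi/M)}{x\sin^2\theta}\bigr)^{-q}d\theta$, $\;T=\frac{\eta(N_r-N_t)\sin^2(\pi/M)}{2}$; - QAM: $G(x)=\frac{4(\sqrt M-1)}{\sqrt M\pi}\int_{\pi/4}^{\pi/2}\bigl(1+\frac{3\eta}{2(M-1)x\sin^2\theta}\bigr)^{-q}d\theta+\frac{4(\sqrt M-1)}{M\pi}\int_0^{\pi/4}\bigl(1+\frac{3\eta}{2(M-1)x\sin^2\theta}\bigr)^{-q}d\theta$, $\;T=\frac{3\eta(N_r-N_t)}{4(M-1)}$. Let $\mathcal F=\{F\in\mathbb C^{N_t\times N_t}:\ \zeta_1(F^HF)\ge\frac1{\lambda_1T},\ \mathrm{tr}(F^HF)=1\}$, where $\zeta_1$ is the smallest eigenvalue, and let $$\widetilde F=\frac1{\sqrt{\mathrm{tr}(\Lambda^{-1/2})}}\,W\Lambda^{-1/4}V,\qquad V_{jk}=\tfrac1{\sqrt{N_t}}e^{-2\pi i jk/N_t}\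 (0\le j,k<N_t).$$ Then $\mathrm{tr}(\widetilde F^H\widetilde F)=1$, $$P(\widetilde F)=G\Bigl(\bigl(\textstyle\sum_{k=1}^{N_t}\lambda_k^{-1/2}\bigr)^2/N_t\Bigr),$$ and $P(\widetilde F)\le P(F)$ for every $F\in\mathcal F$. In particular, whenever $\widetilde F\in\mathcal F$, the precoder $\widetilde F$ minimizes the average SEP over $\mathcal F$, and the minimum equals $G\bigl((\sum_k\lambda_k^{-1/2})^2/N_t\bigr)$. -/

import Mathlib

open MeasureTheory ProbabilityTheory Matrix
open scoped Kronecker ComplexConjugate ComplexOrder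

namespace ZFPrecoding

noncomputable section

/-- The three modulation families. For `qam` only square sizes `M` are used. -/
inductive Modulation
  | pam
  | psk
  | qam

/-- Admissible constellation sizes: `M ≥ 2`, and `M` is a perfect square for QAM. -/
def Modulation.ValidSize : Modulation → ℕ → Prop
  | .pam, M => 2 ≤ M
  | .psk, M => 2 ≤ M
  | .qam, M => 2 ≤ M ∧ IsSquare M

/-- The `M`-point constellation, with zero mean and unit average energy. -/
def Modulation.constellation : Modulation → ℕ → Finset ℂ
  | .pam, M => (Finset.range M).image fun i : ℕ =>
      ((Real.sqrt (3 / ((M : ℝ) ^ 2 - 1)) * (2 * (i : ℝ) - ((M : ℝ) - 1)) : ℝ) : ℂ)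
  | .psk, M => (Finset.range M).image fun i : ℕ =>
      Complex.exp (2 * (Real.pi : ℂ) * Complex.I * (i : ℂ) / (M : ℂ))
  | .qam, M => (Finset.range (Nat.sqrt M) ×ˢ Finset.range (Nat.sqrt M)).image fun p : ℕ × ℕ =>
      ((Real.sqrt (3 / (2 * ((M : ℝ) - 1))) *
          (2 * (p.1 : ℝ) - ((Nat.sqrt M : ℝ) - 1)) : ℝ) : ℂ) +
      ((Real.sqrt (3 / (2 * ((M : ℝ) - 1))) *
          (2 * (p.2 : ℝ) - ((Nat.sqrt M : ℝ) - 1)) : ℝ) : ℂ) * Complex.I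

/-- A minimum-distance hard decision onto `S` (ties may be broken in any way). -/
def IsMinDistDetector (S : Finset ℂ) (δ : ℂ → ℂ) : Prop :=
  ∀ z, δ z ∈ S ∧ ∀ c ∈ S, ‖z - δ z‖ ≤ ‖z - c‖

/-- `X` is a zero-mean circularly-symmetric complex Gaussian vector with covariance
`E[X Xᴴ] = C`: it is (jointly, over the reals) Gaussian, centred, with covariance `C` and
vanishing pseudo-covariance `E[X Xᵀ]`. -/
structure IsCircularGaussian {Ω ι : Type*} [MeasurableSpace Ω] [Fintype ι]
    (X : Ω → ι → ℂ) (C : Matrix ι ι ℂ) (P : Measure Ω) : Prop where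
  gaussian : HasGaussianLaw X P
  mean : ∀ i, ∫ ω, X ω i ∂P = 0
  cov : ∀ i j, ∫ ω, X ω i * conj (X ω j) ∂P = C i j
  pseudoCov : ∀ i j, ∫ ω, X ω i * X ω j ∂P = 0

/-- The random quantities of the transmission model: channel matrix `H`, symbol vector `s`,
noise `ξ`. The columns of `Hᴴ` (conjugated rows of `H`) are independent circular complex
Gaussian vectors with covariance `Sig`, i.e. `E[conj (H ℓ i) * H m j] = if ℓ = m then Sig i j
else 0`; the noise is circular complex Gaussian with covariance `σ² I`; the symbols are
independent and uniform on the constellation `S`; channel, symbols and noise are independent. -/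
structure IsMIMOModel {Ω : Type*} [MeasurableSpace Ω] (P : Measure Ω) {Nr Nt : ℕ}
    (Sig : Matrix (Fin Nt) (Fin Nt) ℂ) (σ : ℝ) (S : Finset ℂ)
    (H : Ω → Matrix (Fin Nr) (Fin Nt) ℂ) (s : Ω → Fin Nt → ℂ) (ξ : Ω → Fin Nr → ℂ) : Prop where
  channel : IsCircularGaussian (fun ω (p : Fin Nr × Fin Nt) => conj (H ω p.1 p.2))
    ((1 : Matrix (Fin Nr) (Fin Nr) ℂ) ⊗ₖ Sig) P
  noise : IsCircularGaussian ξ (((σ ^ 2 : ℝ) : ℂ) • (1 : Matrix (Fin Nr) (Fin Nr) ℂ)) P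
  symbol_law : ∀ k, HasLaw (fun ω => s ω k) (uniformOn (S : Set ℂ)) P
  symbol_indep : iIndepFun (fun k ω => s ω k) P
  indep_symbol_noise : IndepFun s ξ P
  indep_channel : IndepFun (fun ω (p : Fin Nr × Fin Nt) => H ω p.1 p.2)
    (fun ω => (s ω, ξ ω)) P

/-- Pseudo-inverse `(Aᴴ A)⁻¹ Aᴴ` of a matrix of full column rank. -/
def pinv {m n : ℕ} (A : Matrix (Fin m) (Fin n) ℂ) : Matrix (Fin n) (Fin m) ℂ :=
  (Aᴴ * A)⁻¹ * Aᴴ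

/-- Zero-forcing equalizer output `(H F)⁺ r` for the received vector `r = H F s + ξ`. -/
def zfOutput {Nr Nt : ℕ} (F : Matrix (Fin Nt) (Fin Nt) ℂ) (H : Matrix (Fin Nr) (Fin Nt) ℂ)
    (s : Fin Nt → ℂ) (ξ : Fin Nr → ℂ) : Fin Nt → ℂ :=
  pinv (H * F) *ᵥ ((H * F) *ᵥ s + ξ)

/-- Average symbol error probability of the precoder `F` with zero-forcing detection: the
arithmetic mean over the `Nt` streams of the probability (over channel, symbols and noise)
that the detected symbol differs from the transmitted one. -/
def avgSEP {Ω : Type*} [MeasurableSpace Ω] (P : Measure Ω) {Nr Nt : ℕ} (δ : ℂ → ℂ)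
    (H : Ω → Matrix (Fin Nr) (Fin Nt) ℂ) (s : Ω → Fin Nt → ℂ) (ξ : Ω → Fin Nr → ℂ)
    (F : Matrix (Fin Nt) (Fin Nt) ℂ) : ℝ :=
  (1 / (Nt : ℝ)) * ∑ k, P.real {ω | δ (zfOutput F (H ω) (s ω) (ξ ω) k) ≠ s ω k}

/-- The function `G` of the modulation, for size `M`, SNR `η`, and antenna numbers. -/
def Modulation.G : Modulation → (M : ℕ) → (η : ℝ) → (Nr Nt : ℕ) → (x : ℝ) → ℝ
  | .pam, M, η, Nr, Nt, x =>
      2 * ((M : ℝ) - 1) / (M * Real.pi) * ∫ θ in (0 : ℝ)..(Real.pi / 2),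
        (1 + 3 * η / (((M : ℝ) ^ 2 - 1) * x * Real.sin θ ^ 2)) ^ (-((Nr : ℤ) - (Nt : ℤ) + 1))
  | .psk, M, η, Nr, Nt, x =>
      1 / Real.pi * ∫ θ in (0 : ℝ)..(((M : ℝ) - 1) * Real.pi / M),
        (1 + η * Real.sin (Real.pi / M) ^ 2 / (x * Real.sin θ ^ 2)) ^
          (-((Nr : ℤ) - (Nt : ℤ) + 1))
  | .qam, M, η, Nr, Nt, x =>
      4 * (Real.sqrt M - 1) / (Real.sqrt M * Real.pi) *
        (∫ θ in (Real.pi / 4)..(Real.pi / 2),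
          (1 + 3 * η / (2 * ((M : ℝ) - 1) * x * Real.sin θ ^ 2)) ^
            (-((Nr : ℤ) - (Nt : ℤ) + 1))) +
      4 * (Real.sqrt M - 1) / (M * Real.pi) *
        (∫ θ in (0 : ℝ)..(Real.pi / 4),
          (1 + 3 * η / (2 * ((M : ℝ) - 1) * x * Real.sin θ ^ 2)) ^
            (-((Nr : ℤ) - (Nt : ℤ) + 1)))

/-- The convexity threshold `T` of the modulation. -/
def Modulation.T : Modulation → (M : ℕ) → (η : ℝ) → (Nr Nt : ℕ) → ℝ
  | .pam, M, η, Nr, Nt => 3 * η * ((Nr : ℝ) - Nt) / (2 * ((M : ℝ) ^ 2 - 1))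
  | .psk, M, η, Nr, Nt => η * ((Nr : ℝ) - Nt) * Real.sin (Real.pi / M) ^ 2 / 2
  | .qam, M, η, Nr, Nt => 3 * η * ((Nr : ℝ) - Nt) / (4 * ((M : ℝ) - 1))

/-- Smallest eigenvalue of the Hermitian matrix `Fᴴ F`. -/
def minEigGram {n : ℕ} (F : Matrix (Fin n) (Fin n) ℂ) : ℝ :=
  ⨅ i, (isHermitian_conjTranspose_mul_self F).eigenvalues i

/-- Unit-power precoders whose Gram matrix has smallest eigenvalue at least `1 / (lam1 * T)`. -/
def feasible {n : ℕ} (lam1 T : ℝ) : Set (Matrix (Fin n) (Fin n) ℂ) :=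
  {F | 1 / (lam1 * T) ≤ minEigGram F ∧ (Fᴴ * F).trace = 1}

/-- The normalized (unitary) discrete Fourier transform matrix. -/
def dftMatrix (n : ℕ) : Matrix (Fin n) (Fin n) ℂ :=
  Matrix.of fun j k =>
    Complex.exp (-(2 * (Real.pi : ℂ) * Complex.I * (j : ℂ) * (k : ℂ) / (n : ℂ))) /
      ((Real.sqrt n : ℝ) : ℂ)

/-- The precoder `W Λ^(-1/4) V / √(tr Λ^(-1/2))` with `Λ = diag lam` and `V` the DFT matrix. -/
def optPrecoder {n : ℕ} (W : Matrix (Fin n) (Fin n) ℂ) (lam : Fin n → ℝ) :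
    Matrix (Fin n) (Fin n) ℂ :=
  ((1 / Real.sqrt (∑ k, lam k ^ (-(1 / 2) : ℝ)) : ℝ) : ℂ) •
    (W * Matrix.diagonal (fun k => ((lam k ^ (-(1 / 4) : ℝ) : ℝ) : ℂ)) * dftMatrix n)

end

end ZFPrecoding

open ZFPrecoding

/-! Put `A = H * F`. Zero forcing outputs `s + A⁺ ξ`, so conditionally on the channel stream `k` is
a scalar Gaussian channel with noise variance `σ² / γ`, where `γ = zfGain A k` is the inverse of the
`k`-th diagonal entry of `(Aᴴ A)⁻¹`. Geometrically `γ` is the squared distance from the `k`-th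
column of `A` to the span of the others (`sum_inner_sq_eq_zfGain`). Subtracting from that column its
regression on the others leaves this distance unchanged and makes the column independent of them.
Hence `γ` is a sum of `q = Nr - Nt + 1` independent squared moduli of complex Gaussians of variance
`1 / x k`, where `x k` is the `k`-th diagonal entry of `(Fᴴ Σ F)⁻¹`; its Laplace transform at `t` is
`(1 + t / x k)^(-q)` (`IsRayleigh.integral_exp_zfGain`).

For all three constellations Craig's formula writes the symbol error probability at noise variance
`v` as an integral of `exp(-κ / (v sin² θ))` against a fixed finite measure in `θ` (`awgnSEP_eq`).
Averaging over the channel under the integral sign inserts the Laplace transform and yields `G (x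
k)` for stream `k` (`IsMIMOModel.stream_sep`). Thus `P(F)` is the mean of the numbers `G (x k)`.

The rest is optimization. The function `x ↦ (1 + a / x)^(-q)` is increasing, and convex for `x ≤ (q
- 1) a / 2`. Here `a = κ η / sin² θ ≥ κ η`, so `G` satisfies Jensen's inequality on `(0, T]`
(`G_jensen`). Feasibility forces `x k ≤ 1 / (λ₁ ζ₁) ≤ T` (`noise_amplification_le`). Jensen and
monotonicity reduce the bound to the trace of `(Fᴴ Σ F)⁻¹`, which under `tr (Fᴴ F) = 1` is at least
`(tr Σ^(-1/2))²` by Cauchy-Schwarz (`trace_inv_ge`). The factor `Λ^(-1/4)` gives equality in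
Cauchy-Schwarz, and the entries of equal modulus in the Fourier matrix make all `x k` equal, which
is equality in Jensen (`optPrecoder_cov`). -/

namespace ZFPrecoding

open scoped NNReal ENNReal InnerProductSpace

/-! ### Circular complex Gaussian vectors: linear images, independence, marginals -/

/-- The law of a circularly-symmetric complex Gaussian variable of variance `v`. -/
noncomputable def cgauss (v : ℝ≥0) : Measure ℂ :=
  ((gaussianReal 0 (v / 2)).prod (gaussianReal 0 (v / 2))).map
    Complex.measurableEquivRealProd.symm

instance (v : ℝ≥0) : IsProbabilityMeasure (cgauss v) :=
  Measure.isProbabilityMeasure_map Complex.measurableEquivRealProd.symm.measurable.aemeasurable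

/-- Every real-linear functional on `ℂ` is `z ↦ Re (a z)`. -/
lemma exists_re_mul (L : StrongDual ℝ ℂ) : ∃ a : ℂ, ∀ z, L z = (a * z).re := by
  refine ⟨⟨L 1, -L Complex.I⟩, fun z => ?_⟩
  conv_lhs => rw [← Complex.re_add_im z]
  have : (z.re : ℂ) + z.im * Complex.I = z.re • (1 : ℂ) + z.im • Complex.I := by simp
  rw [this, map_add, map_smul, map_smul]
  simp only [smul_eq_mul, Complex.mul_re]
  ring

lemma exists_sum_re_mul {ι : Type*} [Fintype ι] [DecidableEq ι] (L : StrongDual ℝ (ι → ℂ)) :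
    ∃ a : ι → ℂ, ∀ z, L z = ∑ k, (a k * z k).re := by
  choose a ha using fun k => exists_re_mul (L ∘L ContinuousLinearMap.single ℝ (fun _ => ℂ) k)
  refine ⟨a, fun z => ?_⟩
  conv_lhs => rw [← Finset.univ_sum_single z, map_sum]
  exact Finset.sum_congr rfl fun k _ => by rw [← ha]; rfl

section Circular

variable {Ω ι κ : Type*} [MeasurableSpace Ω] {P : Measure Ω} [Fintype ι] [Fintype κ]
  {X : Ω → ι → ℂ} {C : Matrix ι ι ℂ}

namespace IsCircularGaussian

lemma memLp (h : IsCircularGaussian X C P) (i : ι) : MemLp (fun ω => X ω i) 2 P :=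
  (h.gaussian.eval i).memLp_two

lemma integrable_mul (h : IsCircularGaussian X C P) (i j : ι) :
    Integrable (fun ω => X ω i * X ω j) P :=
  (h.memLp i).integrable_mul (h.memLp j)

lemma integrable_mul_conj (h : IsCircularGaussian X C P) (i j : ι) :
    Integrable (fun ω => X ω i * conj (X ω j)) P :=
  (h.memLp i).integrable_mul (h.memLp j).star

lemma linear (h : IsCircularGaussian X C P) (A : Matrix κ ι ℂ) :
    IsCircularGaussian (fun ω => A *ᵥ X ω) (A * C * Aᴴ) P where
  gaussian := by
    exact h.gaussian.map_fun
      ((LinearMap.toContinuousLinearMap (Matrix.mulVecLin A)).restrictScalars ℝ)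
  mean i := by
    simp only [Matrix.mulVec, dotProduct]
    have := h.gaussian.isProbabilityMeasure
    rw [integral_finsetSum _ fun k _ => ((h.memLp k).integrable (by norm_num)).const_mul _]
    simp [integral_const_mul, h.mean]
  cov i j := by
    have e : ∀ ω, (A *ᵥ X ω) i * conj ((A *ᵥ X ω) j)
        = ∑ k, ∑ l, (A i k * conj (A j l)) * (X ω k * conj (X ω l)) := fun ω => by
      simp only [Matrix.mulVec, dotProduct, map_sum, map_mul, Finset.sum_mul_sum]
      exact Finset.sum_congr rfl fun k _ => Finset.sum_congr rfl fun l _ => by ring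
    simp_rw [e]
    rw [integral_finsetSum _ fun k _ => integrable_finsetSum _ fun l _ =>
      (h.integrable_mul_conj k l).const_mul _]
    simp_rw [integral_finsetSum _ fun l _ => (h.integrable_mul_conj _ l).const_mul _,
      integral_const_mul, h.cov, Matrix.mul_apply, Finset.sum_mul, Matrix.conjTranspose_apply]
    rw [Finset.sum_comm]
    exact Finset.sum_congr rfl fun k _ => Finset.sum_congr rfl fun l _ => by
      simp only [RCLike.star_def]; ring
  pseudoCov i j := by
    have e : ∀ ω, (A *ᵥ X ω) i * ((A *ᵥ X ω) j)
        = ∑ k, ∑ l, (A i k * A j l) * (X ω k * X ω l) := fun ω => by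
      simp only [Matrix.mulVec, dotProduct, Finset.sum_mul_sum]
      exact Finset.sum_congr rfl fun k _ => Finset.sum_congr rfl fun l _ => by ring
    simp_rw [e]
    rw [integral_finsetSum _ fun k _ => integrable_finsetSum _ fun l _ =>
      (h.integrable_mul k l).const_mul _]
    simp_rw [integral_finsetSum _ fun l _ => (h.integrable_mul _ l).const_mul _,
      integral_const_mul, h.pseudoCov]
    simp

lemma comp (h : IsCircularGaussian X C P) (f : κ → ι) :
    IsCircularGaussian (fun ω k => X ω (f k)) (C.submatrix f f) P where
  gaussian := h.gaussian.map_fun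
    (ContinuousLinearMap.pi fun k => ContinuousLinearMap.proj (R := ℝ) (f k))
  mean _ := h.mean _
  cov _ _ := h.cov _ _
  pseudoCov _ _ := h.pseudoCov _ _

/-- For `u = a X i` and `w = b X j` one has `Re u · Re w = Re (u w + u w̄) / 2`. The first term has
mean zero by the vanishing pseudo-covariance, the second by `C i j = 0`. -/
lemma covariance_re (h : IsCircularGaussian X C P) {i j : ι} (hij : C i j = 0) (a b : ℂ) :
    cov[fun ω => (a * X ω i).re, fun ω => (b * X ω j).re; P] = 0 := by
  have := h.gaussian.isProbabilityMeasure
  have hre : ∀ (c : ℂ) k, MemLp (fun ω => (c * X ω k).re) 2 P := fun c k =>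
    ((h.memLp k).const_mul c).re
  have hm : ∀ (c : ℂ) k, ∫ ω, (c * X ω k).re ∂P = 0 := fun c k => by
    have := integral_re (((h.memLp k).integrable (by norm_num)).const_mul c)
    simp only [RCLike.re_to_complex] at this
    rw [this, integral_const_mul, h.mean]; simp
  rw [covariance_eq_sub (hre a i) (hre b j), hm, hm]
  have e : ∀ ω, (a * X ω i).re * (b * X ω j).re
      = ((a * b / 2) * (X ω i * X ω j) + (a * conj b / 2) * (X ω i * conj (X ω j))).re := by
    intro ω
    have : (a * b / 2) * (X ω i * X ω j) + (a * conj b / 2) * (X ω i * conj (X ω j))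
      = (a * X ω i) * ((b * X ω j + conj (b * X ω j)) / 2) := by rw [map_mul]; ring
    rw [this, Complex.add_conj]
    rw [mul_div_assoc', Complex.ofReal_mul, mul_left_comm, Complex.ofReal_ofNat,
      mul_div_assoc, mul_div_cancel₀ _ (two_ne_zero' ℂ), Complex.re_mul_ofReal]
  simp only [Pi.mul_apply, e]
  have := integral_re (((h.integrable_mul i j).const_mul (a * b / 2)).add
    ((h.integrable_mul_conj i j).const_mul (a * conj b / 2)))
  simp only [RCLike.re_to_complex, Pi.add_apply] at this
  rw [this, integral_add ((h.integrable_mul i j).const_mul _)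
    ((h.integrable_mul_conj i j).const_mul _), integral_const_mul, integral_const_mul,
    h.cov, h.pseudoCov, hij]
  simp

/-- For jointly Gaussian families, independence amounts to vanishing covariance of all real
functionals, and these are real parts of complex multiples. -/
lemma iIndepFun (h : IsCircularGaussian X C P) (hC : ∀ i j, i ≠ j → C i j = 0) :
    ProbabilityTheory.iIndepFun (fun i ω => X ω i) P := by
  refine h.gaussian.iIndepFun_of_covariance_strongDual fun i j hij L₁ L₂ => ?_
  obtain ⟨a, ha⟩ := exists_re_mul L₁
  obtain ⟨b, hb⟩ := exists_re_mul L₂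
  simp only [Function.comp_def, ha, hb]
  exact h.covariance_re (hC i j hij) a b

lemma indepFun {κ' : Type*} [Fintype κ'] (h : IsCircularGaussian X C P) (f : κ → ι) (g : κ' → ι)
    (hC : ∀ i j, C (f i) (g j) = 0) :
    IndepFun (fun ω i => X ω (f i)) (fun ω j => X ω (g j)) P := by
  classical
  have := h.gaussian.isProbabilityMeasure
  have hg : HasGaussianLaw (fun ω => ((fun i => X ω (f i)), (fun j => X ω (g j)))) P :=
    h.gaussian.map_fun ((ContinuousLinearMap.pi fun k =>
      ContinuousLinearMap.proj (R := ℝ) (φ := fun _ => ℂ) (f k)).prod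
      (ContinuousLinearMap.pi fun k => ContinuousLinearMap.proj (R := ℝ) (g k)))
  refine hg.indepFun_of_covariance_strongDual fun L₁ L₂ => ?_
  obtain ⟨a, ha⟩ := exists_sum_re_mul L₁
  obtain ⟨b, hb⟩ := exists_sum_re_mul L₂
  simp only [Function.comp_def, ha, hb]
  rw [covariance_fun_sum_fun_sum]
  · exact Finset.sum_eq_zero fun i _ => Finset.sum_eq_zero fun j _ =>
      h.covariance_re (hC i j) _ _
  · exact fun i => ((h.memLp _).const_mul _).re
  · exact fun i => ((h.memLp _).const_mul _).re

/-- `E|X|² = v` fixes the sum of the variances of the real and imaginary parts; the real part of `E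
X² = 0` makes them equal and the imaginary part makes them uncorrelated, hence independent by joint
Gaussianity. -/
lemma map_eq_cgauss (h : IsCircularGaussian X C P) (i : ι) {v : ℝ≥0} (hv : C i i = (v : ℝ)) :
    P.map (fun ω => X ω i) = cgauss v := by
  have := h.gaussian.isProbabilityMeasure
  have hi : HasGaussianLaw (fun ω => X ω i) P := h.gaussian.eval i
  have hre : HasGaussianLaw (fun ω => (X ω i).re) P := hi.map_fun Complex.reCLM
  have him : HasGaussianLaw (fun ω => (X ω i).im) P := hi.map_fun Complex.imCLM
  have hpair : HasGaussianLaw (fun ω => ((X ω i).re, (X ω i).im)) P :=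
    hi.map_fun (Complex.reCLM.prod Complex.imCLM)
  have mre : MemLp (fun ω => (X ω i).re) 2 P := hre.memLp_two
  have mim : MemLp (fun ω => (X ω i).im) 2 P := him.memLp_two
  have ire : ∫ ω, (X ω i).re ∂P = 0 := by
    have := integral_re (((h.memLp i).integrable (by norm_num)))
    simp only [RCLike.re_to_complex] at this
    rw [this, h.mean]; simp
  have iim : ∫ ω, (X ω i).im ∂P = 0 := by
    have := integral_im (((h.memLp i).integrable (by norm_num)))
    simp only [RCLike.im_to_complex] at this
    rw [this, h.mean]; simp
  have e1 : ∫ ω, ((X ω i).re ^ 2 + (X ω i).im ^ 2) ∂P = v := by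
    have := integral_re (h.integrable_mul_conj i i)
    rw [h.cov, hv] at this
    simp only [RCLike.re_to_complex, Complex.mul_conj, Complex.normSq_apply] at this
    simpa [sq] using this
  have e2 : ∫ ω, ((X ω i).re ^ 2 - (X ω i).im ^ 2) ∂P = 0 := by
    have := integral_re (h.integrable_mul i i)
    rw [h.pseudoCov] at this
    simpa [sq] using this
  have e3 : ∫ ω, (X ω i).re * (X ω i).im ∂P = 0 := by
    have := integral_im (h.integrable_mul i i)
    rw [h.pseudoCov] at this
    simp only [RCLike.im_to_complex, Complex.mul_im, Complex.zero_im] at this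
    have e : ∀ ω, (X ω i).re * (X ω i).im + (X ω i).im * (X ω i).re
      = 2 * ((X ω i).re * (X ω i).im) := fun ω => by ring
    simp_rw [e, integral_const_mul] at this
    linarith
  rw [integral_add mre.integrable_sq mim.integrable_sq] at e1
  rw [integral_sub mre.integrable_sq mim.integrable_sq] at e2
  have vre : Var[fun ω => (X ω i).re; P] = v / 2 := by
    rw [variance_of_integral_eq_zero mre.aemeasurable ire]; linarith
  have vim : Var[fun ω => (X ω i).im; P] = v / 2 := by
    rw [variance_of_integral_eq_zero mim.aemeasurable iim]; linarith
  have hind : IndepFun (fun ω => (X ω i).re) (fun ω => (X ω i).im) P := by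
    refine hpair.indepFun_of_covariance_eq_zero ?_
    rw [covariance_eq_sub mre mim, ire, iim]
    simpa using e3
  have hv2 : (((v : ℝ) / 2).toNNReal) = v / 2 := by
    rw [Real.toNNReal_div v.coe_nonneg]; simp
  have hp := (indepFun_iff_map_prod_eq_prod_map_map mre.aemeasurable mim.aemeasurable).1 hind
  rw [hre.map_eq_gaussianReal, him.map_eq_gaussianReal, ire, iim, vre, vim, hv2] at hp
  rw [cgauss, ← hp, AEMeasurable.map_map_of_aemeasurable
    Complex.measurableEquivRealProd.symm.measurable.aemeasurable
    (mre.aemeasurable.prodMk mim.aemeasurable)]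
  congr 1

lemma map_eq_pi (h : IsCircularGaussian X C P) [DecidableEq ι] {v : ℝ≥0}
    (hv : C = ((v : ℝ) : ℂ) • (1 : Matrix ι ι ℂ)) :
    P.map X = Measure.pi fun _ => cgauss v := by
  have := h.gaussian.isProbabilityMeasure
  have hind := h.iIndepFun fun i j hij => by simp [hv, hij]
  rw [iIndepFun_iff_map_fun_eq_pi_map fun i => (h.memLp i).aemeasurable] at hind
  have : ∀ i, P.map (fun ω => X ω i) = cgauss v := fun i => h.map_eq_cgauss i (by simp [hv])
  simp only [this] at hind
  exact hind

end IsCircularGaussian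

end Circular

/-! ### Density and Laplace transform of the squared modulus -/

lemma cgauss_eq_withDensity {v : ℝ≥0} (hv : v ≠ 0) :
    cgauss v = volume.withDensity fun z : ℂ =>
      ENNReal.ofReal ((Real.pi * v)⁻¹ * Real.exp (-(‖z‖ ^ 2 / v))) := by
  have hv2 : v / 2 ≠ 0 := by positivity
  have hv' : (0 : ℝ) < v := by positivity
  rw [cgauss, gaussianReal_of_var_ne_zero _ hv2, prod_withDensity (measurable_gaussianPDF _ _)
    (measurable_gaussianPDF _ _)]
  have := Complex.volume_preserving_equiv_real_prod.symm
  ext s hs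
  rw [Measure.map_apply this.measurable hs, withDensity_apply _ hs,
    withDensity_apply _ (this.measurable hs)]
  rw [← this.setLIntegral_comp_preimage_emb Complex.measurableEquivRealProd.symm.measurableEmbedding]
  refine lintegral_congr fun p => ?_
  rw [gaussianPDF, gaussianPDF, ← ENNReal.ofReal_mul (gaussianPDFReal_nonneg _ _ _)]
  congr 1
  have hn : ‖Complex.measurableEquivRealProd.symm p‖ ^ 2 = p.1 ^ 2 + p.2 ^ 2 := by
    rw [← Complex.normSq_eq_norm_sq, Complex.normSq_apply]
    simp [sq]
  have hs : (√(2 * Real.pi * ((v / 2 : ℝ≥0) : ℝ)))⁻¹ * (√(2 * Real.pi * ((v / 2 : ℝ≥0) : ℝ)))⁻¹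
      = (Real.pi * v)⁻¹ := by
    rw [← mul_inv, Real.mul_self_sqrt (by positivity)]
    push_cast
    congr 1; ring
  simp only [gaussianPDFReal]
  rw [mul_mul_mul_comm, hs, ← Real.exp_add, hn]
  congr 2
  push_cast
  field_simp
  ring

/-- The Laplace transform of `|Z|²` for `Z` circular complex Gaussian. -/
lemma integral_exp_cgauss {v : ℝ≥0} (hv : v ≠ 0) {t : ℝ} (ht : 0 ≤ t) :
    ∫ z, Real.exp (-t * ‖z‖ ^ 2) ∂(cgauss v) = (1 + t * v)⁻¹ := by
  have hv' : (0 : ℝ) < v := by positivity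
  rw [cgauss_eq_withDensity hv, integral_withDensity_eq_integral_toReal_smul
    (by fun_prop) (by simp)]
  have : ∀ z : ℂ, (ENNReal.ofReal ((Real.pi * v)⁻¹ * Real.exp (-(‖z‖ ^ 2 / v)))).toReal •
      Real.exp (-t * ‖z‖ ^ 2) = (Real.pi * v)⁻¹ * Real.exp (-(t + (v : ℝ)⁻¹) * ‖z‖ ^ 2) := by
    intro z
    rw [ENNReal.toReal_ofReal (by positivity), smul_eq_mul, mul_assoc, ← Real.exp_add]
    congr 2; field_simp; ring
  simp_rw [this, integral_const_mul]
  rw [GaussianFourier.integral_rexp_neg_mul_sq_norm (by positivity), Complex.finrank_real_complex]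
  have : ((2 : ℕ) : ℝ) / 2 = 1 := by norm_num
  rw [this, Real.rpow_one]
  field_simp
  ring

/-- White coordinates are independent, so the Laplace transform of the squared norm factors. -/
lemma IsCircularGaussian.integral_exp_neg_sum {Ω ι : Type*} [MeasurableSpace Ω] {P : Measure Ω}
    [Fintype ι] [DecidableEq ι] {X : Ω → ι → ℂ} {C : Matrix ι ι ℂ}
    (h : IsCircularGaussian X C P) {v : ℝ≥0} (hv : v ≠ 0)
    (hC : C = ((v : ℝ) : ℂ) • (1 : Matrix ι ι ℂ)) {t : ℝ} (ht : 0 ≤ t) :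
    ∫ ω, Real.exp (-t * ∑ i, ‖X ω i‖ ^ 2) ∂P = ((1 + t * v)⁻¹) ^ Fintype.card ι := by
  have hm := h.map_eq_pi hC
  have : ∫ x : ι → ℂ, Real.exp (-t * ∑ i, ‖x i‖ ^ 2) ∂(P.map X)
      = ∫ ω, Real.exp (-t * ∑ i, ‖X ω i‖ ^ 2) ∂P :=
    integral_map h.gaussian.aemeasurable (by
      refine Continuous.aestronglyMeasurable ?_
      fun_prop)
  rw [← this, hm]
  simp_rw [Finset.mul_sum, Real.exp_sum]
  rw [integral_fintype_prod_eq_prod (fun _ z => Real.exp (-t * ‖z‖ ^ 2))]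
  simp only [integral_exp_cgauss hv ht, Finset.prod_const, Finset.card_univ]

/-! ### The zero-forcing gain as a squared distance to a span of columns -/

section Deterministic

variable {n m : ℕ}

/-- The `j`-th column of a matrix as a vector of the Euclidean space. -/
noncomputable def ecol (A : Matrix (Fin n) (Fin m) ℂ) (j : Fin m) : EuclideanSpace ℂ (Fin n) :=
  WithLp.toLp 2 fun i => A i j

/-- The span of the columns other than the `k`-th one. -/
noncomputable def otherSpan (A : Matrix (Fin n) (Fin m) ℂ) (k : Fin m) :
    Submodule ℂ (EuclideanSpace ℂ (Fin n)) :=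
  Submodule.span ℂ (ecol A '' {k}ᶜ)

/-- Post-detection gain of the `k`-th stream: inverse of the noise amplification. -/
noncomputable def zfGain (A : Matrix (Fin n) (Fin m) ℂ) (k : Fin m) : ℝ :=
  (((Aᴴ * A)⁻¹ k k).re)⁻¹

lemma inner_ecol (A : Matrix (Fin n) (Fin m) ℂ) (y : Fin n → ℂ) (j : Fin m) :
    ⟪ecol A j, WithLp.toLp 2 y⟫_ℂ = (Aᴴ *ᵥ y) j := by
  simp [ecol, Matrix.mulVec, dotProduct, PiLp.inner_apply, mul_comm]

lemma toLp_mulVec (A : Matrix (Fin n) (Fin m) ℂ) (y : Fin m → ℂ) :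
    WithLp.toLp 2 (A *ᵥ y) = ∑ j, y j • ecol A j := by
  ext i
  simp [ecol, Matrix.mulVec, dotProduct, mul_comm]

lemma mulVec_injective_iff_linearIndependent_ecol (A : Matrix (Fin n) (Fin m) ℂ) :
    Function.Injective A.mulVec ↔ LinearIndependent ℂ (ecol A) := by
  rw [Matrix.mulVec_injective_iff]
  have : ecol A = (WithLp.linearEquiv 2 ℂ (Fin n → ℂ)).symm ∘ A.col := rfl
  rw [this]
  exact ((WithLp.linearEquiv 2 ℂ (Fin n → ℂ)).symm.toLinearMap.linearIndependent_iff
    (LinearEquiv.ker _)).symm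

lemma posDef_gram {A : Matrix (Fin n) (Fin m) ℂ} (hA : Function.Injective A.mulVec) :
    (Aᴴ * A).PosDef :=
  Matrix.PosDef.conjTranspose_mul_self A hA

lemma isUnit_det_gram {A : Matrix (Fin n) (Fin m) ℂ} (hA : Function.Injective A.mulVec) :
    IsUnit (Aᴴ * A).det :=
  (Matrix.isUnit_iff_isUnit_det _).1 (posDef_gram hA).isUnit

/-- Expresses full column rank by a polynomial condition in the entries and their conjugates, which
makes the full-rank event measurable. -/
lemma mulVec_injective_iff_det_gram (A : Matrix (Fin n) (Fin m) ℂ) :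
    Function.Injective A.mulVec ↔ (Aᴴ * A).det ≠ 0 := by
  refine ⟨fun hA => (isUnit_det_gram hA).ne_zero, fun hA => ?_⟩
  have h : Function.Injective (Aᴴ * A).mulVec :=
    Matrix.mulVec_injective_of_isUnit ((Matrix.isUnit_iff_isUnit_det _).2 hA.isUnit)
  refine Function.Injective.of_comp (f := Aᴴ.mulVec) ?_
  convert h using 1
  funext y
  simp [Matrix.mulVec_mulVec]

lemma zfOutput_eq {F : Matrix (Fin m) (Fin m) ℂ} {H : Matrix (Fin n) (Fin m) ℂ}
    (hA : Function.Injective (H * F).mulVec) (s : Fin m → ℂ) (ξ : Fin n → ℂ) :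
    zfOutput F H s ξ = s + pinv (H * F) *ᵥ ξ := by
  rw [zfOutput, Matrix.mulVec_add, Matrix.mulVec_mulVec, pinv, Matrix.mul_assoc _ _ (H * F),
    Matrix.nonsing_inv_mul _ (isUnit_det_gram hA), Matrix.one_mulVec]

lemma pinv_mul_conjTranspose {A : Matrix (Fin n) (Fin m) ℂ}
    (hA : Function.Injective A.mulVec) : pinv A * (pinv A)ᴴ = (Aᴴ * A)⁻¹ := by
  rw [pinv, Matrix.conjTranspose_mul, Matrix.conjTranspose_conjTranspose,
    Matrix.conjTranspose_nonsing_inv, (isHermitian_conjTranspose_mul_self A).eq,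
    Matrix.mul_assoc, ← Matrix.mul_assoc Aᴴ, Matrix.mul_nonsing_inv _ (isUnit_det_gram hA),
    Matrix.mul_one]

lemma gram_inv_diag {A : Matrix (Fin n) (Fin m) ℂ} (hA : Function.Injective A.mulVec)
    (k : Fin m) : (Aᴴ * A)⁻¹ k k = ((((Aᴴ * A)⁻¹ k k).re : ℝ) : ℂ) ∧
      0 < ((Aᴴ * A)⁻¹ k k).re := by
  have h := (posDef_gram hA).inv.diag_pos (i := k)
  rw [Complex.lt_def] at h
  exact ⟨Complex.ext rfl (by simpa using h.2.symm), h.1⟩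

lemma zfGain_pos {A : Matrix (Fin n) (Fin m) ℂ} (hA : Function.Injective A.mulVec)
    (k : Fin m) : 0 < zfGain A k :=
  inv_pos.2 (gram_inv_diag hA k).2

/-- The gain is the squared norm of the projection of the `k`-th column onto the orthogonal
complement of the other columns. -/
lemma sum_inner_sq_eq_zfGain {A : Matrix (Fin n) (Fin m) ℂ} (hA : Function.Injective A.mulVec)
    (k : Fin m) {ι : Type*} [Fintype ι] (w : OrthonormalBasis ι ℂ (otherSpan A k)ᗮ)
    {e : EuclideanSpace ℂ (Fin n)} (he : e - ecol A k ∈ otherSpan A k) :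
    ∑ i, ‖⟪(w i : EuclideanSpace ℂ (Fin n)), e⟫_ℂ‖ ^ 2 = zfGain A k := by
  set g := ((Aᴴ * A)⁻¹ k k).re with hg
  obtain ⟨hg1, hg0⟩ := gram_inv_diag hA k
  -- `y` is the `k`-th column of the inverse Gram matrix, so `p = A y` is the dual vector of column
  -- `k`: orthogonal to the other columns, with inner product 1 with column `k`. Both its squared
  -- norm and its `k`-th coefficient equal `g`.
  set y : Fin m → ℂ := (Aᴴ * A)⁻¹ *ᵥ Pi.single k 1 with hy
  have hyk : y k = g := by rw [hy, Matrix.mulVec_single_one]; exact hg1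
  set p : EuclideanSpace ℂ (Fin n) := WithLp.toLp 2 (A *ᵥ y) with hp
  have hbp : ∀ j, ⟪ecol A j, p⟫_ℂ = (Pi.single k 1 : Fin m → ℂ) j := fun j => by
    rw [hp, inner_ecol, hy, Matrix.mulVec_mulVec, Matrix.mulVec_mulVec,
      Matrix.mul_nonsing_inv _ (isUnit_det_gram hA), Matrix.one_mulVec]
  have hpK : p ∈ (otherSpan A k)ᗮ := by
    rw [otherSpan, Submodule.mem_orthogonal]
    intro u hu
    induction hu using Submodule.span_induction with
    | mem x hx =>
      obtain ⟨j, hj, rfl⟩ := hx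
      rw [hbp, Pi.single_eq_of_ne hj]
    | zero => simp
    | add x y _ _ hx hy => rw [inner_add_left, hx, hy, add_zero]
    | smul a x _ hx => rw [inner_smul_left, hx, mul_zero]
  have hwK : ∀ i, ∀ u ∈ otherSpan A k, ⟪(w i : EuclideanSpace ℂ (Fin n)), u⟫_ℂ = 0 :=
    fun i u hu => Submodule.inner_left_of_mem_orthogonal hu (w i).2
  -- The orthogonal complement sees only the `k`-th term of `p = ∑ j, y j • ecol A j`, and does not
  -- distinguish `e` from column `k`.
  have hwp : ∀ i, ⟪(w i : EuclideanSpace ℂ (Fin n)), p⟫_ℂ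
      = g * ⟪(w i : EuclideanSpace ℂ (Fin n)), e⟫_ℂ := fun i => by
    have h1 : ⟪(w i : EuclideanSpace ℂ (Fin n)), e⟫_ℂ
        = ⟪(w i : EuclideanSpace ℂ (Fin n)), ecol A k⟫_ℂ := by
      have := hwK i _ he
      rwa [inner_sub_right, sub_eq_zero] at this
    rw [h1, hp, toLp_mulVec, inner_sum, Finset.sum_eq_single k, inner_smul_right, hyk]
    · intro j _ hj
      rw [inner_smul_right, hwK i _ (Submodule.subset_span ⟨j, hj, rfl⟩), mul_zero]
    · simp
  have hpn : ‖p‖ ^ 2 = g := by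
    have h1 : (⟪p, p⟫_ℂ) = ((‖p‖ ^ 2 : ℝ) : ℂ) := by
      rw [inner_self_eq_norm_sq_to_K]; norm_cast
    have h2 : ⟪p, p⟫_ℂ = (g : ℂ) := by
      rw [congrArg (fun q => ⟪q, p⟫_ℂ) (toLp_mulVec A y : p = _)]
      rw [sum_inner, Finset.sum_eq_single k]
      · rw [inner_smul_left, hbp, hyk]; simp
      · intro j _ hj
        rw [inner_smul_left, hbp, Pi.single_eq_of_ne hj, mul_zero]
      · simp
    exact_mod_cast h1.symm.trans h2
  have hsum : ∑ i, ‖⟪(w i : EuclideanSpace ℂ (Fin n)), p⟫_ℂ‖ ^ 2 = g := by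
    rw [← hpn]
    exact w.sum_sq_norm_inner_right ⟨p, hpK⟩
  simp_rw [hwp, norm_mul, mul_pow, ← Finset.mul_sum] at hsum
  rw [Complex.norm_real, Real.norm_eq_abs, sq_abs] at hsum
  rw [zfGain, ← hg]
  have : g * ∑ i, ‖⟪(w i : EuclideanSpace ℂ (Fin n)), e⟫_ℂ‖ ^ 2 = 1 := by
    have h := hsum
    rw [sq, mul_assoc] at h
    exact mul_left_cancel₀ hg0.ne' (h.trans (mul_one g).symm)
  exact eq_inv_of_mul_eq_one_right this

lemma otherSpan_eq_range (A : Matrix (Fin n) (Fin m) ℂ) (k : Fin m) :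
    otherSpan A k = Submodule.span ℂ (Set.range fun j : {j // j ≠ k} => ecol A j) := by
  rw [otherSpan, Set.image_eq_range]
  rfl

lemma finrank_otherSpan_le (A : Matrix (Fin n) (Fin m) ℂ) (k : Fin m) :
    Module.finrank ℂ (otherSpan A k) + 1 ≤ m := by
  rw [otherSpan_eq_range]
  have h := finrank_range_le_card (R := ℂ) fun j : {j // j ≠ k} => ecol A j
  have hc : Fintype.card {j // j ≠ k} = m - 1 := by
    rw [Fintype.card_subtype_compl]; simp
  have := k.pos
  rw [hc, Set.finrank] at h
  omega

lemma finrank_otherSpan {A : Matrix (Fin n) (Fin m) ℂ} (k : Fin m)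
    (hA : Function.Injective A.mulVec) :
    Module.finrank ℂ (otherSpan A k) + 1 = m := by
  rw [otherSpan_eq_range]
  have h := finrank_span_eq_card (R := ℂ) (b := fun j : {j // j ≠ k} => ecol A j)
    (((mulVec_injective_iff_linearIndependent_ecol A).1 hA).comp _ Subtype.val_injective)
  have hc : Fintype.card {j // j ≠ k} = m - 1 := by
    rw [Fintype.card_subtype_compl]; simp
  have := k.pos
  rw [hc] at h
  rw [h]
  omega

lemma mulVec_injective_of_notMem {A : Matrix (Fin n) (Fin m) ℂ}
    (hA : ∀ k, ecol A k ∉ otherSpan A k) : Function.Injective A.mulVec := by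
  rw [mulVec_injective_iff_linearIndependent_ecol, linearIndependent_iff_notMem_span]
  intro k
  rw [← Set.compl_eq_univ_sdiff]
  exact hA k

end Deterministic

/-! ### Measurability of matrix inverses, gains and the full-rank event -/

lemma measurable_det {Ω : Type*} [MeasurableSpace Ω] {m : ℕ}
    {A : Ω → Matrix (Fin m) (Fin m) ℂ} (hA : ∀ i j, Measurable fun ω => A ω i j) :
    Measurable fun ω => (A ω).det := by
  simp_rw [Matrix.det_apply]
  exact Finset.measurable_fun_sum _ fun σ _ =>
    (Finset.measurable_fun_prod _ fun i _ => hA _ _).const_smul _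

lemma measurable_matrix_inv {Ω : Type*} [MeasurableSpace Ω] {m : ℕ}
    {A : Ω → Matrix (Fin m) (Fin m) ℂ} (hA : ∀ i j, Measurable fun ω => A ω i j) (i j : Fin m) :
    Measurable fun ω => (A ω)⁻¹ i j := by
  simp_rw [Matrix.inv_def, Matrix.smul_apply, Ring.inverse_eq_inv', smul_eq_mul,
    Matrix.adjugate_apply]
  refine (measurable_det hA).inv.mul (measurable_det fun a b => ?_)
  by_cases h : a = j
  · subst h; simp
  · simp [Matrix.updateRow_ne h, hA]

lemma measurable_gram {Ω : Type*} [MeasurableSpace Ω] {n m : ℕ}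
    {A : Ω → Matrix (Fin n) (Fin m) ℂ} (hA : ∀ i j, Measurable fun ω => A ω i j) (i j : Fin m) :
    Measurable fun ω => ((A ω)ᴴ * A ω) i j := by
  simp_rw [Matrix.mul_apply, Matrix.conjTranspose_apply, RCLike.star_def]
  exact Finset.measurable_fun_sum _ fun l _ =>
    (Complex.continuous_conj.measurable.comp (hA l i)).mul (hA l j)

lemma measurable_zfGain {Ω : Type*} [MeasurableSpace Ω] {n m : ℕ}
    {A : Ω → Matrix (Fin n) (Fin m) ℂ} (hA : ∀ i j, Measurable fun ω => A ω i j) (k : Fin m) :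
    Measurable fun ω => zfGain (A ω) k :=
  (Complex.measurable_re.comp (measurable_matrix_inv (measurable_gram hA) k k)).inv

lemma measurableSet_mulVec_injective {Ω : Type*} [MeasurableSpace Ω] {n m : ℕ}
    {A : Ω → Matrix (Fin n) (Fin m) ℂ} (hA : ∀ i j, Measurable fun ω => A ω i j) :
    MeasurableSet {ω | Function.Injective (A ω).mulVec} := by
  simp_rw [mulVec_injective_iff_det_gram]
  exact (measurable_det (measurable_gram hA)) (measurableSet_singleton 0).compl

/-! ### Rayleigh channels and splitting off one column -/

/-- The channel `B` has independent rows whose conjugates are circular with covariance `C`. -/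
def IsRayleigh {Ω : Type*} [MeasurableSpace Ω] {n m : ℕ} (B : Ω → Matrix (Fin n) (Fin m) ℂ)
    (C : Matrix (Fin m) (Fin m) ℂ) (P : Measure Ω) : Prop :=
  IsCircularGaussian (fun ω (p : Fin n × Fin m) => conj (B ω p.1 p.2))
    ((1 : Matrix (Fin n) (Fin n) ℂ) ⊗ₖ C) P

variable {Ω : Type*} [MeasurableSpace Ω] {P : Measure Ω} {n m : ℕ}
  {B : Ω → Matrix (Fin n) (Fin m) ℂ} {C : Matrix (Fin m) (Fin m) ℂ}

/-- On the vectorized conjugate channel, right multiplication by `F` acts as `1 ⊗ Fᴴ`. -/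
lemma IsRayleigh.mul (h : IsRayleigh B C P) (F : Matrix (Fin m) (Fin m) ℂ) :
    IsRayleigh (fun ω => B ω * F) (Fᴴ * C * F) P := by
  have := IsCircularGaussian.linear h ((1 : Matrix (Fin n) (Fin n) ℂ) ⊗ₖ Fᴴ)
  rw [Matrix.conjTranspose_kronecker, ← Matrix.mul_kronecker_mul, ← Matrix.mul_kronecker_mul,
    Matrix.conjTranspose_one, Matrix.conjTranspose_conjTranspose, Matrix.one_mul,
    Matrix.one_mul] at this
  refine (congrArg (fun Z => IsCircularGaussian Z _ P) ?_).mp this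
  funext ω p
  simp only [Matrix.mulVec, dotProduct, Fintype.sum_prod_type, Matrix.kroneckerMap_apply,
    Matrix.one_apply, Matrix.mul_apply, map_sum, map_mul, Matrix.conjTranspose_apply,
    RCLike.star_def]
  rw [Finset.sum_eq_single p.1]
  · simp [mul_comm]
  · intro i _ hi
    simp [hi.symm]
  · simp

/-- The matrix whose conjugate has the given `k`-th column and other columns. -/
noncomputable def assemble (k : Fin m) (x : Fin n × {j // j ≠ k} → ℂ) (e : Fin n → ℂ) :
    Matrix (Fin n) (Fin m) ℂ :=
  Matrix.of fun l j => if h : j = k then conj (e l) else conj (x (l, ⟨j, h⟩))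

lemma assemble_conj (k : Fin m) (A : Matrix (Fin n) (Fin m) ℂ) :
    assemble k (fun p => conj (A p.1 p.2)) (fun l => conj (A l k)) = A := by
  ext l j
  by_cases h : j = k
  · subst h; simp [assemble]
  · simp [assemble, h]

lemma ecol_assemble_of_ne {k : Fin m} (x : Fin n × {j // j ≠ k} → ℂ) (e : Fin n → ℂ)
    {j : Fin m} (h : j ≠ k) :
    ecol (assemble k x e) j = WithLp.toLp 2 fun l => conj (x (l, ⟨j, h⟩)) := by
  simp [ecol, assemble, h]

lemma ecol_assemble_self (k : Fin m) (x : Fin n × {j // j ≠ k} → ℂ) (e : Fin n → ℂ) :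
    ecol (assemble k x e) k = WithLp.toLp 2 fun l => conj (e l) := by
  simp [ecol, assemble]

lemma otherSpan_assemble (k : Fin m) (x : Fin n × {j // j ≠ k} → ℂ) (e e' : Fin n → ℂ) :
    otherSpan (assemble k x e) k = otherSpan (assemble k x e') k := by
  rw [otherSpan, otherSpan]
  congr 1
  refine Set.image_congr fun j hj => ?_
  rw [ecol_assemble_of_ne _ _ hj, ecol_assemble_of_ne _ _ hj]

lemma measurable_assemble (k : Fin m) (l : Fin n) (j : Fin m) :
    Measurable fun q : (Fin n × {j // j ≠ k} → ℂ) × (Fin n → ℂ) => assemble k q.1 q.2 l j := by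
  by_cases h : j = k
  · simp only [assemble, Matrix.of_apply, h, dite_true]
    exact Complex.continuous_conj.measurable.comp ((measurable_pi_apply l).comp measurable_snd)
  · simp only [assemble, Matrix.of_apply, h, dite_false]
    exact Complex.continuous_conj.measurable.comp ((measurable_pi_apply _).comp measurable_fst)

/-- A σ-compact source makes the range a countable union of compact sets. -/
lemma measurableSet_range_of_continuous {α β : Type*} [TopologicalSpace α] [SigmaCompactSpace α]
    [TopologicalSpace β] [T2Space β] [MeasurableSpace β] [OpensMeasurableSpace β] {f : α → β}
    (hf : Continuous f) : MeasurableSet (Set.range f) := by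
  rw [← Set.image_univ, ← iUnion_compactCovering α, Set.image_iUnion]
  exact MeasurableSet.iUnion fun i => ((isCompact_compactCovering α i).image hf).measurableSet

/-- The degenerate configurations are parametrized continuously by the other columns and the
coefficients of the combination, hence form the range of a continuous map. -/
lemma measurableSet_mem_otherSpan (k : Fin m) :
    MeasurableSet {q : (Fin n × {j // j ≠ k} → ℂ) × (Fin n → ℂ) |
      ecol (assemble k q.1 q.2) k ∈ otherSpan (assemble k q.1 q.2) k} := by
  let f : (Fin n × {j // j ≠ k} → ℂ) × ({j // j ≠ k} → ℂ) →
      (Fin n × {j // j ≠ k} → ℂ) × (Fin n → ℂ) :=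
    fun q => (q.1, fun l => ∑ j, q.2 j * q.1 (l, j))
  have hf : Continuous f := by fun_prop
  convert! measurableSet_range_of_continuous hf
  ext ⟨x, e⟩
  simp only [Set.mem_ofPred_eq, Set.mem_range]
  rw [otherSpan_eq_range, Submodule.mem_span_range_iff_exists_fun]
  have hj : ∀ j : {j // j ≠ k}, ecol (assemble k x e) j
      = WithLp.toLp 2 fun l => conj (x (l, j)) := fun j => ecol_assemble_of_ne x e j.2
  simp only [hj, ecol_assemble_self]
  constructor
  · rintro ⟨c, hc⟩
    refine ⟨(x, fun j => conj (c j)), Prod.ext rfl (funext fun l => ?_)⟩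
    have := congrArg (fun v : EuclideanSpace ℂ (Fin n) => conj (v l)) hc
    simpa using this
  · rintro ⟨⟨x', c⟩, hc⟩
    obtain ⟨rfl, rfl⟩ := Prod.mk.inj hc
    refine ⟨fun j => conj (c j), ?_⟩
    ext l
    simp

/-! ### Law of the gain when one column is uncorrelated with the others -/

section Decoupled

variable {k : Fin m} {v : ℝ≥0}

lemma IsRayleigh.indep_column (h : IsRayleigh B C P) (hC : ∀ j, j ≠ k → C j k = 0) :
    IndepFun (fun ω (p : Fin n × {j // j ≠ k}) => conj (B ω p.1 p.2))
      (fun ω l => conj (B ω l k)) P :=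
  IsCircularGaussian.indepFun h (fun p : Fin n × {j // j ≠ k} => (p.1, (p.2 : Fin m)))
    (fun l => (l, k)) fun i j => by simp [hC _ i.2.2]

lemma IsRayleigh.column (h : IsRayleigh B C P) (hk : C k k = (v : ℝ)) :
    IsCircularGaussian (fun ω l => conj (B ω l k)) (((v : ℝ) : ℂ) • 1) P := by
  have := IsCircularGaussian.comp h fun l : Fin n => (l, k)
  convert! this using 1
  ext i j
  simp [Matrix.one_apply, hk]

lemma IsRayleigh.map_prod (h : IsRayleigh B C P) (hC : ∀ j, j ≠ k → C j k = 0) :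
    P.map (fun ω => ((fun p : Fin n × {j // j ≠ k} => conj (B ω p.1 p.2)),
        fun l => conj (B ω l k)))
      = (P.map fun ω (p : Fin n × {j // j ≠ k}) => conj (B ω p.1 p.2)).prod
        (P.map fun ω l => conj (B ω l k)) := by
  have hP := IsCircularGaussian.gaussian h |>.isProbabilityMeasure
  refine (indepFun_iff_map_prod_eq_prod_map_map ?_ ?_).1 (h.indep_column hC)
  · exact (IsCircularGaussian.comp h
      fun p : Fin n × {j // j ≠ k} => (p.1, (p.2 : Fin m))).gaussian.aemeasurable
  · exact (IsCircularGaussian.comp h fun l : Fin n => (l, k)).gaussian.aemeasurable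

/-- Coordinates of a white circular Gaussian vector in an orthonormal system are white. -/
lemma IsCircularGaussian.inner_orthonormal {e : Ω → Fin n → ℂ}
    (h : IsCircularGaussian e (((v : ℝ) : ℂ) • 1) P) {ι : Type*} [Fintype ι] [DecidableEq ι]
    {w : ι → EuclideanSpace ℂ (Fin n)} (hw : Orthonormal ℂ w) :
    IsCircularGaussian
      (fun ω i => conj ⟪w i, WithLp.toLp 2 fun l => conj (e ω l)⟫_ℂ) (((v : ℝ) : ℂ) • 1) P := by
  have := h.linear (Matrix.of fun i l => w i l : Matrix ι (Fin n) ℂ)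
  convert! this using 1
  · funext ω i
    simp [Matrix.mulVec, dotProduct, PiLp.inner_apply, mul_comm]
  · rw [Matrix.mul_smul, Matrix.mul_one, Matrix.smul_mul]
    congr 1
    ext i j
    have := orthonormal_iff_ite.1 hw j i
    rw [Matrix.one_apply, Matrix.mul_apply]
    simp only [PiLp.inner_apply] at this
    simp only [Matrix.of_apply, Matrix.conjTranspose_apply]
    rw [if_congr (eq_comm (a := i)) rfl rfl, ← this]
    exact Finset.sum_congr rfl fun l _ => by simp

lemma cgauss_singleton (hv : v ≠ 0) (z : ℂ) : cgauss v {z} = 0 := by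
  rw [cgauss_eq_withDensity hv]
  exact withDensity_absolutelyContinuous _ _ (measure_singleton z)

/-- A proper subspace has a unit normal vector; membership forces the coordinate along it to vanish,
but this coordinate is a nondegenerate Gaussian and has no atoms. -/
lemma IsCircularGaussian.ae_notMem {e : Ω → Fin n → ℂ}
    (h : IsCircularGaussian e (((v : ℝ) : ℂ) • 1) P) (hv : v ≠ 0)
    {K : Submodule ℂ (EuclideanSpace ℂ (Fin n))} (hK : Module.finrank ℂ K < n) :
    ∀ᵐ ω ∂P, WithLp.toLp 2 (fun l => conj (e ω l)) ∉ K := by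
  have hd := K.finrank_add_finrank_orthogonal
  rw [finrank_euclideanSpace_fin] at hd
  let w := stdOrthonormalBasis ℂ Kᗮ
  have hw : Orthonormal ℂ fun i => (w i : EuclideanSpace ℂ (Fin n)) :=
    w.orthonormal.comp_linearIsometry Kᗮ.subtypeₗᵢ
  let i₀ : Fin (Module.finrank ℂ Kᗮ) := ⟨0, by omega⟩
  have hc := h.inner_orthonormal hw
  have hm := hc.map_eq_cgauss i₀ (v := v) (by simp)
  have h0 : ∀ᵐ z ∂(cgauss v), z ≠ 0 := by
    rw [ae_iff]; simpa using cgauss_singleton hv 0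
  rw [← hm] at h0
  filter_upwards [ae_of_ae_map (hc.memLp i₀).aemeasurable h0] with ω hω hmem
  apply hω
  rw [Submodule.inner_left_of_mem_orthogonal hmem (w i₀).2, map_zero]

/-- By Fubini the other columns may be frozen; they span a subspace of dimension at most `m - 1 <
n`, which the independent `k`-th column almost surely avoids. -/
lemma IsRayleigh.ae_notMem_of_decoupled (h : IsRayleigh B C P) (hmn : m ≤ n)
    (hC : ∀ j, j ≠ k → C j k = 0) (hv : v ≠ 0) (hk : C k k = (v : ℝ)) :
    ∀ᵐ ω ∂P, ecol (B ω) k ∉ otherSpan (B ω) k := by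
  have hP := IsCircularGaussian.gaussian h |>.isProbabilityMeasure
  have hcol := h.column hk
  have hoth := IsCircularGaussian.comp h
      fun p : Fin n × {j // j ≠ k} => (p.1, (p.2 : Fin m))
  have hae : ∀ᵐ q ∂(P.map fun ω => ((fun p : Fin n × {j // j ≠ k} => conj (B ω p.1 p.2)),
        fun l => conj (B ω l k))),
      ecol (assemble k q.1 q.2) k ∉ otherSpan (assemble k q.1 q.2) k := by
    rw [h.map_prod hC, ae_iff]
    simp only [not_not]
    have := Measure.isProbabilityMeasure_map (μ := P) hcol.gaussian.aemeasurable
    rw [Measure.measure_prod_null (measurableSet_mem_otherSpan k)]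
    refine ae_of_all _ fun x => ?_
    have hx := hcol.ae_notMem hv (K := otherSpan (assemble k x 0) k) (by
      have := finrank_otherSpan_le (assemble k x (0 : Fin n → ℂ)) k
      omega)
    have hs : MeasurableSet (Prod.mk x ⁻¹' {q : (Fin n × {j // j ≠ k} → ℂ) × (Fin n → ℂ) |
      ecol (assemble k q.1 q.2) k ∈ otherSpan (assemble k q.1 q.2) k}) :=
      (measurableSet_mem_otherSpan k).preimage measurable_prodMk_left
    refine (Measure.map_apply_of_aemeasurable hcol.gaussian.aemeasurable hs).trans ?_
    rw [ae_iff] at hx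
    simp only [not_not] at hx
    refine Eq.trans (congrArg P (Set.ext fun ω => ?_)) hx
    change ecol (assemble k x fun l => conj (B ω l k)) k
      ∈ otherSpan (assemble k x fun l => conj (B ω l k)) k ↔ _ ∈ otherSpan (assemble k x 0) k
    rw [otherSpan_assemble k x _ 0, ecol_assemble_self]
  have := ae_of_ae_map (hoth.gaussian.aemeasurable.prodMk hcol.gaussian.aemeasurable) hae
  filter_upwards [this] with ω hω
  rwa [assemble_conj] at hω

/-- With the other columns frozen, the gain is the sum of the squared coordinates of the `k`-th
column along an orthonormal basis of a fixed space of dimension `n - m + 1`. The conditional Laplace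
transform does not depend on the frozen columns. -/
lemma IsRayleigh.integral_exp_of_decoupled (h : IsRayleigh B C P) (hmn : m ≤ n)
    (hinj : ∀ᵐ ω ∂P, Function.Injective (B ω).mulVec)
    (hC : ∀ j, j ≠ k → C j k = 0) (hv : v ≠ 0) (hk : C k k = (v : ℝ)) {t : ℝ} (ht : 0 ≤ t) :
    ∫ ω, Real.exp (-t * zfGain (B ω) k) ∂P = ((1 + t * v)⁻¹) ^ (n - m + 1) := by
  have hP := IsCircularGaussian.gaussian h |>.isProbabilityMeasure
  have hcol := h.column hk
  have hoth := IsCircularGaussian.comp h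
      fun p : Fin n × {j // j ≠ k} => (p.1, (p.2 : Fin m))
  have hmeas := hoth.gaussian.aemeasurable.prodMk hcol.gaussian.aemeasurable
  have hPc := Measure.isProbabilityMeasure_map (μ := P) hcol.gaussian.aemeasurable
  have hPo := Measure.isProbabilityMeasure_map (μ := P) hoth.gaussian.aemeasurable
  have hdet : MeasurableSet {q : (Fin n × {j // j ≠ k} → ℂ) × (Fin n → ℂ) |
      Function.Injective (assemble k q.1 q.2).mulVec} :=
    measurableSet_mulVec_injective (measurable_assemble k)
  have hφ : Measurable fun q : (Fin n × {j // j ≠ k} → ℂ) × (Fin n → ℂ) =>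
      Real.exp (-t * zfGain (assemble k q.1 q.2) k) :=
    ((measurable_zfGain (measurable_assemble k) k).const_mul _).exp
  have hae : ∀ᵐ q ∂((P.map fun ω (p : Fin n × {j // j ≠ k}) => conj (B ω p.1 p.2)).prod
        (P.map fun ω l => conj (B ω l k))), Function.Injective (assemble k q.1 q.2).mulVec := by
    rw [← h.map_prod hC, ae_map_iff hmeas hdet]
    filter_upwards [hinj] with ω hω
    rwa [assemble_conj]
  have hint : Integrable (fun q : (Fin n × {j // j ≠ k} → ℂ) × (Fin n → ℂ) =>
      Real.exp (-t * zfGain (assemble k q.1 q.2) k))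
      ((P.map fun ω (p : Fin n × {j // j ≠ k}) => conj (B ω p.1 p.2)).prod
        (P.map fun ω l => conj (B ω l k))) := by
    refine Integrable.of_bound hφ.aestronglyMeasurable 1 ?_
    filter_upwards [hae] with q hq
    rw [Real.norm_eq_abs, abs_of_pos (Real.exp_pos _), Real.exp_le_one_iff]
    have := (zfGain_pos hq k).le
    nlinarith
  have hstep : ∫ ω, Real.exp (-t * zfGain (B ω) k) ∂P
      = ∫ q, Real.exp (-t * zfGain (assemble k q.1 q.2) k)
        ∂(P.map fun ω => ((fun p : Fin n × {j // j ≠ k} => conj (B ω p.1 p.2)),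
          fun l => conj (B ω l k))) := by
    rw [integral_map hmeas hφ.aestronglyMeasurable]
    simp only [assemble_conj]
  rw [hstep, h.map_prod hC, integral_prod _ hint]
  have hx : ∀ᵐ x ∂(P.map fun ω (p : Fin n × {j // j ≠ k}) => conj (B ω p.1 p.2)),
      ∫ e, Real.exp (-t * zfGain (assemble k x e) k) ∂(P.map fun ω l => conj (B ω l k))
        = ((1 + t * v)⁻¹) ^ (n - m + 1) := by
    filter_upwards [Measure.ae_ae_of_ae_prod hae] with x hx
    -- One full-rank completion shows that the frozen columns are independent, so the orthogonal
    -- complement has dimension exactly `n - m + 1`.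
    obtain ⟨e₀, he₀⟩ := hx.exists
    have hd := (otherSpan (assemble k x e₀) k).finrank_add_finrank_orthogonal
    rw [finrank_euclideanSpace_fin] at hd
    have hd' := finrank_otherSpan k he₀
    have hcard : Module.finrank ℂ (otherSpan (assemble k x e₀) k)ᗮ = n - m + 1 := by omega
    let w := (stdOrthonormalBasis ℂ (otherSpan (assemble k x e₀) k)ᗮ).reindex (finCongr hcard)
    have hw : Orthonormal ℂ fun i => (w i : EuclideanSpace ℂ (Fin n)) :=
      w.orthonormal.comp_linearIsometry (otherSpan (assemble k x e₀) k)ᗮ.subtypeₗᵢ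
    have hfin := (hcol.inner_orthonormal hw).integral_exp_neg_sum hv rfl ht
    rw [Fintype.card_fin] at hfin
    rw [← hfin]
    refine (integral_map (f := fun e => Real.exp (-t * zfGain (assemble k x e) k))
      hcol.gaussian.aemeasurable
      (hφ.comp measurable_prodMk_left).aestronglyMeasurable).trans ?_
    refine integral_congr_ae ?_
    filter_upwards [ae_of_ae_map hcol.gaussian.aemeasurable hx] with ω hω
    rw [← sum_inner_sq_eq_zfGain hω k (w.map (LinearIsometryEquiv.ofEq _ _ (by
      rw [otherSpan_assemble k x e₀]))) (e := ecol (assemble k x fun l => conj (B ω l k)) k)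
      (by simp), ecol_assemble_self]
    refine congrArg (fun r => Real.exp (-t * r)) (Finset.sum_congr rfl fun i _ => ?_)
    rw [RCLike.norm_conj]
    rfl
  rw [integral_congr_ae hx]
  simp

end Decoupled

/-! ### Reduction of a general covariance to the decoupled case -/

/-- The matrix replacing the `k`-th column by the combination of the columns that is uncorrelated
with the other columns. -/
noncomputable def decouple (C : Matrix (Fin m) (Fin m) ℂ) (k : Fin m) :
    Matrix (Fin m) (Fin m) ℂ :=
  (1 : Matrix (Fin m) (Fin m) ℂ).updateCol k fun i => C⁻¹ i k / C⁻¹ k k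

lemma decouple_mulVec (C : Matrix (Fin m) (Fin m) ℂ) (k : Fin m) (y : Fin m → ℂ) (i : Fin m) :
    (decouple C k *ᵥ y) i = (if i = k then 0 else y i) + C⁻¹ i k / C⁻¹ k k * y k := by
  rw [Matrix.mulVec, dotProduct, ← Finset.sum_erase_add _ _ (Finset.mem_univ k)]
  congr 1
  · rw [Finset.sum_congr rfl fun j hj => by
      rw [decouple, Matrix.updateCol_ne (Finset.ne_of_mem_erase hj), Matrix.one_apply, ite_mul,
        one_mul, zero_mul]]
    rw [Finset.sum_ite_eq]
    simp [ite_not]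
  · simp [decouple]

lemma decouple_injective {k : Fin m} (hk : C⁻¹ k k ≠ 0) :
    Function.Injective (decouple C k).mulVec := by
  rw [← Matrix.coe_mulVecLin, injective_iff_map_eq_zero]
  intro y hy
  have h : ∀ i, (decouple C k *ᵥ y) i = 0 := fun i => congrFun hy i
  simp_rw [decouple_mulVec] at h
  have hyk : y k = 0 := by
    have := h k
    rwa [if_pos rfl, div_self hk, one_mul, zero_add] at this
  funext i
  have := h i
  by_cases hi : i = k
  · rw [hi, hyk]; rfl
  · rwa [hyk, mul_zero, add_zero, if_neg hi] at this

lemma ecol_mul_decouple_of_ne (A : Matrix (Fin n) (Fin m) ℂ) {k j : Fin m} (h : j ≠ k) :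
    ecol (A * decouple C k) j = ecol A j := by
  ext i
  simp [ecol, decouple, Matrix.mul_apply, Matrix.updateCol_ne h, Matrix.one_apply]

lemma otherSpan_mul_decouple (A : Matrix (Fin n) (Fin m) ℂ) (k : Fin m) :
    otherSpan (A * decouple C k) k = otherSpan A k := by
  rw [otherSpan, otherSpan]
  congr 1
  exact Set.image_congr fun j hj => ecol_mul_decouple_of_ne A hj

/-- The coefficient of column `k` itself in the combination is 1, so only other columns are added.
-/
lemma ecol_mul_decouple_sub_mem (A : Matrix (Fin n) (Fin m) ℂ) {k : Fin m} (hk : C⁻¹ k k ≠ 0) :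
    ecol (A * decouple C k) k - ecol A k ∈ otherSpan A k := by
  have h : ecol (A * decouple C k) k = ∑ j, (C⁻¹ j k / C⁻¹ k k) • ecol A j := by
    rw [← toLp_mulVec]
    ext i
    simp [ecol, decouple, Matrix.mul_apply, Matrix.mulVec, dotProduct]
  rw [h, ← Finset.sum_erase_add _ _ (Finset.mem_univ k), div_self hk, one_smul,
    add_sub_cancel_right]
  exact Submodule.sum_mem _ fun j hj => Submodule.smul_mem _ _
    (Submodule.subset_span ⟨j, Finset.ne_of_mem_erase hj, rfl⟩)

lemma ecol_mem_otherSpan_decouple (A : Matrix (Fin n) (Fin m) ℂ) {k : Fin m}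
    (hk : C⁻¹ k k ≠ 0) :
    ecol (A * decouple C k) k ∈ otherSpan (A * decouple C k) k ↔ ecol A k ∈ otherSpan A k := by
  rw [otherSpan_mul_decouple, ← Submodule.sub_mem_iff_left _ (ecol_mul_decouple_sub_mem A hk),
    sub_sub_cancel]

/-- The distance from column `k` to the span of the others ignores any multiple of the others added
to it. -/
lemma zfGain_mul_decouple {A : Matrix (Fin n) (Fin m) ℂ} (hA : Function.Injective A.mulVec)
    {k : Fin m} (hk : C⁻¹ k k ≠ 0) : zfGain (A * decouple C k) k = zfGain A k := by
  have hAT : Function.Injective (A * decouple C k).mulVec := by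
    have := hA.comp (decouple_injective hk)
    convert this using 1
    funext y
    simp [Matrix.mulVec_mulVec]
  rw [← sum_inner_sq_eq_zfGain hA k (stdOrthonormalBasis ℂ _) (ecol_mul_decouple_sub_mem A hk),
    ← sum_inner_sq_eq_zfGain hAT k ((stdOrthonormalBasis ℂ (otherSpan A k)ᗮ).map
      (LinearIsometryEquiv.ofEq _ _ (by rw [otherSpan_mul_decouple])))
      (e := ecol (A * decouple C k) k) (by simp)]
  simp

/-- The new column has coefficient vector `C⁻¹ e_k / (C⁻¹)_kk`, which `C` sends to `e_k / (C⁻¹)_kk`.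
Rows `j ≠ k` of the transposed decoupling matrix are basis vectors and therefore give zero. -/
lemma decouple_cov (hC : C.PosDef) (k : Fin m) :
    (∀ j, j ≠ k → ((decouple C k)ᴴ * C * decouple C k) j k = 0) ∧
      ((decouple C k)ᴴ * C * decouple C k) k k = (C⁻¹ k k)⁻¹ := by
  have hk : C⁻¹ k k ≠ 0 := (hC.inv.diag_pos (i := k)).ne'
  have hdet : IsUnit C.det := (Matrix.isUnit_iff_isUnit_det _).1 hC.isUnit
  have h1 : ∀ i, (C * decouple C k) i k = if i = k then (C⁻¹ k k)⁻¹ else 0 := fun i => by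
    have : (C * C⁻¹) i k = (1 : Matrix (Fin m) (Fin m) ℂ) i k := by
      rw [Matrix.mul_nonsing_inv _ hdet]
    rw [Matrix.mul_apply, Matrix.one_apply] at this
    simp only [Matrix.mul_apply, decouple, Matrix.updateCol_self, div_eq_mul_inv, ← mul_assoc]
    rw [← Finset.sum_mul, this]
    split_ifs <;> simp
  have h2 : ∀ j, ((decouple C k)ᴴ * C * decouple C k) j k
      = conj (decouple C k k j) * (C⁻¹ k k)⁻¹ := fun j => by
    rw [Matrix.mul_assoc, Matrix.mul_apply, Finset.sum_eq_single k]
    · simp [h1]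
    · intro i _ hi
      simp [h1, hi]
    · simp
  refine ⟨fun j hj => ?_, ?_⟩
  · rw [h2, decouple, Matrix.updateCol_ne hj, Matrix.one_apply_ne hj.symm]
    simp
  · rw [h2, decouple, Matrix.updateCol_self, div_self hk]
    simp

lemma posDef_diag_coe (hC : C.PosDef) (k : Fin m) :
    ∃ v : ℝ≥0, v ≠ 0 ∧ C k k = (v : ℝ) := by
  have h := hC.diag_pos (i := k)
  rw [Complex.lt_def] at h
  refine ⟨⟨(C k k).re, h.1.le⟩, fun h0 => h.1.ne' (congrArg NNReal.toReal h0), ?_⟩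
  exact Complex.ext rfl (by simpa using h.2.symm)

/-- Each column in turn is decoupled from the rest, hence almost surely outside their span;
excluding all these null events gives linear independence. -/
lemma IsRayleigh.ae_injective (h : IsRayleigh B C P) (hmn : m ≤ n) (hC : C.PosDef) :
    ∀ᵐ ω ∂P, Function.Injective (B ω).mulVec := by
  have : ∀ᵐ ω ∂P, ∀ k, ecol (B ω) k ∉ otherSpan (B ω) k := by
    rw [ae_all_iff]
    intro k
    obtain ⟨v, hv, h1⟩ := posDef_diag_coe hC.inv k
    have hk : C⁻¹ k k ≠ 0 := (hC.inv.diag_pos (i := k)).ne'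
    filter_upwards [(h.mul (decouple C k)).ae_notMem_of_decoupled (v := v⁻¹) hmn
      (decouple_cov hC k).1 (inv_ne_zero hv)
      (by rw [(decouple_cov hC k).2, h1]; push_cast; rfl)] with ω hω
    rwa [ecol_mem_otherSpan_decouple _ hk] at hω
  filter_upwards [this] with ω hω using mulVec_injective_of_notMem hω

/-- The zero-forcing gain is Gamma distributed, expressed through its Laplace transform. -/
lemma IsRayleigh.integral_exp_zfGain (h : IsRayleigh B C P) (hmn : m ≤ n) (hC : C.PosDef)
    (k : Fin m) {t : ℝ} (ht : 0 ≤ t) :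
    ∫ ω, Real.exp (-t * zfGain (B ω) k) ∂P = ((1 + t / (C⁻¹ k k).re)⁻¹) ^ (n - m + 1) := by
  obtain ⟨v, hv, h1⟩ := posDef_diag_coe hC.inv k
  have hk : C⁻¹ k k ≠ 0 := (hC.inv.diag_pos (i := k)).ne'
  have hinj := h.ae_injective hmn hC
  have := (h.mul (decouple C k)).integral_exp_of_decoupled (v := v⁻¹) hmn
      (by
        filter_upwards [hinj] with ω hω
        have := hω.comp (decouple_injective hk)
        convert this using 1
        funext y
        simp [Matrix.mulVec_mulVec])
      (decouple_cov hC k).1 (inv_ne_zero hv)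
      (by rw [(decouple_cov hC k).2, h1]; push_cast; rfl) ht
  rw [div_eq_mul_inv, h1, Complex.ofReal_re, ← NNReal.coe_inv]
  refine Eq.trans (integral_congr_ae ?_) this
  filter_upwards [hinj] with ω hω
  rw [zfGain_mul_decouple hω hk]

/-! ### Null sets of the complex Gaussian and minimum-distance decisions -/

lemma cgauss_re_im (v : ℝ≥0) {A B : Set ℝ} (hA : MeasurableSet A) (hB : MeasurableSet B) :
    cgauss v {z | z.re ∈ A ∧ z.im ∈ B} = gaussianReal 0 (v / 2) A * gaussianReal 0 (v / 2) B := by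
  have hm : MeasurableSet {z : ℂ | z.re ∈ A ∧ z.im ∈ B} :=
    (Complex.measurable_re hA).inter (Complex.measurable_im hB)
  rw [cgauss, Measure.map_apply Complex.measurableEquivRealProd.symm.measurable hm,
    ← Measure.prod_prod]
  congr 1

lemma cgauss_re (v : ℝ≥0) {A : Set ℝ} (hA : MeasurableSet A) :
    cgauss v {z | z.re ∈ A} = gaussianReal 0 (v / 2) A := by
  simpa using cgauss_re_im v hA MeasurableSet.univ

lemma cgauss_im (v : ℝ≥0) {A : Set ℝ} (hA : MeasurableSet A) :
    cgauss v {z | z.im ∈ A} = gaussianReal 0 (v / 2) A := by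
  simpa using cgauss_re_im v MeasurableSet.univ hA

/-- The density depends on the norm alone, and real-linear isometries preserve Lebesgue measure. -/
lemma cgauss_preimage {v : ℝ≥0} (hv : v ≠ 0) (e : ℂ ≃ₗᵢ[ℝ] ℂ) (A : Set ℂ) :
    cgauss v (e ⁻¹' A) = cgauss v A := by
  have : (cgauss v).map e = cgauss v := by
    ext s hs
    rw [Measure.map_apply e.continuous.measurable hs, cgauss_eq_withDensity hv,
      withDensity_apply _ hs, withDensity_apply _ (e.continuous.measurable hs)]
    have := e.measurePreserving.setLIntegral_comp_preimage_emb
        e.toHomeomorph.toMeasurableEquiv.measurableEmbedding (fun z : ℂ =>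
          ENNReal.ofReal ((Real.pi * v)⁻¹ * Real.exp (-(‖z‖ ^ 2 / v)))) s
    simpa only [LinearIsometryEquiv.norm_map] using this
  conv_rhs => rw [← this]
  exact (e.toHomeomorph.toMeasurableEquiv.map_apply A).symm

lemma ae_re_ne {v : ℝ≥0} (hv : v ≠ 0) (a : ℝ) : ∀ᵐ z ∂(cgauss v), z.re ≠ a := by
  have hv2 : v / 2 ≠ 0 := by positivity
  have := nullSingletonClass_gaussianReal (μ := 0) hv2
  rw [ae_iff]
  have h := cgauss_re v (measurableSet_singleton a)
  rw [measure_singleton] at h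
  simpa using h

lemma ae_im_ne {v : ℝ≥0} (hv : v ≠ 0) (a : ℝ) : ∀ᵐ z ∂(cgauss v), z.im ≠ a := by
  have hv2 : v / 2 ≠ 0 := by positivity
  have := nullSingletonClass_gaussianReal (μ := 0) hv2
  rw [ae_iff]
  have h := cgauss_im v (measurableSet_singleton a)
  rw [measure_singleton] at h
  simpa using h

/-- A real line equidistant from two points is a null set. -/
lemma ae_norm_ne {v : ℝ≥0} (hv : v ≠ 0) {w : ℂ} (hw : w ≠ 0) :
    ∀ᵐ z ∂(cgauss v), ‖z‖ ≠ ‖z - w‖ := by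
  have hn : (‖w‖ : ℂ) ≠ 0 := by simpa using hw
  have hu : ‖w / ‖w‖‖ = 1 := by simp [hw]
  -- This rotation sends `‖w‖` to `w`, so the preimage of the bisector of `0` and `w` is the
  -- vertical line `Re z = ‖w‖ / 2`.
  let u : Circle := ⟨w / ‖w‖, mem_sphere_zero_iff_norm.2 hu⟩
  have h := ae_re_ne hv (‖w‖ / 2)
  rw [ae_iff] at h ⊢
  rw [← cgauss_preimage hv (rotation u)]
  convert! h using 2
  ext z
  simp only [Set.mem_preimage, Set.mem_ofPred_eq, not_not]
  have h1 : rotation u z - w = rotation u (z - ‖w‖) := by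
    simp only [rotation_apply, mul_sub]
    congr 1
    simp only [u]
    field_simp
  rw [h1, LinearIsometryEquiv.norm_map, LinearIsometryEquiv.norm_map,
    ← sq_eq_sq₀ (norm_nonneg _) (norm_nonneg _), ← Complex.normSq_eq_norm_sq,
    ← Complex.normSq_eq_norm_sq, Complex.normSq_apply, Complex.normSq_apply]
  have hw' : 0 < ‖w‖ := by positivity
  simp only [Complex.sub_re, Complex.sub_im, Complex.ofReal_re, Complex.ofReal_im]
  constructor
  · intro h
    have : ‖w‖ * (2 * z.re - ‖w‖) = 0 := by linarith
    rcases mul_eq_zero.1 this with h | h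
    · exact absurd h hw'.ne'
    · linarith
  · intro h; rw [h]; ring

/-- In the absence of ties, a minimum-distance detector is correct iff the transmitted point is
strictly nearest. -/
lemma IsMinDistDetector.eq_iff {S : Finset ℂ} {δ : ℂ → ℂ} (hδ : IsMinDistDetector S δ) {c z : ℂ}
    (hc : c ∈ S) (hz : ∀ c' ∈ S, c' ≠ c → ‖z‖ ≠ ‖z - (c' - c)‖) :
    δ (c + z) = c ↔ ∀ c' ∈ S, c' ≠ c → ‖z‖ < ‖z - (c' - c)‖ := by
  obtain ⟨h1, h2⟩ := hδ (c + z)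
  have e : ∀ c', c + z - c' = z - (c' - c) := fun c' => by ring
  constructor
  · intro h c' hc' hne
    refine lt_of_le_of_ne ?_ (hz c' hc' hne)
    have := h2 c' hc'
    rwa [h, e, e, sub_self, sub_zero] at this
  · intro h
    by_contra hne
    have h3 := h _ h1 hne
    have := h2 c hc
    rw [e, e, sub_self, sub_zero] at this
    exact absurd h3 this.not_gt

lemma IsMinDistDetector.ae_eq_iff {S : Finset ℂ} {δ : ℂ → ℂ} (hδ : IsMinDistDetector S δ)
    {v : ℝ≥0} (hv : v ≠ 0) {c : ℂ} (hc : c ∈ S) :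
    ∀ᵐ z ∂(cgauss v), δ (c + z) = c ↔ ∀ c' ∈ S, c' ≠ c → ‖z‖ < ‖z - (c' - c)‖ := by
  have : ∀ᵐ z ∂(cgauss v), ∀ c' ∈ S, c' ≠ c → ‖z‖ ≠ ‖z - (c' - c)‖ := by
    rw [Finset.eventually_all]
    intro c' _
    by_cases h : c' = c
    · simp [h]
    · filter_upwards [ae_norm_ne hv (sub_ne_zero.2 h)] with z hz _ using hz
  filter_upwards [this] with z hz using hδ.eq_iff hc hz

/-! ### Polar integration and Craig's formula for Gaussian tails -/

/-- The Jacobian factor `r` makes the radial integrand an exact derivative; what remains of the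
normalization is `1 / (2π)`. -/
lemma lintegral_radial {v R : ℝ} (hv : 0 < v) (hR : 0 ≤ R) :
    ∫⁻ r in Set.Ioi R, ENNReal.ofReal (r * ((Real.pi * v)⁻¹ * Real.exp (-(r ^ 2 / v))))
      = ENNReal.ofReal ((2 * Real.pi)⁻¹ * Real.exp (-(R ^ 2 / v))) := by
  have hd : ∀ x ∈ Set.Ici R, HasDerivAt (fun r => -((2 * Real.pi)⁻¹ * Real.exp (-(r ^ 2 / v))))
      (x * ((Real.pi * v)⁻¹ * Real.exp (-(x ^ 2 / v)))) x := by
    intro x _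
    have h1 : HasDerivAt (fun r : ℝ => -(r ^ 2 / v)) (-(2 * x / v)) x := by
      simpa using ((hasDerivAt_pow 2 x).div_const v).fun_neg
    have := ((h1.exp).const_mul (2 * Real.pi)⁻¹).fun_neg
    convert! this using 1
    have := Real.pi_pos
    field_simp
  have hpos : ∀ x ∈ Set.Ioi R, 0 ≤ x * ((Real.pi * v)⁻¹ * Real.exp (-(x ^ 2 / v))) := by
    intro x hx
    have : 0 ≤ x := hR.trans (le_of_lt hx)
    have := Real.pi_pos
    positivity
  have hlim : Filter.Tendsto (fun r => -((2 * Real.pi)⁻¹ * Real.exp (-(r ^ 2 / v))))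
      Filter.atTop (nhds 0) := by
    have : Filter.Tendsto (fun r : ℝ => r ^ 2 / v) Filter.atTop Filter.atTop :=
      (Filter.tendsto_pow_atTop two_ne_zero).atTop_div_const hv
    simpa using ((Real.tendsto_exp_neg_atTop_nhds_zero.comp this).const_mul (2 * Real.pi)⁻¹).neg
  have hint := integrableOn_Ioi_deriv_of_nonneg' hd hpos hlim
  rw [← ofReal_integral_eq_lintegral_ofReal hint (by
    filter_upwards [ae_restrict_mem measurableSet_Ioi] with x hx using hpos x hx),
    integral_Ioi_of_hasDerivAt_of_nonneg' hd hpos hlim]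
  simp

/-- Gaussian measure of a region given in polar coordinates around the mean. -/
lemma cgauss_polar {v : ℝ≥0} (hv : v ≠ 0) {A : Set ℂ} (hA : MeasurableSet A) {Φ : Set ℝ}
    (hΦ : MeasurableSet Φ) (hΦ' : Φ ⊆ Set.Ioo (-Real.pi) Real.pi) {R : ℝ → ℝ}
    (hR : ∀ φ ∈ Φ, 0 ≤ R φ) (hRm : Measurable R)
    (hmem : ∀ φ ∈ Set.Ioo (-Real.pi) Real.pi, ∀ r > 0,
      (⟨r * Real.cos φ, r * Real.sin φ⟩ : ℂ) ∈ A ↔ φ ∈ Φ ∧ R φ ≤ r) :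
    (cgauss v).real A = (2 * Real.pi)⁻¹ * ∫ φ in Φ, Real.exp (-(R φ ^ 2 / v)) := by
  have hv' : (0 : ℝ) < v := by positivity
  have hpt : ∀ p : ℝ × ℝ, Complex.polarCoord.symm p = ⟨p.1 * Real.cos p.2, p.1 * Real.sin p.2⟩ := by
    intro p
    rw [Complex.polarCoord_symm_apply]
    apply Complex.ext <;> simp [Complex.cos_ofReal_re, Complex.sin_ofReal_re]
  have hfm : Measurable (A.indicator fun z : ℂ =>
      ENNReal.ofReal ((Real.pi * v)⁻¹ * Real.exp (-(‖z‖ ^ 2 / v)))) :=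
    Measurable.indicator (by fun_prop) hA
  have hpm : Measurable fun p : ℝ × ℝ => (⟨p.1 * Real.cos p.2, p.1 * Real.sin p.2⟩ : ℂ) := by
    have : (fun p : ℝ × ℝ => (⟨p.1 * Real.cos p.2, p.1 * Real.sin p.2⟩ : ℂ))
      = fun p => ((p.1 * Real.cos p.2 : ℝ) : ℂ) + ((p.1 * Real.sin p.2 : ℝ) : ℂ) * Complex.I := by
      funext p; apply Complex.ext <;> simp [Complex.cos_ofReal_re, Complex.sin_ofReal_re]
    rw [this]
    fun_prop
  have key : cgauss v A = ∫⁻ φ in Φ, ENNReal.ofReal ((2 * Real.pi)⁻¹ * Real.exp (-(R φ ^ 2 / v))) := by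
    rw [cgauss_eq_withDensity hv, withDensity_apply _ hA, ← lintegral_indicator hA,
      ← Complex.lintegral_comp_polarCoord_symm, polarCoord_target]
    simp only [hpt]
    rw [Measure.volume_eq_prod, ← Measure.prod_restrict, lintegral_prod_symm' _ (by
      exact (by fun_prop : Measurable fun p : ℝ × ℝ => ENNReal.ofReal p.1).mul (hfm.comp hpm))]
    rw [← Set.inter_eq_self_of_subset_left hΦ', ← setLIntegral_indicator hΦ]
    refine setLIntegral_congr_fun measurableSet_Ioo fun φ hφ => ?_
    by_cases hφΦ : φ ∈ Φ
    · rw [Set.indicator_of_mem hφΦ, ← lintegral_radial hv' (hR φ hφΦ)]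
      -- The region contains the boundary radius while the radial integral runs over the open
      -- half-line; the difference is one point.
      have h0 : ∀ᵐ r : ℝ, r ≠ R φ := by rw [ae_iff]; simp
      rw [← lintegral_indicator measurableSet_Ioi, ← lintegral_indicator measurableSet_Ioi]
      refine lintegral_congr_ae ?_
      filter_upwards [h0] with r hr
      by_cases hr0 : 0 < r
      · rw [Set.indicator_of_mem (show r ∈ Set.Ioi 0 from hr0)]
        by_cases hRr : R φ < r
        · rw [Set.indicator_of_mem (show r ∈ Set.Ioi (R φ) from hRr),
            Set.indicator_of_mem ((hmem φ hφ r hr0).2 ⟨hφΦ, hRr.le⟩), smul_eq_mul,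
            ← ENNReal.ofReal_mul hr0.le, ← Complex.normSq_eq_norm_sq, Complex.normSq_apply]
          have : r * Real.cos φ * (r * Real.cos φ) + r * Real.sin φ * (r * Real.sin φ) = r ^ 2 := by
            linear_combination r ^ 2 * Real.sin_sq_add_cos_sq φ
          simp only [this]
        · rw [Set.indicator_of_notMem (show r ∉ Set.Ioi (R φ) from hRr),
            Set.indicator_of_notMem, smul_zero]
          rw [hmem φ hφ r hr0]
          rintro ⟨_, h⟩
          exact hRr (lt_of_le_of_ne h hr.symm)
      · rw [Set.indicator_of_notMem (show r ∉ Set.Ioi 0 from hr0), Set.indicator_of_notMem]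
        exact fun h => hr0 ((hR φ hφΦ).trans_lt h)
    · rw [Set.indicator_of_notMem hφΦ]
      refine (setLIntegral_congr_fun measurableSet_Ioi fun r hr => ?_).trans lintegral_zero
      rw [Set.indicator_of_notMem, smul_zero]
      rw [hmem φ hφ r hr]
      exact fun h => hφΦ h.1
  rw [Measure.real, key, ← integral_const_mul, integral_eq_lintegral_of_nonneg_ae
    (ae_of_all _ fun φ => by positivity) (by fun_prop)]

/-- The integrand of Craig-type error formulas. -/
noncomputable def craigExp (a θ : ℝ) : ℝ := Real.exp (-(a / Real.sin θ ^ 2))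

lemma measurable_craigExp (a : ℝ) : Measurable (craigExp a) := by
  unfold craigExp
  fun_prop

lemma craigExp_nonneg (a θ : ℝ) : 0 ≤ craigExp a θ := (Real.exp_pos _).le

lemma craigExp_le_one {a : ℝ} (ha : 0 ≤ a) (θ : ℝ) : craigExp a θ ≤ 1 := by
  rw [craigExp, Real.exp_le_one_iff, neg_nonpos]
  positivity

lemma integrable_of_mem_unit {μ : Measure ℝ} [IsFiniteMeasure μ] {f : ℝ → ℝ} (hf : Measurable f)
    (h0 : ∀ θ, 0 ≤ f θ) (h1 : ∀ θ, f θ ≤ 1) : Integrable f μ :=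
  Integrable.of_bound hf.aestronglyMeasurable 1
    (ae_of_all _ fun θ => by rw [Real.norm_eq_abs, abs_of_nonneg (h0 θ)]; exact h1 θ)

lemma intervalIntegrable_craigExp {a : ℝ} (ha : 0 ≤ a) (x y : ℝ) :
    IntervalIntegrable (craigExp a) volume x y :=
  ⟨integrable_of_mem_unit (measurable_craigExp a) (craigExp_nonneg a) (craigExp_le_one ha),
    integrable_of_mem_unit (measurable_craigExp a) (craigExp_nonneg a) (craigExp_le_one ha)⟩

lemma integral_craigExp_pi {a : ℝ} (ha : 0 ≤ a) :
    ∫ θ in (0 : ℝ)..Real.pi, craigExp a θ = 2 * ∫ θ in (0 : ℝ)..(Real.pi / 2), craigExp a θ := by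
  rw [← intervalIntegral.integral_add_adjacent_intervals
    (intervalIntegrable_craigExp ha 0 (Real.pi / 2)) (intervalIntegrable_craigExp ha _ Real.pi)]
  have h := intervalIntegral.integral_comp_sub_left (a := 0) (b := Real.pi / 2) (craigExp a) Real.pi
  have e : ∀ θ, craigExp a (Real.pi - θ) = craigExp a θ := fun θ => by
    rw [craigExp, craigExp, Real.sin_pi_sub]
  simp only [e, sub_zero, sub_half] at h
  rw [← h]; ring

/-- Craig's formula for the Gaussian tail. -/
lemma gaussian_tail {v : ℝ≥0} (hv : v ≠ 0) {d : ℝ} (hd : 0 < d) :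
    (gaussianReal 0 (v / 2)).real (Set.Ici d)
      = Real.pi⁻¹ * ∫ θ in (0 : ℝ)..(Real.pi / 2), craigExp (d ^ 2 / v) θ := by
  have hpi := Real.pi_pos
  have hm : MeasurableSet {z : ℂ | z.im ∈ Set.Ici d} := Complex.measurable_im measurableSet_Ici
  -- The tail is the complex Gaussian measure of the half-plane `Im z ≥ d`, which the ray at angle
  -- `φ ∈ (0, π)` enters at radius `d / sin φ`.
  rw [Measure.real, ← cgauss_im v measurableSet_Ici, ← Measure.real,
    cgauss_polar hv hm (Φ := Set.Ioo 0 Real.pi)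
    (R := fun φ => d / Real.sin φ) measurableSet_Ioo
    (Set.Ioo_subset_Ioo_left (by linarith)) (fun φ hφ => ?_) (by fun_prop) ?_]
  · have e : ∀ φ, Real.exp (-((d / Real.sin φ) ^ 2 / v)) = craigExp (d ^ 2 / v) φ := fun φ => by
      rw [craigExp, div_pow, div_right_comm]
    simp_rw [e]
    rw [← integral_Ioc_eq_integral_Ioo, ← intervalIntegral.integral_of_le hpi.le,
      integral_craigExp_pi (by positivity)]
    field_simp
  swap
  · exact div_nonneg hd.le (Real.sin_pos_of_pos_of_lt_pi hφ.1 hφ.2).le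
  · intro φ hφ r hr
    simp only [Set.mem_Ici, Set.mem_ofPred_eq]
    constructor
    · intro h
      have hs : 0 < Real.sin φ := pos_of_mul_pos_right (hd.trans_le h) hr.le
      refine ⟨⟨?_, hφ.2⟩, (div_le_iff₀ hs).2 h⟩
      by_contra hneg
      exact absurd hs (Real.sin_nonpos_of_nonpos_of_neg_pi_le (not_lt.1 hneg) hφ.1.le).not_gt
    · rintro ⟨h1, h2⟩
      exact (div_le_iff₀ (Real.sin_pos_of_pos_of_lt_pi h1.1 h1.2)).1 h2

/-- The square of the tail is the measure of the quadrant `Re z ≥ d, Im z ≥ d`. A ray enters it at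
radius `d / min (sin φ) (cos φ)`, and reflection in the diagonal folds `(π/4, π/2)` onto `(0, π/4)`.
-/
lemma gaussian_tail_sq {v : ℝ≥0} (hv : v ≠ 0) {d : ℝ} (hd : 0 < d) :
    (gaussianReal 0 (v / 2)).real (Set.Ici d) ^ 2
      = Real.pi⁻¹ * ∫ θ in (0 : ℝ)..(Real.pi / 4), craigExp (d ^ 2 / v) θ := by
  have hpi := Real.pi_pos
  have hv' : (0 : ℝ) < v := by positivity
  have hpos : ∀ φ ∈ Set.Ioo 0 (Real.pi / 2), 0 < Real.sin φ ∧ 0 < Real.cos φ := fun φ hφ =>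
    ⟨Real.sin_pos_of_pos_of_lt_pi hφ.1 (by linarith [hφ.2]),
      Real.cos_pos_of_mem_Ioo ⟨by linarith [hφ.1], hφ.2⟩⟩
  have hm : MeasurableSet {z : ℂ | z.re ∈ Set.Ici d ∧ z.im ∈ Set.Ici d} :=
    (Complex.measurable_re measurableSet_Ici).inter (Complex.measurable_im measurableSet_Ici)
  rw [sq, Measure.real, ← ENNReal.toReal_mul, ← cgauss_re_im v measurableSet_Ici measurableSet_Ici,
    ← Measure.real,
    cgauss_polar hv hm (Φ := Set.Ioo 0 (Real.pi / 2))
    (R := fun φ => d / min (Real.sin φ) (Real.cos φ)) measurableSet_Ioo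
    (Set.Ioo_subset_Ioo (by linarith) (by linarith)) (fun φ hφ => ?_) (by fun_prop) ?_]
  · have hint : ∀ x y, IntervalIntegrable
        (fun φ => Real.exp (-((d / min (Real.sin φ) (Real.cos φ)) ^ 2 / v))) volume x y := by
      have : ∀ μ : Measure ℝ, IsFiniteMeasure μ → Integrable
        (fun φ => Real.exp (-((d / min (Real.sin φ) (Real.cos φ)) ^ 2 / v))) μ := fun μ _ =>
        integrable_of_mem_unit (by fun_prop) (fun _ => (Real.exp_pos _).le) fun θ => by
          rw [Real.exp_le_one_iff, neg_nonpos]; positivity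
      exact fun x y => ⟨this _ inferInstance, this _ inferInstance⟩
    rw [← integral_Ioc_eq_integral_Ioo, ← intervalIntegral.integral_of_le (by positivity),
      ← intervalIntegral.integral_add_adjacent_intervals (hint 0 (Real.pi / 4)) (hint _ _)]
    have hcs : ∀ φ ∈ Set.Icc 0 (Real.pi / 4), Real.sin φ ≤ Real.cos φ := fun φ hφ => by
      rw [← Real.cos_pi_div_two_sub]
      exact Real.cos_le_cos_of_nonneg_of_le_pi hφ.1 (by linarith [hφ.1]) (by linarith [hφ.2])
    have h1 : ∫ φ in (0 : ℝ)..(Real.pi / 4),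
        Real.exp (-((d / min (Real.sin φ) (Real.cos φ)) ^ 2 / v))
        = ∫ θ in (0 : ℝ)..(Real.pi / 4), craigExp (d ^ 2 / v) θ := by
      refine intervalIntegral.integral_congr fun φ hφ => ?_
      rw [Set.uIcc_of_le (by positivity)] at hφ
      rw [min_eq_left (hcs φ hφ), craigExp, div_pow, div_right_comm]
    have h2 : ∫ φ in (Real.pi / 4)..(Real.pi / 2),
        Real.exp (-((d / min (Real.sin φ) (Real.cos φ)) ^ 2 / v))
        = ∫ θ in (0 : ℝ)..(Real.pi / 4), craigExp (d ^ 2 / v) θ := by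
      have h := intervalIntegral.integral_comp_sub_left (a := 0) (b := Real.pi / 4)
        (fun φ => Real.exp (-((d / min (Real.sin φ) (Real.cos φ)) ^ 2 / v))) (Real.pi / 2)
      rw [sub_zero, show Real.pi / 2 - Real.pi / 4 = Real.pi / 4 by ring] at h
      rw [← h, ← h1]
      refine intervalIntegral.integral_congr fun φ _ => ?_
      simp only [Real.sin_pi_div_two_sub, Real.cos_pi_div_two_sub, min_comm]
    rw [h1, h2]
    field_simp
    ring
  swap
  · exact div_nonneg hd.le (le_min (hpos φ hφ).1.le (hpos φ hφ).2.le)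
  · intro φ hφ r hr
    simp only [Set.mem_Ici, Set.mem_ofPred_eq]
    have hiff : 0 < Real.sin φ → 0 < Real.cos φ →
        (d / min (Real.sin φ) (Real.cos φ) ≤ r ↔ d ≤ r * Real.cos φ ∧ d ≤ r * Real.sin φ) := by
      intro hs hc
      rw [div_le_iff₀ (lt_min hs hc), mul_min_of_nonneg _ _ hr.le, le_min_iff, and_comm]
    constructor
    · rintro ⟨h1, h2⟩
      have hs : 0 < Real.sin φ := pos_of_mul_pos_right (hd.trans_le h2) hr.le
      have hc : 0 < Real.cos φ := pos_of_mul_pos_right (hd.trans_le h1) hr.le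
      refine ⟨⟨?_, ?_⟩, (hiff hs hc).2 ⟨h1, h2⟩⟩
      · by_contra hneg
        exact absurd hs (Real.sin_nonpos_of_nonpos_of_neg_pi_le (not_lt.1 hneg) hφ.1.le).not_gt
      · by_contra hneg
        exact absurd hc (Real.cos_nonpos_of_pi_div_two_le_of_le (not_lt.1 hneg)
          (by linarith [hφ.2])).not_gt
    · rintro ⟨h1, h2⟩
      exact (hiff (hpos φ h1).1 (hpos φ h1).2).1 h2

lemma norm_lt_norm_sub_iff (z w : ℂ) :
    ‖z‖ < ‖z - w‖ ↔ 2 * (z.re * w.re + z.im * w.im) < w.re ^ 2 + w.im ^ 2 := by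
  rw [← sq_lt_sq₀ (norm_nonneg _) (norm_nonneg _), ← Complex.normSq_eq_norm_sq,
    ← Complex.normSq_eq_norm_sq, Complex.normSq_apply, Complex.normSq_apply, Complex.sub_re,
    Complex.sub_im]
  constructor <;> intro h <;> nlinarith

/-- Average symbol error probability on the additive Gaussian channel of noise variance `v`. -/
noncomputable def awgnSEP (S : Finset ℂ) (δ : ℂ → ℂ) (v : ℝ≥0) : ℝ :=
  (S.card : ℝ)⁻¹ * ∑ c ∈ S, (cgauss v).real {z | δ (c + z) ≠ c}

/-! ### Error probability of rectangular lattice constellations -/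

section Lattice

/-- Values of one noise coordinate that keep a lattice point with the given neighbours correct. -/
def okSet (d : ℝ) (a b : Prop) : Set ℝ := {x | (a → x < d) ∧ (b → -d < x)}

lemma measurableSet_okSet (d : ℝ) (a b : Prop) : MeasurableSet (okSet d a b) := by
  have : okSet d a b = {x | a → x < d} ∩ {x | b → -d < x} := rfl
  rw [this]
  refine MeasurableSet.inter ?_ ?_
  · by_cases h : a
    · simp only [h, true_imp_iff]; exact measurableSet_Iio
    · simp [h]
  · by_cases h : b
    · simp only [h, true_imp_iff]; exact measurableSet_Ioi
    · simp [h]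

/-- Each existing neighbour contributes one tail to the complement; the two tails are disjoint and
have equal measure by symmetry. -/
lemma gaussian_okSet (v : ℝ≥0) {d : ℝ} (hd : 0 < d) (a b : Prop) [Decidable a] [Decidable b] :
    (gaussianReal 0 (v / 2)).real (okSet d a b)
      = 1 - ((if a then 1 else 0) + if b then 1 else 0)
        * (gaussianReal 0 (v / 2)).real (Set.Ici d) := by
  have hneg : (gaussianReal 0 (v / 2)).real (Set.Iic (-d))
      = (gaussianReal 0 (v / 2)).real (Set.Ici d) := by
    have h := gaussianReal_map_neg (μ := 0) (v := v / 2)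
    rw [neg_zero] at h
    conv_rhs => rw [← h]
    rw [measureReal_def, measureReal_def, Measure.map_apply measurable_neg measurableSet_Ici]
    congr 2
    ext x
    simp
  have h1 := probReal_compl_eq_one_sub (μ := gaussianReal 0 (v / 2))
    (measurableSet_okSet d a b)
  have h2 : (gaussianReal 0 (v / 2)).real (okSet d a b)ᶜ
      = ((if a then 1 else 0) + if b then 1 else 0)
        * (gaussianReal 0 (v / 2)).real (Set.Ici d) := by
    by_cases ha : a <;> by_cases hb : b
    · have : (okSet d a b)ᶜ = Set.Ici d ∪ Set.Iic (-d) := by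
        ext x
        simp only [okSet, ha, hb, Set.mem_compl_iff, Set.mem_ofPred_eq, true_imp_iff, not_and_or,
          not_lt, Set.mem_union, Set.mem_Ici, Set.mem_Iic]
      rw [this, measureReal_union _ measurableSet_Iic, hneg]
      · simp [ha, hb]; ring
      · rw [Set.disjoint_left]
        intro x hx hx'
        simp only [Set.mem_Ici, Set.mem_Iic] at hx hx'
        linarith
    · have : (okSet d a b)ᶜ = Set.Ici d := by
        ext x; simp [okSet, ha, hb]
      rw [this]; simp [ha, hb]
    · have : (okSet d a b)ᶜ = Set.Iic (-d) := by
        ext x; simp [okSet, ha, hb]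
      rw [this, hneg]; simp [ha, hb]
    · have : (okSet d a b)ᶜ = ∅ := by
        ext x; simp [okSet, ha, hb]
      rw [this]; simp [ha, hb]
  linarith

/-- Point of a rectangular lattice constellation. -/
noncomputable def latticePt (d : ℝ) (K L : ℕ) (p : ℕ × ℕ) : ℂ :=
  ((d * (2 * (p.1 : ℝ) - ((K : ℝ) - 1)) : ℝ) : ℂ) +
    ((d * (2 * (p.2 : ℝ) - ((L : ℝ) - 1)) : ℝ) : ℂ) * Complex.I

lemma latticePt_sub_re (d : ℝ) (K L : ℕ) (p q : ℕ × ℕ) :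
    (latticePt d K L p - latticePt d K L q).re = 2 * d * ((p.1 : ℝ) - q.1) := by
  simp [latticePt]; ring

lemma latticePt_sub_im (d : ℝ) (K L : ℕ) (p q : ℕ × ℕ) :
    (latticePt d K L p - latticePt d K L q).im = 2 * d * ((p.2 : ℝ) - q.2) := by
  simp [latticePt]; ring

lemma latticePt_injective {d : ℝ} (hd : 0 < d) (K L : ℕ) :
    Function.Injective (latticePt d K L) := by
  intro p q h
  have h1 := latticePt_sub_re d K L p q
  have h2 := latticePt_sub_im d K L p q
  rw [sub_eq_zero.2 h] at h1 h2
  simp only [Complex.zero_re, Complex.zero_im, zero_eq_mul, mul_eq_zero, hd.ne', or_false,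
    sub_eq_zero, OfNat.ofNat_ne_zero, false_or, Nat.cast_inj] at h1 h2
  exact Prod.ext h1 h2

/-- Adjacent points already decide: the one-step bound times `|j - i|` is at most `d (j - i)²`,
because distinct integers satisfy `|j - i| ≤ (j - i)²`. -/
lemma okSet_step {d x : ℝ} (hd : 0 < d) {K i j : ℕ} (hj : j < K)
    (hx : x ∈ okSet d (i + 1 < K) (0 < i)) (hij : j ≠ i) :
    x * ((j : ℝ) - i) < d * ((j : ℝ) - i) ^ 2 := by
  rcases lt_or_gt_of_ne hij with h | h
  · have h1 := hx.2 (by omega)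
    have h2 : (j : ℝ) + 1 ≤ i := by exact_mod_cast h
    have h3 : 0 < (x + d) * ((i : ℝ) - j) := mul_pos (by linarith) (by linarith)
    have h4 : 0 ≤ d * (((i : ℝ) - j) * ((i : ℝ) - j - 1)) :=
      mul_nonneg hd.le (mul_nonneg (by linarith) (by linarith))
    nlinarith
  · have h1 := hx.1 (by omega)
    have h2 : (i : ℝ) + 1 ≤ j := by exact_mod_cast h
    have h3 : 0 < (d - x) * ((j : ℝ) - i) := mul_pos (by linarith) (by linarith)
    have h4 : 0 ≤ d * (((j : ℝ) - i) * ((j : ℝ) - i - 1)) :=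
      mul_nonneg hd.le (mul_nonneg (by linarith) (by linarith))
    nlinarith

/-- The inequality `‖z‖ < ‖z - w‖` is a sum of one inequality per coordinate, so the decision cell
is a product of intervals cut out by the adjacent points. -/
lemma lattice_nearest_iff {d : ℝ} (hd : 0 < d) {K L : ℕ} {p : ℕ × ℕ}
    (hp : p ∈ Finset.range K ×ˢ Finset.range L) (z : ℂ) :
    (∀ c' ∈ (Finset.range K ×ˢ Finset.range L).image (latticePt d K L),
      c' ≠ latticePt d K L p → ‖z‖ < ‖z - (c' - latticePt d K L p)‖) ↔
    z.re ∈ okSet d (p.1 + 1 < K) (0 < p.1) ∧ z.im ∈ okSet d (p.2 + 1 < L) (0 < p.2) := by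
  rw [Finset.mem_product, Finset.mem_range, Finset.mem_range] at hp
  have hcond : ∀ q, ‖z‖ < ‖z - (latticePt d K L q - latticePt d K L p)‖ ↔
      z.re * ((q.1 : ℝ) - p.1) + z.im * ((q.2 : ℝ) - p.2)
        < d * ((q.1 : ℝ) - p.1) ^ 2 + d * ((q.2 : ℝ) - p.2) ^ 2 := fun q => by
    rw [norm_lt_norm_sub_iff, latticePt_sub_re, latticePt_sub_im]
    have h4 : 0 < 4 * d := by positivity
    rw [← mul_lt_mul_iff_right₀ h4 (b := z.re * ((q.1 : ℝ) - p.1) + z.im * ((q.2 : ℝ) - p.2))]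
    exact iff_of_eq (congrArg₂ _ (by ring) (by ring))
  simp only [Finset.forall_mem_image, (latticePt_injective hd K L).ne_iff, hcond,
    Finset.mem_product, Finset.mem_range]
  constructor
  · intro h
    refine ⟨⟨fun h1 => ?_, fun h1 => ?_⟩, ⟨fun h1 => ?_, fun h1 => ?_⟩⟩
    · have := @h (p.1 + 1, p.2) ⟨h1, hp.2⟩ (fun h => by simpa using congrArg Prod.fst h)
      push_cast at this
      linarith
    · have := @h (p.1 - 1, p.2) ⟨by omega, hp.2⟩ (fun h => by have := congrArg Prod.fst h; omega)
      rw [Nat.cast_sub (by omega)] at this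
      push_cast at this
      linarith
    · have := @h (p.1, p.2 + 1) ⟨hp.1, h1⟩ (fun h => by simpa using congrArg Prod.snd h)
      push_cast at this
      linarith
    · have := @h (p.1, p.2 - 1) ⟨hp.1, by omega⟩ (fun h => by have := congrArg Prod.snd h; omega)
      rw [Nat.cast_sub (by omega)] at this
      push_cast at this
      linarith
  · rintro ⟨h1, h2⟩ q hq hne
    by_cases e1 : q.1 = p.1
    · have e2 : q.2 ≠ p.2 := fun h => hne (Prod.ext e1 h)
      have := okSet_step hd hq.2 h2 e2
      rw [e1]; linarith
    · have s1 := okSet_step hd hq.1 h1 e1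
      by_cases e2 : q.2 = p.2
      · rw [e2]; linarith
      · have := okSet_step hd hq.2 h2 e2
        linarith

/-- Among `K` points on a line there are `K - 1` right neighbours and `K - 1` left neighbours. -/
lemma sum_neighbours {K : ℕ} (hK : 0 < K) (h : ℝ) :
    ∑ i ∈ Finset.range K, (1 - ((if i + 1 < K then 1 else 0) + if 0 < i then 1 else 0) * h)
      = K - 2 * (K - 1) * h := by
  obtain ⟨k, rfl⟩ : ∃ k, K = k + 1 := ⟨K - 1, by omega⟩
  have h1 : ∑ i ∈ Finset.range (k + 1), (if i + 1 < k + 1 then (1 : ℝ) else 0) = k := by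
    rw [Finset.sum_range_succ, if_neg (lt_irrefl _), add_zero,
      Finset.sum_congr rfl fun i hi => if_pos (Nat.succ_lt_succ (Finset.mem_range.1 hi))]
    simp
  have h2 : ∑ i ∈ Finset.range (k + 1), (if 0 < i then (1 : ℝ) else 0) = k := by
    rw [Finset.sum_range_succ', if_neg (lt_irrefl _), add_zero,
      Finset.sum_congr rfl fun i _ => if_pos (Nat.succ_pos i)]
    simp
  rw [Finset.sum_sub_distrib, ← Finset.sum_mul, Finset.sum_add_distrib, h1, h2, Finset.sum_const,
    Finset.card_range, nsmul_eq_mul]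
  push_cast
  ring

/-- Real and imaginary noise are independent, so correct decisions factor, and averaging over a
product grid factors too. The case `L = 1` has trivial second factor and covers PAM. -/
lemma awgnSEP_lattice {δ : ℂ → ℂ} {v : ℝ≥0} (hv : v ≠ 0) {d : ℝ} (hd : 0 < d) {K L : ℕ}
    (hK : 0 < K) (hL : 0 < L)
    (hδ : IsMinDistDetector ((Finset.range K ×ˢ Finset.range L).image (latticePt d K L)) δ) :
    awgnSEP ((Finset.range K ×ˢ Finset.range L).image (latticePt d K L)) δ v
      = 1 - (1 - 2 * (K - 1) / K * (gaussianReal 0 (v / 2)).real (Set.Ici d))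
        * (1 - 2 * (L - 1) / L * (gaussianReal 0 (v / 2)).real (Set.Ici d)) := by
  set g := (gaussianReal 0 (v / 2)).real (Set.Ici d) with hg
  have hprob : ∀ p ∈ Finset.range K ×ˢ Finset.range L,
      (cgauss v).real {z | δ (latticePt d K L p + z) ≠ latticePt d K L p}
      = 1 - (1 - ((if p.1 + 1 < K then 1 else 0) + if 0 < p.1 then 1 else 0) * g)
        * (1 - ((if p.2 + 1 < L then 1 else 0) + if 0 < p.2 then 1 else 0) * g) := by
    intro p hp
    have hae := hδ.ae_eq_iff hv (Finset.mem_image_of_mem _ hp)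
    have hm : MeasurableSet {z : ℂ | z.re ∈ okSet d (p.1 + 1 < K) (0 < p.1) ∧
        z.im ∈ okSet d (p.2 + 1 < L) (0 < p.2)} :=
      (Complex.measurable_re (measurableSet_okSet _ _ _)).inter
        (Complex.measurable_im (measurableSet_okSet _ _ _))
    have hset : {z | δ (latticePt d K L p + z) ≠ latticePt d K L p} =ᵐ[cgauss v]
        ({z : ℂ | z.re ∈ okSet d (p.1 + 1 < K) (0 < p.1) ∧
        z.im ∈ okSet d (p.2 + 1 < L) (0 < p.2)}ᶜ : Set ℂ) := by
      refine Filter.eventuallyEq_set.2 ?_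
      filter_upwards [hae] with z hz
      rw [lattice_nearest_iff hd hp] at hz
      simp only [Set.mem_ofPred_eq, Set.mem_compl_iff, ne_eq, hz]
    rw [measureReal_congr hset, probReal_compl_eq_one_sub hm, measureReal_def,
      cgauss_re_im v (measurableSet_okSet _ _ _) (measurableSet_okSet _ _ _), ENNReal.toReal_mul,
      ← measureReal_def, ← measureReal_def, gaussian_okSet v hd, gaussian_okSet v hd, ← hg]
  rw [awgnSEP, Finset.card_image_of_injective _ (latticePt_injective hd K L),
    Finset.sum_image fun p _ q _ h => latticePt_injective hd K L h,
    Finset.sum_congr rfl hprob, Finset.sum_sub_distrib, Finset.sum_product' _ _ (fun i j =>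
      (1 - ((if i + 1 < K then 1 else 0) + if 0 < i then 1 else 0) * g)
        * (1 - ((if j + 1 < L then 1 else 0) + if 0 < j then 1 else 0) * g)),
    ← Finset.sum_mul_sum, sum_neighbours hK, sum_neighbours hL]
  simp only [Finset.sum_const, Finset.card_product, Finset.card_range, nsmul_eq_mul, Nat.cast_mul,
    mul_one]
  have : (0 : ℝ) < K := by exact_mod_cast hK
  have : (0 : ℝ) < L := by exact_mod_cast hL
  field_simp

end Lattice

/-! ### Error probability of phase-shift keying -/

section PSK

variable {M : ℕ}

lemma mem_psk_iff (hM : 2 ≤ M) (c : ℂ) : c ∈ Modulation.psk.constellation M ↔ c ^ M = 1 := by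
  have hp := Complex.isPrimitiveRoot_exp M (by omega)
  have e : ∀ i : ℕ, Complex.exp (2 * (Real.pi : ℂ) * Complex.I * (i : ℂ) / (M : ℂ))
      = Complex.exp (2 * (Real.pi : ℂ) * Complex.I / M) ^ i := fun i => by
    rw [← Complex.exp_nat_mul]; congr 1; ring
  simp only [Modulation.constellation, Finset.mem_image, Finset.mem_range, e]
  constructor
  · rintro ⟨i, _, rfl⟩
    rw [pow_right_comm, hp.pow_eq_one, one_pow]
  · intro h
    have : NeZero M := ⟨by omega⟩
    obtain ⟨i, hi, h⟩ := hp.eq_pow_of_pow_eq_one h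
    exact ⟨i, hi, h⟩

/-- Noise values for which a neighbour of the symbol `1` is at least as close. -/
def pskErr (M : ℕ) : Set ℂ :=
  {z | ¬ ∀ u ∈ Modulation.psk.constellation M, u ≠ 1 → ‖z‖ < ‖z - (u - 1)‖}

/-- Multiplication by a root of unity is an isometry permuting the constellation, so every symbol
has the error region of `1` up to rotation. -/
lemma pskErr_rotate (hM : 2 ≤ M) {c : ℂ} (hc : c ∈ Modulation.psk.constellation M) (z : ℂ) :
    (¬ ∀ c' ∈ Modulation.psk.constellation M, c' ≠ c → ‖c * z‖ < ‖c * z - (c' - c)‖)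
      ↔ z ∈ pskErr M := by
  rw [mem_psk_iff hM] at hc
  have hc1 : ‖c‖ = 1 := Complex.norm_eq_one_of_pow_eq_one hc (by omega)
  have hc0 : c ≠ 0 := fun h => by simp [h] at hc1
  have e : ∀ u, ‖c * z - (c * u - c)‖ = ‖z - (u - 1)‖ := fun u => by
    rw [show c * z - (c * u - c) = c * (z - (u - 1)) by ring, norm_mul, hc1, one_mul]
  refine not_congr ⟨fun h u hu hu1 => ?_, fun h c' hc' hne => ?_⟩
  · rw [mem_psk_iff hM] at hu
    have := h (c * u) ((mem_psk_iff hM _).2 (by rw [mul_pow, hc, hu, one_mul]))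
      (fun h => hu1 (by simpa [hc0] using h))
    rwa [e, norm_mul, hc1, one_mul] at this
  · rw [mem_psk_iff hM] at hc'
    have := h (c' / c) ((mem_psk_iff hM _).2 (by rw [div_pow, hc, hc', div_one]))
      (fun h => hne (by rwa [div_eq_one_iff_eq hc0] at h))
    rwa [← e, mul_div_cancel₀ _ hc0, ← one_mul ‖z‖, ← hc1, ← norm_mul] at this

lemma pskErr_conj (hM : 2 ≤ M) (z : ℂ) : conj z ∈ pskErr M ↔ z ∈ pskErr M := by
  have key : ∀ z, (∀ u ∈ Modulation.psk.constellation M, u ≠ 1 → ‖z‖ < ‖z - (u - 1)‖) →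
      ∀ u ∈ Modulation.psk.constellation M, u ≠ 1 → ‖conj z‖ < ‖conj z - (u - 1)‖ := by
    intro z h u hu hu1
    rw [mem_psk_iff hM] at hu
    have := h (conj u) ((mem_psk_iff hM _).2 (by rw [← map_pow, hu, map_one]))
      (fun h => hu1 (by simpa using congrArg conj h))
    rw [← RCLike.norm_conj z, ← RCLike.norm_conj (z - _)] at this
    simpa using this
  refine not_congr ⟨fun h => ?_, key z⟩
  simpa using key _ h

/-- With `α = π / M`, the `j`-th point is farther than `1` exactly when `z.im * cot (j α) < 1 +
z.re`. Since `cot` decreases on `(0, π)` and `z.im > 0`, the case `j = 1` is the binding one. -/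
lemma pskErr_upper (hM : 2 ≤ M) {z : ℂ} (hz : 0 < z.im) :
    z ∈ pskErr M ↔
      (1 + z.re) * Real.sin (Real.pi / M) ≤ z.im * Real.cos (Real.pi / M) := by
  have hpi := Real.pi_pos
  have hM0 : (0 : ℝ) < M := by positivity
  have hM2 : (2 : ℝ) ≤ M := by exact_mod_cast hM
  have hsin : ∀ j : ℕ, 0 < j → j < M → 0 < Real.sin (j * (Real.pi / M)) := by
    intro j h0 hj
    have h0' : (0 : ℝ) < j := by exact_mod_cast h0
    have hj' : (j : ℝ) < M := by exact_mod_cast hj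
    refine Real.sin_pos_of_pos_of_lt_pi (by positivity) ?_
    rw [← mul_div_assoc, div_lt_iff₀ hM0]
    nlinarith
  have hre : ∀ j : ℕ, (Complex.exp (2 * (Real.pi : ℂ) * Complex.I * (j : ℂ) / (M : ℂ)) - 1).re
      = -2 * Real.sin (j * (Real.pi / M)) ^ 2 ∧
      (Complex.exp (2 * (Real.pi : ℂ) * Complex.I * (j : ℂ) / (M : ℂ)) - 1).im
      = 2 * Real.sin (j * (Real.pi / M)) * Real.cos (j * (Real.pi / M)) := fun j => by
    have : 2 * (Real.pi : ℂ) * Complex.I * (j : ℂ) / (M : ℂ)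
        = ((2 * (j * (Real.pi / M)) : ℝ) : ℂ) * Complex.I := by push_cast; ring
    rw [this, Complex.sub_re, Complex.sub_im, Complex.exp_ofReal_mul_I_re,
      Complex.exp_ofReal_mul_I_im, Real.sin_two_mul, Real.cos_two_mul, Complex.one_re,
      Complex.one_im, Real.cos_sq']
    constructor <;> ring
  have hcond : ∀ j : ℕ, 0 < j → j < M →
      (‖z‖ < ‖z - (Complex.exp (2 * (Real.pi : ℂ) * Complex.I * (j : ℂ) / (M : ℂ)) - 1)‖ ↔
        z.im * Real.cos (j * (Real.pi / M)) < (1 + z.re) * Real.sin (j * (Real.pi / M))) := by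
    intro j h0 hj
    have hs := hsin j h0 hj
    rw [norm_lt_norm_sub_iff, (hre j).1, (hre j).2,
      ← mul_lt_mul_iff_right₀ (show 0 < 4 * Real.sin (j * (Real.pi / M)) by positivity)
        (b := z.im * _)]
    have hc := Real.sin_sq_add_cos_sq (j * (Real.pi / M))
    constructor <;> intro h <;> nlinarith
  rw [pskErr, Set.mem_ofPred_eq, ← not_lt, not_iff_not]
  constructor
  · intro h
    have h1 : Complex.exp (2 * (Real.pi : ℂ) * Complex.I * ((1 : ℕ) : ℂ) / (M : ℂ)) ≠ 1 := by
      intro h1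
      have := (hre 1).1
      rw [h1, sub_self, Complex.zero_re] at this
      have := hsin 1 one_pos (by omega)
      nlinarith
    have := (hcond 1 one_pos (by omega)).1 (h _ (Finset.mem_image.2
      ⟨1, Finset.mem_range.2 (by omega), rfl⟩) h1)
    simpa using this
  · intro h u hu hu1
    obtain ⟨j, hj, rfl⟩ := Finset.mem_image.1 hu
    rw [Finset.mem_range] at hj
    have hj0 : 0 < j := by
      rcases Nat.eq_zero_or_pos j with rfl | h0
      · simp at hu1
      · exact h0
    rw [hcond j hj0 hj]
    set β := (j : ℝ) * (Real.pi / M) with hβ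
    set α := Real.pi / M with hα
    have hα0 : 0 < Real.sin α := by simpa using hsin 1 one_pos (by omega)
    have hβ0 : 0 < Real.sin β := hsin j hj0 hj
    have hd : 0 ≤ Real.sin (β - α) := by
      have h1 : (1 : ℝ) ≤ j := by exact_mod_cast hj0
      have h2 : (j : ℝ) < M := by exact_mod_cast hj
      have hα1 : 0 < α := by positivity
      have hMα : M * α = Real.pi := by rw [hα]; field_simp
      refine Real.sin_nonneg_of_nonneg_of_le_pi ?_ ?_
      · nlinarith
      · nlinarith
    rw [Real.sin_sub] at hd
    rw [← mul_lt_mul_iff_right₀ hα0]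
    nlinarith [mul_lt_mul_of_pos_left h hβ0, mul_nonneg hz.le hd]

/-- Conjugation exchanges the halves of the error region, which doubles `1 / (2π)`. In the upper
half the ray at angle `φ ∈ (α, π)` enters at radius `sin α / sin (φ - α)`; a shift by `α` gives
Craig's integrand. -/
lemma cgauss_pskErr {v : ℝ≥0} (hv : v ≠ 0) (hM : 2 ≤ M) :
    (cgauss v).real (pskErr M) = Real.pi⁻¹ * ∫ θ in (0 : ℝ)..(Real.pi - Real.pi / M),
      craigExp (Real.sin (Real.pi / M) ^ 2 / v) θ := by
  have hpi := Real.pi_pos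
  have hM0 : (0 : ℝ) < M := by positivity
  have hM2 : (2 : ℝ) ≤ M := by exact_mod_cast hM
  set α := Real.pi / M with hα
  have hα0 : 0 < α := by positivity
  have hα2 : α ≤ Real.pi / 2 := div_le_div_of_nonneg_left hpi.le two_pos hM2
  have hsα : 0 < Real.sin α := Real.sin_pos_of_pos_of_lt_pi hα0 (by linarith)
  set A : Set ℂ := {z | 0 < z.im ∧ (1 + z.re) * Real.sin α ≤ z.im * Real.cos α} with hA
  have hAm : MeasurableSet A :=
    (measurableSet_lt measurable_const Complex.measurable_im).inter
      (measurableSet_le ((Complex.measurable_re.const_add 1).mul_const _)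
        (Complex.measurable_im.mul_const _))
  have hconj : cgauss v ((conj : ℂ → ℂ) ⁻¹' A) = cgauss v A :=
    cgauss_preimage hv Complex.conjLIE A
  have hset : pskErr M =ᵐ[cgauss v] (A ∪ (conj : ℂ → ℂ) ⁻¹' A : Set ℂ) := by
    refine Filter.eventuallyEq_set.2 ?_
    filter_upwards [ae_im_ne hv 0] with z hz
    simp only [Set.mem_union, Set.mem_preimage, hA, Set.mem_ofPred_eq, Complex.conj_im,
      Complex.conj_re]
    rcases lt_or_gt_of_ne hz with h | h
    · rw [← pskErr_conj hM, pskErr_upper hM (by simpa using h), ← hα]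
      have h1 : ¬ 0 < z.im := h.not_gt
      have h2 : 0 < -z.im := by linarith
      simp [h1, h2]
    · rw [pskErr_upper hM h, ← hα]
      have h2 : ¬ 0 < -z.im := by linarith
      simp [h, h2]
  have hdisj : Disjoint A ((conj : ℂ → ℂ) ⁻¹' A) := by
    rw [Set.disjoint_left]
    rintro z ⟨h1, _⟩ ⟨h2, _⟩
    rw [Complex.conj_im] at h2
    linarith
  rw [measureReal_congr hset, measureReal_union hdisj
    (hAm.preimage Complex.continuous_conj.measurable), measureReal_def, measureReal_def, hconj,
    ← measureReal_def, cgauss_polar hv hAm (Φ := Set.Ioo α Real.pi)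
    (R := fun φ => Real.sin α / Real.sin (φ - α)) measurableSet_Ioo
    (Set.Ioo_subset_Ioo_left (by linarith)) (fun φ hφ => ?_) (by fun_prop) ?_]
  · have e : ∀ φ, Real.exp (-((Real.sin α / Real.sin (φ - α)) ^ 2 / v))
        = craigExp (Real.sin α ^ 2 / v) (φ - α) := fun φ => by
      rw [craigExp, div_pow, div_right_comm]
    simp_rw [e]
    rw [← integral_Ioc_eq_integral_Ioo, ← intervalIntegral.integral_of_le (by linarith),
      intervalIntegral.integral_comp_sub_right (craigExp (Real.sin α ^ 2 / v)), sub_self]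
    field_simp
    ring
  swap
  · exact div_nonneg hsα.le (Real.sin_pos_of_pos_of_lt_pi (by linarith [hφ.1])
      (by linarith [hφ.2])).le
  · intro φ hφ r hr
    simp only [hA, Set.mem_ofPred_eq]
    have e : (1 + r * Real.cos φ) * Real.sin α ≤ r * Real.sin φ * Real.cos α ↔
        Real.sin α ≤ r * Real.sin (φ - α) := by
      rw [Real.sin_sub]
      constructor <;> intro h <;> linarith
    rw [e]
    constructor
    · rintro ⟨h1, h2⟩
      have hs : 0 < Real.sin φ := pos_of_mul_pos_right h1 hr.le
      have hs' : 0 < Real.sin (φ - α) := pos_of_mul_pos_right (hsα.trans_le h2) hr.le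
      have hφ0 : 0 < φ := by
        by_contra hneg
        exact absurd hs (Real.sin_nonpos_of_nonpos_of_neg_pi_le (not_lt.1 hneg) hφ.1.le).not_gt
      refine ⟨⟨?_, hφ.2⟩, (div_le_iff₀ hs').2 h2⟩
      by_contra hneg
      exact absurd hs' (Real.sin_nonpos_of_nonpos_of_neg_pi_le
        (by linarith [not_lt.1 hneg]) (by linarith)).not_gt
    · rintro ⟨h1, h2⟩
      have hs' : 0 < Real.sin (φ - α) :=
        Real.sin_pos_of_pos_of_lt_pi (by linarith [h1.1]) (by linarith [h1.2])
      exact ⟨mul_pos hr (Real.sin_pos_of_pos_of_lt_pi (hα0.trans h1.1) h1.2),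
        (div_le_iff₀ hs').1 h2⟩

lemma awgnSEP_psk {δ : ℂ → ℂ} {v : ℝ≥0} (hv : v ≠ 0) (hM : 2 ≤ M)
    (hδ : IsMinDistDetector (Modulation.psk.constellation M) δ) :
    awgnSEP (Modulation.psk.constellation M) δ v
      = Real.pi⁻¹ * ∫ θ in (0 : ℝ)..(Real.pi - Real.pi / M),
        craigExp (Real.sin (Real.pi / M) ^ 2 / v) θ := by
  have hprob : ∀ c ∈ Modulation.psk.constellation M,
      (cgauss v).real {z | δ (c + z) ≠ c} = (cgauss v).real (pskErr M) := by
    intro c hc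
    have hc1 : ‖c‖ = 1 :=
      Complex.norm_eq_one_of_pow_eq_one ((mem_psk_iff hM c).1 hc) (by omega)
    let u : Circle := ⟨c, mem_sphere_zero_iff_norm.2 hc1⟩
    have hset : {z | δ (c + z) ≠ c} =ᵐ[cgauss v] ({z | ¬ ∀ c' ∈ Modulation.psk.constellation M,
        c' ≠ c → ‖z‖ < ‖z - (c' - c)‖} : Set ℂ) := by
      refine Filter.eventuallyEq_set.2 ?_
      filter_upwards [hδ.ae_eq_iff hv hc] with z hz
      simp only [ne_eq, hz]
    rw [measureReal_congr hset, measureReal_def, measureReal_def,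
      ← cgauss_preimage hv (rotation u)]
    congr 2
    ext z
    exact pskErr_rotate hM hc z
  have hne : (Modulation.psk.constellation M).Nonempty :=
    ⟨1, (mem_psk_iff hM 1).2 (one_pow _)⟩
  rw [awgnSEP, Finset.sum_congr rfl hprob, Finset.sum_const, nsmul_eq_mul, cgauss_pskErr hv hM,
    inv_mul_cancel_left₀]
  exact_mod_cast hne.card_pos.ne'

end PSK

/-! ### Common form of the error formulas and of `G` -/

lemma psk_angle {M : ℕ} (hM : 2 ≤ M) :
    ((M : ℝ) - 1) * Real.pi / M = Real.pi - Real.pi / M := by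
  have : (M : ℝ) ≠ 0 := by positivity
  field_simp

/-- The constant `κ` in the error exponent `κ / (v sin² θ)`. -/
noncomputable def Modulation.craigConst : Modulation → ℕ → ℝ
  | .pam, M => 3 / ((M : ℝ) ^ 2 - 1)
  | .psk, M => Real.sin (Real.pi / M) ^ 2
  | .qam, M => 3 / (2 * ((M : ℝ) - 1))

/-- The angular measure of Craig's formula for each modulation. -/
noncomputable def Modulation.craigMeasure : Modulation → ℕ → Measure ℝ
  | .pam, M => ENNReal.ofReal (2 * ((M : ℝ) - 1) / (M * Real.pi)) •
      volume.restrict (Set.Ioc 0 (Real.pi / 2))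
  | .psk, M => ENNReal.ofReal (1 / Real.pi) •
      volume.restrict (Set.Ioc 0 (((M : ℝ) - 1) * Real.pi / M))
  | .qam, M => ENNReal.ofReal (4 * (Real.sqrt M - 1) / (Real.sqrt M * Real.pi)) •
      volume.restrict (Set.Ioc (Real.pi / 4) (Real.pi / 2)) +
      ENNReal.ofReal (4 * (Real.sqrt M - 1) / (M * Real.pi)) •
      volume.restrict (Set.Ioc 0 (Real.pi / 4))

variable {mod : Modulation} {M : ℕ}

instance : IsFiniteMeasure (mod.craigMeasure M) := by
  have (c a b : ℝ) : IsFiniteMeasure (ENNReal.ofReal c • volume.restrict (Set.Ioc a b)) :=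
    Measure.smul_finite _ ENNReal.ofReal_ne_top
  cases mod <;> simp only [Modulation.craigMeasure] <;> infer_instance

lemma Modulation.ValidSize.two_le (hM : mod.ValidSize M) : 2 ≤ M := by
  cases mod
  · exact hM
  · exact hM
  · exact hM.1

lemma craigConst_pos (hM : mod.ValidSize M) : 0 < mod.craigConst M := by
  have hM2 : (2 : ℝ) ≤ M := by exact_mod_cast hM.two_le
  cases mod
  · exact div_pos (by norm_num) (by nlinarith)
  · have hpi := Real.pi_pos
    refine pow_pos (Real.sin_pos_of_pos_of_lt_pi (by positivity) ?_) 2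
    rw [div_lt_iff₀ (by linarith)]
    nlinarith
  · exact div_pos (by norm_num) (by linarith)

lemma integral_smul_restrict_Ioc {c a b : ℝ} (hc : 0 ≤ c) (hab : a ≤ b) (f : ℝ → ℝ) :
    ∫ θ, f θ ∂(ENNReal.ofReal c • volume.restrict (Set.Ioc a b)) = c * ∫ θ in a..b, f θ := by
  rw [integral_smul_measure, ENNReal.toReal_ofReal hc, intervalIntegral.integral_of_le hab,
    smul_eq_mul]

lemma one_le_sqrt_size (hM : 2 ≤ M) : 1 ≤ Real.sqrt M := by
  rw [Real.one_le_sqrt]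
  exact_mod_cast (by omega : 1 ≤ M)

lemma integral_craigMeasure_qam (hM : 2 ≤ M) {f : ℝ → ℝ} (hf : Measurable f)
    (h0 : ∀ θ, 0 ≤ f θ) (h1 : ∀ θ, f θ ≤ 1) :
    ∫ θ, f θ ∂(Modulation.qam.craigMeasure M)
      = 4 * (Real.sqrt M - 1) / (Real.sqrt M * Real.pi) *
        (∫ θ in (Real.pi / 4)..(Real.pi / 2), f θ) +
        4 * (Real.sqrt M - 1) / (M * Real.pi) * (∫ θ in (0 : ℝ)..(Real.pi / 4), f θ) := by
  have hs := one_le_sqrt_size hM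
  have hpi := Real.pi_pos
  have (c a b : ℝ) : IsFiniteMeasure (ENNReal.ofReal c • volume.restrict (Set.Ioc a b)) :=
    Measure.smul_finite _ ENNReal.ofReal_ne_top
  rw [Modulation.craigMeasure, integral_add_measure (integrable_of_mem_unit hf h0 h1)
    (integrable_of_mem_unit hf h0 h1), integral_smul_restrict_Ioc _ (by linarith),
    integral_smul_restrict_Ioc _ (by positivity)]
  · have : 0 ≤ Real.sqrt M - 1 := by linarith
    positivity
  · have : 0 ≤ Real.sqrt M - 1 := by linarith
    positivity

lemma zpow_ratio_mem {a : ℝ} (ha : 0 ≤ a) (θ : ℝ) (q : ℕ) :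
    0 ≤ ((1 + a / Real.sin θ ^ 2)⁻¹) ^ q ∧ ((1 + a / Real.sin θ ^ 2)⁻¹) ^ q ≤ 1 := by
  have : 0 ≤ a / Real.sin θ ^ 2 := by positivity
  exact ⟨by positivity, pow_le_one₀ (by positivity) (inv_le_one_of_one_le₀ (by linarith))⟩

/-- `G` as an average of the functions `x ↦ (1 + a / x)^(-q)`. -/
lemma G_eq_integral (hM : mod.ValidSize M) {η : ℝ} (hη : 0 < η) {Nr Nt : ℕ} (hN : Nt ≤ Nr)
    {x : ℝ} (hx : 0 < x) :
    mod.G M η Nr Nt x = ∫ θ, ((1 + mod.craigConst M * η / x / Real.sin θ ^ 2)⁻¹) ^ (Nr - Nt + 1)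
      ∂(mod.craigMeasure M) := by
  have hq : -((Nr : ℤ) - (Nt : ℤ) + 1) = -((Nr - Nt + 1 : ℕ) : ℤ) := by
    push_cast [Nat.cast_sub hN]; ring
  have hz : ∀ y : ℝ, y ^ (-((Nr : ℤ) - (Nt : ℤ) + 1)) = (y⁻¹) ^ (Nr - Nt + 1) := fun y => by
    rw [hq, _root_.zpow_neg, zpow_natCast, inv_pow]
  have hM2 := hM.two_le
  have hM2' : (2 : ℝ) ≤ M := by exact_mod_cast hM2
  have hpi := Real.pi_pos
  have hκ := craigConst_pos hM
  cases mod
  · simp only [Modulation.G, hz, Modulation.craigMeasure, Modulation.craigConst]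
    rw [integral_smul_restrict_Ioc _ (by positivity)]
    · congr 1
      refine intervalIntegral.integral_congr fun θ _ => ?_
      simp only [div_mul_eq_mul_div, div_div]
    · have : (0 : ℝ) ≤ M - 1 := by linarith
      positivity
  · simp only [Modulation.G, hz, Modulation.craigMeasure, Modulation.craigConst]
    rw [integral_smul_restrict_Ioc (by positivity)]
    · congr 1
      refine intervalIntegral.integral_congr fun θ _ => ?_
      simp only [div_div, mul_comm η]
    · have : (0 : ℝ) ≤ M - 1 := by linarith
      positivity
  · rw [integral_craigMeasure_qam hM2 (by fun_prop)
      (fun θ => (zpow_ratio_mem (by positivity) θ _).1)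
      (fun θ => (zpow_ratio_mem (by positivity) θ _).2)]
    simp only [Modulation.G, hz, Modulation.craigConst]
    simp only [div_mul_eq_mul_div, div_div]

lemma T_eq (mod : Modulation) (M : ℕ) (η : ℝ) (Nr Nt : ℕ) :
    mod.T M η Nr Nt = mod.craigConst M * η * ((Nr : ℝ) - Nt) / 2 := by
  cases mod <;> simp only [Modulation.T, Modulation.craigConst]
  · rw [div_mul_eq_mul_div, div_mul_eq_mul_div, div_div, mul_comm 2]
  · ring
  · rw [div_mul_eq_mul_div, div_mul_eq_mul_div, div_div]; ring_nf

/-- The error probability on the additive Gaussian channel by Craig's formula. -/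
lemma awgnSEP_eq (hM : mod.ValidSize M) {δ : ℂ → ℂ}
    (hδ : IsMinDistDetector (mod.constellation M) δ) {v : ℝ≥0} (hv : v ≠ 0) :
    awgnSEP (mod.constellation M) δ v
      = ∫ θ, craigExp (mod.craigConst M / v) θ ∂(mod.craigMeasure M) := by
  have hv' : (0 : ℝ) < v := by positivity
  have hM2 := hM.two_le
  have hM2' : (2 : ℝ) ≤ M := by exact_mod_cast hM2
  have hpi := Real.pi_pos
  have hκ := craigConst_pos hM
  cases mod
  · have hd : 0 < Real.sqrt (3 / ((M : ℝ) ^ 2 - 1)) := Real.sqrt_pos.2 hκ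
    -- PAM is the lattice with `M` columns and a single row.
    have hS : Modulation.pam.constellation M = (Finset.range M ×ˢ Finset.range 1).image
        (latticePt (Real.sqrt (3 / ((M : ℝ) ^ 2 - 1))) M 1) := by
      ext c
      simp [Modulation.constellation, latticePt]
    have hd2 : Real.sqrt (3 / ((M : ℝ) ^ 2 - 1)) ^ 2 = 3 / ((M : ℝ) ^ 2 - 1) := Real.sq_sqrt hκ.le
    rw [hS] at hδ ⊢
    rw [awgnSEP_lattice hv hd (by omega) one_pos hδ, gaussian_tail hv hd, hd2,
      Modulation.craigMeasure, integral_smul_restrict_Ioc _ (by positivity),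
      Modulation.craigConst]
    · push_cast
      field_simp
      ring
    · have : (0 : ℝ) ≤ M - 1 := by linarith
      positivity
  · rw [awgnSEP_psk hv hM2 hδ, Modulation.craigMeasure, integral_smul_restrict_Ioc
      (by positivity), psk_angle hM2, Modulation.craigConst, one_div]
    have : (0 : ℝ) ≤ M - 1 := by linarith
    positivity
  · obtain ⟨K, hK⟩ := hM.2
    have hsq : Nat.sqrt M = K := by rw [hK, Nat.sqrt_eq]
    have hMK : (M : ℝ) = K * K := by exact_mod_cast hK
    have hsqr : Real.sqrt M = K := by rw [hMK, Real.sqrt_mul_self (by positivity)]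
    have hK0 : 0 < K := by
      rcases Nat.eq_zero_or_pos K with rfl | h
      · omega
      · exact h
    have hK' : (0 : ℝ) < K := by exact_mod_cast hK0
    have hd : 0 < Real.sqrt (3 / (2 * ((M : ℝ) - 1))) := Real.sqrt_pos.2 hκ
    have hS : Modulation.qam.constellation M = (Finset.range K ×ˢ Finset.range K).image
        (latticePt (Real.sqrt (3 / (2 * ((M : ℝ) - 1)))) K K) := by
      simp only [Modulation.constellation, hsq]
      rfl
    have ha : (0 : ℝ) ≤ Modulation.qam.craigConst M / v := by positivity
    rw [hS] at hδ ⊢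
    have h2 := gaussian_tail_sq hv hd
    have h1 := gaussian_tail hv hd
    have hd2 : Real.sqrt (3 / (2 * ((M : ℝ) - 1))) ^ 2 = 3 / (2 * ((M : ℝ) - 1)) :=
      Real.sq_sqrt hκ.le
    rw [hd2] at h1 h2
    rw [integral_craigMeasure_qam hM2 (measurable_craigExp _) (craigExp_nonneg _)
      (craigExp_le_one ha), awgnSEP_lattice hv hd hK0 hK0 hδ, hsqr]
    have hadd := intervalIntegral.integral_add_adjacent_intervals
      (intervalIntegrable_craigExp ha 0 (Real.pi / 4))
      (intervalIntegrable_craigExp ha (Real.pi / 4) (Real.pi / 2))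
    rw [Modulation.craigConst] at hadd ⊢
    rw [← hadd] at h1
    set g := (gaussianReal 0 (v / 2)).real (Set.Ici (Real.sqrt (3 / (2 * ((M : ℝ) - 1)))))
    -- The linear term is an integral over `[0, π/2]` and the quadratic one over `[0, π/4]`. On `[0,
    -- π/4]` they combine to the weight `4 (K - 1) / K²`, where `K² = M`.
    have e : 1 - (1 - 2 * ((K : ℝ) - 1) / K * g) * (1 - 2 * ((K : ℝ) - 1) / K * g)
        = 4 * (K - 1) / K * g - 4 * (K - 1) ^ 2 / K ^ 2 * g ^ 2 := by ring
    rw [e, h2, h1]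
    have hMM : (M : ℝ) * Real.pi = K * K * Real.pi := by rw [hMK]
    rw [hMM]
    generalize (∫ θ in (0 : ℝ)..(Real.pi / 4), craigExp (3 / (2 * ((M : ℝ) - 1)) / v) θ) = I1
    generalize (∫ θ in (Real.pi / 4)..(Real.pi / 2), craigExp (3 / (2 * ((M : ℝ) - 1)) / v) θ) = I2
    field_simp
    ring

/-! ### From the transmission model to scalar Gaussian channels -/

/-- No rank condition is needed: the matrix inverse used here keeps positive semidefiniteness even
for singular Gram matrices. -/
lemma zfGain_nonneg {n m : ℕ} (A : Matrix (Fin n) (Fin m) ℂ) (k : Fin m) : 0 ≤ zfGain A k := by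
  have h := (Matrix.posSemidef_conjTranspose_mul_self A).inv.diag_nonneg (i := k)
  exact inv_nonneg.2 (Complex.le_def.1 h).1

lemma uniformOn_prod_apply (S : Finset ℂ) (ν : Measure ℂ) [SFinite ν] {D : Set (ℂ × ℂ)}
    (hD : MeasurableSet D) :
    ((uniformOn (S : Set ℂ)).prod ν) D = (S.card : ℝ≥0∞)⁻¹ * ∑ c ∈ S, ν {z | (c, z) ∈ D} := by
  rw [Measure.prod_apply hD, uniformOn, ProbabilityTheory.cond, lintegral_smul_measure,
    lintegral_finset, Measure.count_apply_finset, smul_eq_mul]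
  simp only [Measure.count_singleton, mul_one]
  rfl

lemma measurable_mul_right {Ω : Type*} [MeasurableSpace Ω] {n m : ℕ}
    {A : Ω → Matrix (Fin n) (Fin m) ℂ} (hA : ∀ i j, Measurable fun ω => A ω i j)
    (F : Matrix (Fin m) (Fin m) ℂ) (i : Fin n) (j : Fin m) :
    Measurable fun ω => (A ω * F) i j := by
  simp_rw [Matrix.mul_apply]
  exact Finset.measurable_fun_sum _ fun l _ => (hA i l).mul_const _

lemma measurable_pinv {Ω : Type*} [MeasurableSpace Ω] {n m : ℕ}
    {A : Ω → Matrix (Fin n) (Fin m) ℂ} (hA : ∀ i j, Measurable fun ω => A ω i j)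
    (i : Fin m) (j : Fin n) : Measurable fun ω => pinv (A ω) i j := by
  simp_rw [pinv, Matrix.mul_apply, Matrix.conjTranspose_apply, RCLike.star_def]
  exact Finset.measurable_fun_sum _ fun l _ =>
    (measurable_matrix_inv (measurable_gram hA) i l).mul
      (Complex.continuous_conj.measurable.comp (hA j l))

section Model

variable {Ω : Type*} [MeasurableSpace Ω] {P : Measure Ω} {Nr Nt : ℕ}
  {Sig : Matrix (Fin Nt) (Fin Nt) ℂ} {σ : ℝ} {S : Finset ℂ}
  {H : Ω → Matrix (Fin Nr) (Fin Nt) ℂ} {s : Ω → Fin Nt → ℂ} {ξ : Ω → Fin Nr → ℂ}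

/-- The noise variance of the `k`-th stream after zero forcing. -/
noncomputable def streamVar (σ : ℝ) (F : Matrix (Fin Nt) (Fin Nt) ℂ)
    (A : Matrix (Fin Nr) (Fin Nt) ℂ) (k : Fin Nt) : ℝ≥0 :=
  (σ ^ 2 / zfGain (A * F) k).toNNReal

lemma streamVar_coe (σ : ℝ) (F : Matrix (Fin Nt) (Fin Nt) ℂ) (A : Matrix (Fin Nr) (Fin Nt) ℂ)
    (k : Fin Nt) : (streamVar σ F A k : ℝ) = σ ^ 2 / zfGain (A * F) k :=
  Real.coe_toNNReal _ (div_nonneg (sq_nonneg _) (zfGain_nonneg _ _))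

namespace IsMIMOModel

lemma isRayleigh (h : IsMIMOModel P Sig σ S H s ξ) (F : Matrix (Fin Nt) (Fin Nt) ℂ) :
    IsRayleigh (fun ω => H ω * F) (Fᴴ * Sig * F) P :=
  IsRayleigh.mul h.channel F

lemma aemeasurable_channel (h : IsMIMOModel P Sig σ S H s ξ) :
    AEMeasurable (fun ω (p : Fin Nr × Fin Nt) => H ω p.1 p.2) P := by
  have hc : Measurable fun x : Fin Nr × Fin Nt → ℂ => fun p => conj (x p) :=
    measurable_pi_lambda _ fun p =>
      Complex.continuous_conj.measurable.comp (measurable_pi_apply p)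
  have := hc.comp_aemeasurable h.channel.gaussian.aemeasurable
  simpa [Function.comp_def] using this

lemma map_triple (h : IsMIMOModel P Sig σ S H s ξ) (k : Fin Nt) :
    P.map (fun ω => ((fun p : Fin Nr × Fin Nt => H ω p.1 p.2), (s ω k, ξ ω)))
      = (P.map fun ω (p : Fin Nr × Fin Nt) => H ω p.1 p.2).prod
        ((uniformOn (S : Set ℂ)).prod (P.map ξ)) := by
  have := h.noise.gaussian.isProbabilityMeasure
  have hk : Measurable fun q : (Fin Nt → ℂ) × (Fin Nr → ℂ) => (q.1 k, q.2) :=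
    ((measurable_pi_apply k).comp measurable_fst).prodMk measurable_snd
  have h1 := h.indep_channel.comp measurable_id hk
  have h2 := h.indep_symbol_noise.comp (measurable_pi_apply k) measurable_id
  have hξ := h.noise.gaussian.aemeasurable
  have hs := (h.symbol_law k).aemeasurable
  have e1 := (indepFun_iff_map_prod_eq_prod_map_map h.aemeasurable_channel (hs.prodMk hξ)).1 h1
  have e2 := (indepFun_iff_map_prod_eq_prod_map_map hs hξ).1 h2
  rw [(h.symbol_law k).map_eq] at e2
  exact e1.trans (by rw [← e2])

/-- `A⁺ (A⁺)ᴴ = (Aᴴ A)⁻¹`, so its diagonal entry scaled by `σ²` is the variance after filtering. -/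
lemma map_stream_noise (h : IsMIMOModel P Sig σ S H s ξ) {F : Matrix (Fin Nt) (Fin Nt) ℂ}
    {A : Matrix (Fin Nr) (Fin Nt) ℂ} (hA : Function.Injective (A * F).mulVec) (k : Fin Nt) :
    (P.map ξ).map (fun x => (pinv (A * F) *ᵥ x) k) = cgauss (streamVar σ F A k) := by
  have hl := h.noise.linear (pinv (A * F))
  have hm : Measurable fun x : Fin Nr → ℂ => (pinv (A * F) *ᵥ x) k := by
    simp only [Matrix.mulVec, dotProduct]
    fun_prop
  rw [AEMeasurable.map_map_of_aemeasurable hm.aemeasurable h.noise.gaussian.aemeasurable]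
  refine hl.map_eq_cgauss k ?_
  rw [Matrix.mul_smul, Matrix.mul_one, Matrix.smul_mul, pinv_mul_conjTranspose hA,
    Matrix.smul_apply, (gram_inv_diag hA k).1, streamVar_coe, zfGain, div_inv_eq_mul]
  push_cast
  rfl

lemma ae_injective (h : IsMIMOModel P Sig σ S H s ξ) (hN : Nt ≤ Nr)
    {F : Matrix (Fin Nt) (Fin Nt) ℂ} (hC : (Fᴴ * Sig * F).PosDef) :
    ∀ᵐ ω ∂P, Function.Injective (H ω * F).mulVec :=
  (h.isRayleigh F).ae_injective hN hC

/-- Conditioning on the channel: symbol and noise are independent of it and of each other, so for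
fixed `H` the pair consists of a uniform symbol and independent circular Gaussian noise. -/
lemma measure_stream (h : IsMIMOModel P Sig σ S H s ξ) (hN : Nt ≤ Nr) (hS : S.Nonempty)
    {F : Matrix (Fin Nt) (Fin Nt) ℂ} (hC : (Fᴴ * Sig * F).PosDef) (k : Fin Nt)
    {D : Set (ℂ × ℂ)} (hD : MeasurableSet D) :
    P {ω | (s ω k, (pinv (H ω * F) *ᵥ ξ ω) k) ∈ D}
      = ∫⁻ ω, (S.card : ℝ≥0∞)⁻¹ *
          ∑ c ∈ S, cgauss (streamVar σ F (H ω) k) {z | (c, z) ∈ D} ∂P := by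
  have := h.noise.gaussian.isProbabilityMeasure
  let T : (Fin Nr × Fin Nt → ℂ) × (ℂ × (Fin Nr → ℂ)) → ℂ × ℂ := fun q =>
    (q.2.1, (pinv ((Matrix.of fun i j => q.1 (i, j)) * F) *ᵥ q.2.2) k)
  have hentry : ∀ (i : Fin Nr) (j : Fin Nt),
      Measurable fun q : (Fin Nr × Fin Nt → ℂ) × (ℂ × (Fin Nr → ℂ)) =>
        (Matrix.of fun i j => q.1 (i, j) : Matrix (Fin Nr) (Fin Nt) ℂ) i j := fun i j =>
    (measurable_pi_apply (i, j)).comp measurable_fst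
  have hT : Measurable T := by
    refine (measurable_fst.comp measurable_snd).prodMk ?_
    simp only [Matrix.mulVec, dotProduct]
    exact Finset.measurable_fun_sum _ fun l _ =>
      (measurable_pinv (measurable_mul_right hentry F) k l).mul
        ((measurable_pi_apply l).comp (measurable_snd.comp measurable_snd))
  have hξ := h.noise.gaussian.aemeasurable
  have hs := (h.symbol_law k).aemeasurable
  have hPξ := Measure.isProbabilityMeasure_map (μ := P) hξ
  have hPS := isProbabilityMeasure_uniformOn S.finite_toSet hS
  have hmeas := h.aemeasurable_channel.prodMk (hs.prodMk hξ)
  have e1 : P {ω | (s ω k, (pinv (H ω * F) *ᵥ ξ ω) k) ∈ D}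
      = P.map (fun ω => ((fun p : Fin Nr × Fin Nt => H ω p.1 p.2), (s ω k, ξ ω))) (T ⁻¹' D) := by
    rw [Measure.map_apply_of_aemeasurable hmeas (hT hD)]
    rfl
  rw [e1, h.map_triple k, Measure.prod_apply (hT hD),
    lintegral_map' (measurable_measure_prodMk_left (hT hD)).aemeasurable h.aemeasurable_channel]
  refine lintegral_congr_ae ?_
  filter_upwards [h.ae_injective hN hC] with ω hω
  have hm : Measurable fun x : Fin Nr → ℂ => (pinv (H ω * F) *ᵥ x) k := by
    simp only [Matrix.mulVec, dotProduct]
    fun_prop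
  rw [← uniformOn_prod_apply S _ hD, ← h.map_stream_noise hω k,
    ← Measure.map_id (μ := uniformOn (S : Set ℂ)), Measure.map_prod_map _ _ measurable_id hm,
    Measure.map_apply (measurable_id.prodMap hm) hD, Measure.map_id]
  rfl

lemma streamVar_ne_zero (hσ : 0 < σ) {F : Matrix (Fin Nt) (Fin Nt) ℂ}
    {A : Matrix (Fin Nr) (Fin Nt) ℂ} (hA : Function.Injective (A * F).mulVec) (k : Fin Nt) :
    streamVar σ F A k ≠ 0 := by
  have h1 := zfGain_pos hA k
  exact (Real.toNNReal_pos.2 (by positivity)).ne'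

/-- Ties between the transmitted point and another one have probability zero. -/
lemma ae_no_tie (h : IsMIMOModel P Sig σ S H s ξ) (hN : Nt ≤ Nr) (hσ : 0 < σ) (hS : S.Nonempty)
    {F : Matrix (Fin Nt) (Fin Nt) ℂ} (hC : (Fᴴ * Sig * F).PosDef) (k : Fin Nt) :
    ∀ᵐ ω ∂P, s ω k ∈ S → ∀ c' ∈ S, c' ≠ s ω k →
      ‖(pinv (H ω * F) *ᵥ ξ ω) k‖ ≠ ‖(pinv (H ω * F) *ᵥ ξ ω) k - (c' - s ω k)‖ := by
  let D : Set (ℂ × ℂ) := ⋃ c ∈ S, ⋃ c' ∈ S.erase c,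
    {q | q.1 = c ∧ ‖q.2‖ = ‖q.2 - (c' - c)‖}
  have hD : MeasurableSet D := by
    refine Finset.measurableSet_biUnion _ fun c _ => Finset.measurableSet_biUnion _ fun c' _ => ?_
    exact (measurableSet_eq_fun measurable_fst measurable_const).inter
      (measurableSet_eq_fun (by fun_prop) (by fun_prop))
  have hzero : P {ω | (s ω k, (pinv (H ω * F) *ᵥ ξ ω) k) ∈ D} = 0 := by
    rw [h.measure_stream hN hS hC k hD, lintegral_congr_ae (g := 0), Pi.zero_def, lintegral_zero]
    filter_upwards [h.ae_injective hN hC] with ω hω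
    refine mul_eq_zero_of_right _ (Finset.sum_eq_zero fun c _ => ?_)
    have : ∀ᵐ z ∂(cgauss (streamVar σ F (H ω) k)), ∀ c' ∈ S.erase c, ‖z‖ ≠ ‖z - (c' - c)‖ := by
      rw [Finset.eventually_all]
      exact fun c' hc' => ae_norm_ne (streamVar_ne_zero hσ hω k)
        (sub_ne_zero.2 (Finset.ne_of_mem_erase hc'))
    rw [ae_iff] at this
    refine measure_mono_null (fun z hz => ?_) this
    simp only [D, Set.mem_ofPred_eq, Set.mem_iUnion] at hz ⊢
    obtain ⟨c₁, _, c', hc', rfl, heq⟩ := hz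
    exact fun hall => hall c' hc' heq
  have hnotie : ∀ᵐ ω ∂P, (s ω k, (pinv (H ω * F) *ᵥ ξ ω) k) ∉ D := by
    rw [ae_iff]; simpa using hzero
  filter_upwards [hnotie] with ω h3 h2 c' hc' hne heq
  refine h3 ?_
  simp only [D, Set.mem_iUnion, Set.mem_ofPred_eq, Finset.mem_erase]
  exact ⟨_, h2, c', ⟨hne, hc'⟩, rfl, heq⟩

/-- The error probability is the average of the conditional ones given the channel. -/
lemma measure_error (h : IsMIMOModel P Sig σ S H s ξ) (hN : Nt ≤ Nr) (hσ : 0 < σ)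
    {δ : ℂ → ℂ} (hδ : IsMinDistDetector S δ)
    {F : Matrix (Fin Nt) (Fin Nt) ℂ} (hC : (Fᴴ * Sig * F).PosDef) (k : Fin Nt) :
    P {ω | δ (zfOutput F (H ω) (s ω) (ξ ω) k) ≠ s ω k}
      = ∫⁻ ω, ENNReal.ofReal (awgnSEP S δ (streamVar σ F (H ω) k)) ∂P := by
  have hS : S.Nonempty := ⟨_, (hδ 0).1⟩
  have hcard : (0 : ℝ) < S.card := by exact_mod_cast hS.card_pos
  have hinj := h.ae_injective hN hC
  -- The detector `δ` need not be measurable. The set `D`, which counts ties as errors, is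
  -- measurable and agrees with the error event almost surely.
  let D : Set (ℂ × ℂ) := ⋃ c ∈ S, ⋃ c' ∈ S.erase c,
    {q | q.1 = c ∧ ‖q.2 - (c' - c)‖ ≤ ‖q.2‖}
  have hD : MeasurableSet D := by
    refine Finset.measurableSet_biUnion _ fun c _ => Finset.measurableSet_biUnion _ fun c' _ => ?_
    exact (measurableSet_eq_fun measurable_fst measurable_const).inter
      (measurableSet_le (measurable_snd.sub_const _).norm measurable_snd.norm)
  have hDmem : ∀ c ∈ S, ∀ z, (c, z) ∈ D ↔
      ¬ ∀ c' ∈ S, c' ≠ c → ‖z‖ < ‖z - (c' - c)‖ := by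
    intro c hc z
    simp only [D, Set.mem_iUnion, Set.mem_ofPred_eq, Finset.mem_erase]
    push Not
    constructor
    · rintro ⟨_, _, c', hc', rfl, hle⟩
      exact ⟨c', hc'.2, hc'.1, hle⟩
    · rintro ⟨c', hc', hne, hle⟩
      exact ⟨c, hc, c', ⟨hne, hc'⟩, rfl, hle⟩
  have hsym : ∀ᵐ ω ∂P, s ω k ∈ S := by
    have h1 : ∀ᵐ c ∂(uniformOn (S : Set ℂ)), c ∈ S := ae_cond_mem S.measurableSet
    rw [← (h.symbol_law k).map_eq] at h1
    exact ae_of_ae_map (h.symbol_law k).aemeasurable h1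
  have hset : {ω | δ (zfOutput F (H ω) (s ω) (ξ ω) k) ≠ s ω k} =ᵐ[P]
      ({ω | (s ω k, (pinv (H ω * F) *ᵥ ξ ω) k) ∈ D} : Set Ω) := by
    refine Filter.eventuallyEq_set.2 ?_
    filter_upwards [hinj, hsym, h.ae_no_tie hN hσ hS hC k] with ω h1 h2 h3
    rw [hDmem _ h2, zfOutput_eq h1, Pi.add_apply, ne_eq, not_iff_not]
    exact hδ.eq_iff h2 (h3 h2)
  rw [measure_congr hset, h.measure_stream hN hS hC k hD]
  refine lintegral_congr_ae ?_
  filter_upwards [hinj] with ω hωi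
  have hω := streamVar_ne_zero hσ hωi k
  rw [awgnSEP, ENNReal.ofReal_mul (by positivity), ENNReal.ofReal_inv_of_pos hcard,
    ENNReal.ofReal_natCast, ENNReal.ofReal_sum_of_nonneg fun _ _ => measureReal_nonneg]
  congr 1
  refine Finset.sum_congr rfl fun c hc => ?_
  rw [ofReal_measureReal]
  refine measure_congr (Filter.eventuallyEq_set.2 ?_)
  filter_upwards [hδ.ae_eq_iff hω hc] with z hz
  rw [hDmem c hc, ne_eq, hz]

lemma aemeasurable_zfGain (h : IsMIMOModel P Sig σ S H s ξ) (F : Matrix (Fin Nt) (Fin Nt) ℂ)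
    (k : Fin Nt) : AEMeasurable (fun ω => zfGain (H ω * F) k) P := by
  have hentry : ∀ (i : Fin Nr) (j : Fin Nt), Measurable fun x : Fin Nr × Fin Nt → ℂ =>
      (Matrix.of fun i j => x (i, j) : Matrix (Fin Nr) (Fin Nt) ℂ) i j := fun i j =>
    measurable_pi_apply (i, j)
  have hm := measurable_zfGain (measurable_mul_right hentry F) k
  refine (hm.comp_aemeasurable h.aemeasurable_channel).congr (ae_of_all _ fun ω => ?_)
  have e : (Matrix.of fun i j => H ω i j : Matrix (Fin Nr) (Fin Nt) ℂ) = H ω := rfl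
  simp only [Function.comp_apply, e]

/-- The symbol error probability of one stream. -/
theorem stream_sep {mod : Modulation} {M : ℕ} (hM : mod.ValidSize M)
    (h : IsMIMOModel P Sig σ (mod.constellation M) H s ξ) (hN : Nt ≤ Nr) (hσ : 0 < σ) {η : ℝ}
    (hη : η = 1 / σ ^ 2) {δ : ℂ → ℂ} (hδ : IsMinDistDetector (mod.constellation M) δ)
    {F : Matrix (Fin Nt) (Fin Nt) ℂ} (hC : (Fᴴ * Sig * F).PosDef) (k : Fin Nt) :
    P.real {ω | δ (zfOutput F (H ω) (s ω) (ξ ω) k) ≠ s ω k}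
      = mod.G M η Nr Nt ((Fᴴ * Sig * F)⁻¹ k k).re := by
  have := h.noise.gaussian.isProbabilityMeasure
  have hinj := h.ae_injective hN hC
  obtain ⟨x, hx0, hx⟩ := posDef_diag_coe hC.inv k
  have hxpos : (0 : ℝ) < x := by positivity
  have hη0 : 0 < η := by rw [hη]; positivity
  have hκ := craigConst_pos hM
  have hγ := h.aemeasurable_zfGain F k
  -- With noise variance `σ² / γ`, Craig's integrand is `exp(-t γ)` for `t = κ η / sin² θ`. After
  -- exchanging the integrals, the one over the channel is the Laplace transform of the gain at `t`.
  let f : Ω → ℝ → ℝ := fun ω θ =>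
    Real.exp (-(mod.craigConst M * η / Real.sin θ ^ 2) * zfGain (H ω * F) k)
  have hf0 : ∀ ω θ, 0 ≤ f ω θ := fun ω θ => (Real.exp_pos _).le
  have hf1 : ∀ ω θ, f ω θ ≤ 1 := fun ω θ => by
    rw [Real.exp_le_one_iff, neg_mul, neg_nonpos]
    exact mul_nonneg (by positivity) (zfGain_nonneg _ _)
  have hfi : Integrable (Function.uncurry f) (P.prod (mod.craigMeasure M)) := by
    refine Integrable.of_bound ?_ 1 (ae_of_all _ fun q => ?_)
    · refine AEMeasurable.aestronglyMeasurable ?_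
      refine Real.measurable_exp.comp_aemeasurable (AEMeasurable.mul ?_ hγ.comp_fst)
      exact (by fun_prop : Measurable fun q : Ω × ℝ =>
        -(mod.craigConst M * η / Real.sin q.2 ^ 2)).aemeasurable
    · rw [Real.norm_eq_abs]
      exact (abs_of_nonneg (hf0 q.1 q.2)).trans_le (hf1 q.1 q.2)
  have hsep : ∀ᵐ ω ∂P, ENNReal.ofReal (awgnSEP (mod.constellation M) δ (streamVar σ F (H ω) k))
      = ENNReal.ofReal (∫ θ, f ω θ ∂(mod.craigMeasure M)) := by
    filter_upwards [hinj] with ω hωi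
    rw [awgnSEP_eq hM hδ (streamVar_ne_zero hσ hωi k)]
    refine congrArg _ (integral_congr_ae (ae_of_all _ fun θ => ?_))
    have hg := zfGain_pos hωi k
    simp only [f, craigExp, streamVar_coe, hη]
    congr 1
    field_simp
  rw [measureReal_def, h.measure_error hN hσ hδ hC k,
    lintegral_congr_ae hsep, ← integral_eq_lintegral_of_nonneg_ae
      (ae_of_all _ fun ω => integral_nonneg (hf0 ω)) hfi.integral_prod_left.aestronglyMeasurable,
    integral_integral_swap hfi, hx, Complex.ofReal_re, G_eq_integral hM hη0 hN hxpos]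
  refine integral_congr_ae (ae_of_all _ fun θ => ?_)
  simp only [f]
  rw [(h.isRayleigh F).integral_exp_zfGain hN hC k (by positivity), hx, Complex.ofReal_re,
    div_right_comm]

end IsMIMOModel

end Model

/-! ### Monotonicity and convexity of `G` -/

section Scalar

/-- The function averaged in `G`, on positive arguments. -/
lemma inv_one_add_div_pow {a x : ℝ} (hx : 0 < x) (q : ℕ) :
    ((1 + a / x)⁻¹) ^ q = (x / (x + a)) ^ q := by
  congr 1
  rw [one_add_div hx.ne', inv_div]

lemma monotone_ratio {a x y : ℝ} (ha : 0 ≤ a) (hx : 0 < x) (hxy : x ≤ y) (q : ℕ) :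
    ((1 + a / x)⁻¹) ^ q ≤ ((1 + a / y)⁻¹) ^ q := by
  have hy := hx.trans_le hxy
  gcongr

lemma hasDerivAt_ratio_pow (n : ℕ) {a x : ℝ} (h : x + a ≠ 0) :
    HasDerivAt (fun x : ℝ => (x / (x + a)) ^ (n + 2))
      ((n + 2) * a * (x ^ (n + 1) / (x + a) ^ (n + 3))) x := by
  have h1 : HasDerivAt (fun x : ℝ => x / (x + a)) (a / (x + a) ^ 2) x := by
    have := (hasDerivAt_id x).fun_div ((hasDerivAt_id x).add_const a) h
    simpa using this
  have := h1.fun_pow (n + 2)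
  convert! this using 1
  push_cast
  simp only [div_pow]
  field_simp
  ring

lemma hasDerivAt_ratio_pow_deriv (n : ℕ) {a x : ℝ} (h : x + a ≠ 0) :
    HasDerivAt (fun x : ℝ => (n + 2) * a * (x ^ (n + 1) / (x + a) ^ (n + 3)))
      ((n + 2) * a * (x ^ n * ((n + 1) * a - 2 * x) / (x + a) ^ (n + 4))) x := by
  have h1 := (hasDerivAt_pow (n + 1) x).fun_div
    (((hasDerivAt_id x).add_const a).fun_pow (n + 3)) (pow_ne_zero _ h)
  have := h1.const_mul ((n + 2) * a)
  convert! this using 1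
  congr 1
  simp only [id_eq, Nat.add_sub_cancel, show n + 3 - 1 = n + 2 by omega]
  push_cast
  field_simp
  ring

/-- Up to nonnegative factors the second derivative is `(n + 1) a - 2 x`. Here `n + 2` stands for `q
= Nr - Nt + 1`, which is at least 2 when `Nt < Nr`. -/
lemma convexOn_ratio (n : ℕ) {a : ℝ} (ha : 0 ≤ a) :
    ConvexOn ℝ (Set.Ioc 0 ((n + 1) * a / 2)) fun x => ((1 + a / x)⁻¹) ^ (n + 2) := by
  have hpos : ∀ x ∈ Set.Ioc 0 ((n + 1) * a / 2), x + a ≠ 0 := fun x hx => by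
    have := hx.1
    positivity
  refine ConvexOn.congr (f := fun x : ℝ => (x / (x + a)) ^ (n + 2)) ?_
    fun x hx => (inv_one_add_div_pow hx.1 _).symm
  refine convexOn_of_hasDerivWithinAt2_nonneg (convex_Ioc _ _)
    (f' := fun x => (n + 2) * a * (x ^ (n + 1) / (x + a) ^ (n + 3)))
    (f'' := fun x => (n + 2) * a * (x ^ n * ((n + 1) * a - 2 * x) / (x + a) ^ (n + 4)))
    (fun x hx => (hasDerivAt_ratio_pow n (hpos x hx)).continuousAt.continuousWithinAt)
    (fun x hx => (hasDerivAt_ratio_pow n (hpos x (interior_subset hx))).hasDerivWithinAt)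
    (fun x hx => (hasDerivAt_ratio_pow_deriv n (hpos x (interior_subset hx))).hasDerivWithinAt)
    fun x hx => ?_
  have h := interior_subset hx
  have h0 := h.1
  have h1 : 0 ≤ (n + 1) * a - 2 * x := by linarith [h.2]
  positivity

variable {mod : Modulation} {M : ℕ} {η : ℝ} {Nr Nt : ℕ}

lemma integrable_ratio (hM : mod.ValidSize M) (hη : 0 < η) {x : ℝ} (hx : 0 < x) (q : ℕ) :
    Integrable (fun θ => ((1 + mod.craigConst M * η / x / Real.sin θ ^ 2)⁻¹) ^ q)
      (mod.craigMeasure M) := by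
  have hκ := craigConst_pos hM
  exact integrable_of_mem_unit (by fun_prop) (fun θ => (zpow_ratio_mem (by positivity) θ _).1)
      (fun θ => (zpow_ratio_mem (by positivity) θ _).2)

lemma G_mono (hM : mod.ValidSize M) (hη : 0 < η) (hN : Nt ≤ Nr) {x y : ℝ} (hx : 0 < x)
    (hxy : x ≤ y) : mod.G M η Nr Nt x ≤ mod.G M η Nr Nt y := by
  have hκ := craigConst_pos hM
  rw [G_eq_integral hM hη hN hx, G_eq_integral hM hη hN (hx.trans_le hxy)]
  refine integral_mono (integrable_ratio hM hη hx _)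
    (integrable_ratio hM hη (hx.trans_le hxy) _) fun θ => ?_
  simp only [div_right_comm _ x, div_right_comm _ y]
  exact monotone_ratio (by positivity) hx hxy _

/-- Jensen's inequality for `G` below the convexity threshold. -/
lemma G_jensen (hM : mod.ValidSize M) (hη : 0 < η) (hN : Nt < Nr) [NeZero Nt] {x : Fin Nt → ℝ}
    (hx0 : ∀ k, 0 < x k) (hxT : ∀ k, x k ≤ mod.T M η Nr Nt) :
    mod.G M η Nr Nt (1 / (Nt : ℝ) * ∑ k, x k) ≤ 1 / (Nt : ℝ) * ∑ k, mod.G M η Nr Nt (x k) := by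
  have hκ := craigConst_pos hM
  have hNt : (0 : ℝ) < Nt := by exact_mod_cast Nat.pos_of_ne_zero (NeZero.ne Nt)
  have hmean : 0 < 1 / (Nt : ℝ) * ∑ k, x k :=
    mul_pos (by positivity) (Finset.sum_pos (fun k _ => hx0 k) Finset.univ_nonempty)
  obtain ⟨n, hn⟩ : ∃ n, Nr = Nt + (n + 1) := ⟨Nr - Nt - 1, by omega⟩
  have hq : Nr - Nt + 1 = n + 2 := by omega
  have hT : mod.T M η Nr Nt = (n + 1) * (mod.craigConst M * η) / 2 := by
    rw [T_eq, hn]; push_cast; ring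
  rw [G_eq_integral hM hη hN.le hmean]
  simp_rw [fun k => G_eq_integral hM hη hN.le (hx0 k)]
  rw [← integral_finsetSum _ fun k _ => integrable_ratio hM hη (hx0 k) _, ← integral_const_mul]
  refine integral_mono (integrable_ratio hM hη hmean _)
    ((integrable_finsetSum _ fun k _ => integrable_ratio hM hη (hx0 k) _).const_mul _) fun θ => ?_
  simp only [hq]
  -- Division by zero makes every integrand equal to 1 here, so the inequality is an equality.
  by_cases hs : Real.sin θ = 0
  · simp [hs, hNt.ne']
  have hs2 : 0 < Real.sin θ ^ 2 := by positivity
  have hs1 : Real.sin θ ^ 2 ≤ 1 := Real.sin_sq_le_one θ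
  -- The convexity interval is shortest at `sin² θ = 1`, where its right end is `T`; for other
  -- angles it is longer.
  have hle : mod.craigConst M * η ≤ mod.craigConst M * η / Real.sin θ ^ 2 := by
    rw [le_div_iff₀ hs2]
    exact mul_le_of_le_one_right (by positivity) hs1
  have hconv := convexOn_ratio n (a := mod.craigConst M * η / Real.sin θ ^ 2) (by positivity)
  have hj := hconv.map_sum_le (t := Finset.univ) (w := fun _ : Fin Nt => 1 / (Nt : ℝ)) (p := x)
    (fun _ _ => by positivity) (by simp [hNt.ne']) (fun k _ => ⟨hx0 k, (hxT k).trans (by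
      rw [hT]
      gcongr)⟩)
  simp only [smul_eq_mul, ← Finset.mul_sum] at hj
  simp only [div_right_comm _ _ (Real.sin θ ^ 2)]
  exact hj

end Scalar

/-! ### Spectral bounds, Cauchy-Schwarz and the Fourier matrix -/

section LinearAlgebra

variable {n : ℕ}

lemma posSemidef_sub_of_le {U : Matrix (Fin n) (Fin n) ℂ} (hU : U ∈ Matrix.unitaryGroup (Fin n) ℂ)
    {d : Fin n → ℝ} {c : ℝ} (hc : ∀ k, c ≤ d k) :
    (U * Matrix.diagonal (fun k => (d k : ℂ)) * Uᴴ - (c : ℂ) • 1).PosSemidef := by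
  have hUU : U * Uᴴ = 1 := Matrix.mem_unitaryGroup_iff.1 hU
  have h : U * Matrix.diagonal (fun k => (d k : ℂ)) * Uᴴ - (c : ℂ) • 1
      = U * Matrix.diagonal (fun k => ((d k - c : ℝ) : ℂ)) * Uᴴ := by
    have : Matrix.diagonal (fun k => ((d k - c : ℝ) : ℂ))
        = Matrix.diagonal (fun k => (d k : ℂ)) - (c : ℂ) • (1 : Matrix (Fin n) (Fin n) ℂ) := by
      rw [← Matrix.diagonal_one, ← Matrix.diagonal_smul, Matrix.diagonal_sub]
      congr 1
      funext k
      simp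
    rw [this, Matrix.mul_sub, Matrix.sub_mul, Matrix.mul_smul, Matrix.mul_one, Matrix.smul_mul, hUU]
  rw [h]
  refine Matrix.PosSemidef.mul_mul_conjTranspose_same ?_ U
  refine Matrix.posSemidef_diagonal_iff.2 fun k => ?_
  exact_mod_cast sub_nonneg.2 (hc k)

lemma posSemidef_gram_sub (F : Matrix (Fin n) (Fin n) ℂ) :
    (Fᴴ * F - (minEigGram F : ℂ) • 1).PosSemidef := by
  have hA := isHermitian_conjTranspose_mul_self F
  have h := posSemidef_sub_of_le hA.eigenvectorUnitary.2 (d := hA.eigenvalues)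
    (c := minEigGram F) fun k => ciInf_le (Set.finite_range _).bddBelow k
  convert! h using 2
  exact hA.spectral_theorem

/-- Diagonal entries of the inverse of a matrix bounded below by a multiple of the identity. -/
lemma inv_diag_le {C : Matrix (Fin n) (Fin n) ℂ} (hC : C.PosDef) {c : ℝ} (hc : 0 < c)
    (h : (C - (c : ℂ) • 1).PosSemidef) (k : Fin n) : (C⁻¹ k k).re ≤ 1 / c := by
  have hdet : IsUnit C.det := (Matrix.isUnit_iff_isUnit_det _).1 hC.isUnit
  -- Congruence by `C⁻¹` gives `C⁻¹ - c C⁻² ≥ 0`. On the diagonal, `v ≥ c ∑ j, ‖C⁻¹ j k‖² ≥ c v²`,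
  -- so `v ≤ 1 / c`.
  have h1 := h.conjTranspose_mul_mul_same C⁻¹
  have h2 : (C⁻¹)ᴴ * (C - (c : ℂ) • 1) * C⁻¹ = C⁻¹ - (c : ℂ) • ((C⁻¹)ᴴ * C⁻¹) := by
    rw [Matrix.mul_sub, Matrix.sub_mul, Matrix.mul_assoc, Matrix.mul_nonsing_inv _ hdet,
      hC.inv.isHermitian.eq, Matrix.mul_one, Matrix.mul_smul, Matrix.mul_one, Matrix.smul_mul]
  rw [h2] at h1
  have h3 := (Complex.le_def.1 (h1.diag_nonneg (i := k))).1
  obtain ⟨v, hv0, hv⟩ := posDef_diag_coe hC.inv k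
  have hvpos : (0 : ℝ) < v := by positivity
  have h4 : (((C⁻¹)ᴴ * C⁻¹) k k).re = ∑ j, ‖C⁻¹ j k‖ ^ 2 := by
    rw [Matrix.mul_apply, Complex.re_sum]
    refine Finset.sum_congr rfl fun j _ => ?_
    rw [Matrix.conjTranspose_apply, RCLike.star_def, ← Complex.normSq_eq_conj_mul_self,
      Complex.ofReal_re, Complex.normSq_eq_norm_sq]
  have h5 : (v : ℝ) ^ 2 ≤ ∑ j, ‖C⁻¹ j k‖ ^ 2 := by
    have := Finset.single_le_sum (f := fun j => ‖C⁻¹ j k‖ ^ 2) (fun j _ => by positivity)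
      (Finset.mem_univ k)
    simpa [hv] using this
  have h6 : (C⁻¹ k k - (c : ℂ) * ((C⁻¹)ᴴ * C⁻¹) k k).re
      = v - c * ∑ j, ‖C⁻¹ j k‖ ^ 2 := by
    rw [Complex.sub_re, Complex.re_ofReal_mul, h4, hv, Complex.ofReal_re]
  rw [Matrix.sub_apply, Matrix.smul_apply, smul_eq_mul, h6, Complex.zero_re] at h3
  rw [hv, Complex.ofReal_re, le_div_iff₀ hc]
  have : v * (v * c) ≤ (v : ℝ) * 1 := by nlinarith
  exact le_of_mul_le_mul_left this hvpos

/-- Cauchy-Schwarz for the Frobenius inner product. -/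
lemma trace_cauchy_schwarz (A B : Matrix (Fin n) (Fin n) ℂ) :
    ‖(Aᴴ * B).trace‖ ^ 2 ≤ (Aᴴ * A).trace.re * (Bᴴ * B).trace.re := by
  have e : ∀ A B : Matrix (Fin n) (Fin n) ℂ, (Aᴴ * B).trace
      = inner ℂ (WithLp.toLp 2 fun p : Fin n × Fin n => A p.1 p.2)
        (WithLp.toLp 2 fun p : Fin n × Fin n => B p.1 p.2) := fun A B => by
    simp only [Matrix.trace, Matrix.diag, Matrix.mul_apply, PiLp.inner_apply,
      Fintype.sum_prod_type, Matrix.conjTranspose_apply, RCLike.inner_apply, RCLike.star_def]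
    rw [Finset.sum_comm]
    exact Finset.sum_congr rfl fun _ _ => Finset.sum_congr rfl fun _ _ => mul_comm _ _
  rw [e, e, e, ← RCLike.re_to_complex, ← RCLike.re_to_complex, inner_self_eq_norm_sq,
    inner_self_eq_norm_sq, ← mul_pow]
  exact pow_le_pow_left₀ (norm_nonneg _) (norm_inner_le_norm _ _) 2

/-- Distinct columns have as inner product a geometric sum over all powers of a nontrivial `n`-th
root of unity. -/
lemma dft_unitary (hn : n ≠ 0) : (dftMatrix n)ᴴ * dftMatrix n = 1 := by
  have hp := Complex.isPrimitiveRoot_exp n hn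
  set ζ := Complex.exp (2 * Real.pi * Complex.I / n) with hζ
  have hn0 : (n : ℂ) ≠ 0 := by exact_mod_cast hn
  have hζ0 : ζ ≠ 0 := Complex.exp_ne_zero _
  have hexp : ∀ j k : ℕ, Complex.exp (-(2 * (Real.pi : ℂ) * Complex.I * j * k / n))
      = ((ζ ^ k)⁻¹) ^ j := fun j k => by
    rw [inv_pow, ← pow_mul, hζ, ← Complex.exp_nat_mul, ← Complex.exp_neg]
    congr 1
    push_cast
    ring
  have hconj : ∀ k : ℕ, conj ((ζ ^ k)⁻¹) = ζ ^ k := fun k => by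
    have hnorm : ‖ζ ^ k‖ = 1 := by
      rw [norm_pow, Complex.norm_eq_one_of_pow_eq_one hp.pow_eq_one hn, one_pow]
    rw [Complex.inv_def, Complex.normSq_eq_norm_sq, hnorm]
    simp
  have hsq : ((Real.sqrt n : ℝ) : ℂ) * ((Real.sqrt n : ℝ) : ℂ) = n := by
    rw [← Complex.ofReal_mul, Real.mul_self_sqrt (by positivity)]
    simp
  ext a b
  have hterm : ∀ j : Fin n, (dftMatrix n)ᴴ a j * dftMatrix n j b
      = (ζ ^ (a : ℕ) * (ζ ^ (b : ℕ))⁻¹) ^ (j : ℕ) / n := fun j => by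
    rw [Matrix.conjTranspose_apply, dftMatrix, Matrix.of_apply, Matrix.of_apply, hexp, hexp,
      RCLike.star_def, map_div₀, map_pow, hconj, Complex.conj_ofReal, div_mul_div_comm, hsq,
      ← mul_pow]
  rw [Matrix.mul_apply, Finset.sum_congr rfl fun j _ => hterm j, ← Finset.sum_div,
    Fin.sum_univ_eq_sum_range fun j => (ζ ^ (a : ℕ) * (ζ ^ (b : ℕ))⁻¹) ^ j]
  by_cases hab : a = b
  · subst hab
    rw [mul_inv_cancel₀ (pow_ne_zero _ hζ0)]
    simp [hn0]
  · have hr : ζ ^ (a : ℕ) * (ζ ^ (b : ℕ))⁻¹ ≠ 1 := fun h => by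
      rw [mul_inv_eq_one₀ (pow_ne_zero _ hζ0)] at h
      exact hab (Fin.ext (hp.pow_inj a.2 b.2 h))
    rw [geom_sum_eq hr, mul_pow, inv_pow, ← pow_mul, ← pow_mul, mul_comm (a : ℕ), mul_comm (b : ℕ),
      pow_mul, pow_mul, hp.pow_eq_one]
    simp [Matrix.one_apply_ne hab]

/-- Equal moduli are what makes `Vᴴ D V` have constant diagonal for every diagonal `D`. -/
lemma dft_norm_sq (hn : n ≠ 0) (j k : Fin n) :
    conj (dftMatrix n j k) * dftMatrix n j k = ((1 / n : ℝ) : ℂ) := by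
  rw [← Complex.normSq_eq_conj_mul_self, Complex.normSq_eq_norm_sq, dftMatrix, Matrix.of_apply,
    norm_div, Complex.norm_real, Real.norm_of_nonneg (Real.sqrt_nonneg _), div_pow,
    Real.sq_sqrt (by positivity)]
  have : -(2 * (Real.pi : ℂ) * Complex.I * (j : ℂ) * (k : ℂ) / n)
      = ((-(2 * Real.pi * j * k / n) : ℝ) : ℂ) * Complex.I := by push_cast; ring
  rw [this, Complex.norm_exp_ofReal_mul_I, one_pow]

end LinearAlgebra

/-! ### Trace lower bound and its attainment -/

section Precoder

variable {n : ℕ} {Sig W : Matrix (Fin n) (Fin n) ℂ} {lam : Fin n → ℝ}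

lemma lam_pos (hSig : Sig.PosDef) (hW : W ∈ Matrix.unitaryGroup (Fin n) ℂ)
    (hdec : Sig = W * Matrix.diagonal (fun k => (lam k : ℂ)) * Wᴴ) (k : Fin n) : 0 < lam k := by
  have hWW : Wᴴ * W = 1 := Matrix.mem_unitaryGroup_iff'.1 hW
  have hinj : Function.Injective W.mulVec :=
    Matrix.mulVec_injective_of_isUnit (IsUnit.of_mul_eq_one_right _ hWW)
  have h := hSig.conjTranspose_mul_mul_same hinj
  have e : Wᴴ * Sig * W = Matrix.diagonal (fun k => (lam k : ℂ)) := by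
    rw [hdec, Matrix.mul_assoc, Matrix.mul_assoc, hWW, Matrix.mul_one, ← Matrix.mul_assoc, hWW,
      Matrix.one_mul]
  rw [e] at h
  have := h.diag_pos (i := k)
  rw [Matrix.diagonal_apply_eq] at this
  exact_mod_cast this

/-- Inverse of a matrix in spectral form. -/
lemma spectral_inv {U : Matrix (Fin n) (Fin n) ℂ} (hU : Uᴴ * U = 1) {d : Fin n → ℂ}
    (hd : ∀ k, d k ≠ 0) :
    (U * Matrix.diagonal d * Uᴴ)⁻¹ = U * Matrix.diagonal (fun k => (d k)⁻¹) * Uᴴ := by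
  have hU' : U * Uᴴ = 1 := mul_eq_one_comm.1 hU
  refine Matrix.inv_eq_right_inv ?_
  rw [show U * Matrix.diagonal d * Uᴴ * (U * Matrix.diagonal (fun k => (d k)⁻¹) * Uᴴ)
    = U * (Matrix.diagonal d * (Uᴴ * U) * Matrix.diagonal (fun k => (d k)⁻¹)) * Uᴴ by
      simp only [Matrix.mul_assoc], hU, Matrix.mul_one, Matrix.diagonal_mul_diagonal]
  simp only [mul_inv_cancel₀ (hd _), Matrix.diagonal_one, Matrix.mul_one, hU']

/-- Lower bound on the total noise amplification of a unit-power precoder. -/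
lemma trace_inv_ge (hW : W ∈ Matrix.unitaryGroup (Fin n) ℂ) (hlam : ∀ k, 0 < lam k)
    (hdec : Sig = W * Matrix.diagonal (fun k => (lam k : ℂ)) * Wᴴ)
    {F : Matrix (Fin n) (Fin n) ℂ} (hF : IsUnit F.det) (htr : (Fᴴ * F).trace = 1) :
    (∑ k, lam k ^ (-(1 / 2) : ℝ)) ^ 2 ≤ ((Fᴴ * Sig * F)⁻¹).trace.re := by
  have hWW : Wᴴ * W = 1 := Matrix.mem_unitaryGroup_iff'.1 hW
  -- `R` is the square root of `Sig⁻¹`; its trace is the sum to be squared.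
  set R : Matrix (Fin n) (Fin n) ℂ :=
    W * Matrix.diagonal (fun k => ((lam k ^ (-(1 / 2) : ℝ) : ℝ) : ℂ)) * Wᴴ with hR
  have hRH : Rᴴ = R := by
    rw [hR, Matrix.conjTranspose_mul, Matrix.conjTranspose_mul, Matrix.conjTranspose_conjTranspose,
      Matrix.diagonal_conjTranspose, Matrix.mul_assoc]
    congr 3
    funext k
    simp
  have hRR : R * R = Sig⁻¹ := by
    rw [hdec, spectral_inv hWW fun k => by exact_mod_cast (hlam k).ne', hR,
      show ∀ D : Matrix (Fin n) (Fin n) ℂ, W * D * Wᴴ * (W * D * Wᴴ)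
        = W * (D * (Wᴴ * W) * D) * Wᴴ by intro D; simp only [Matrix.mul_assoc], hWW,
      Matrix.mul_one, Matrix.diagonal_mul_diagonal]
    congr 3
    funext k
    rw [← Complex.ofReal_mul, ← Real.rpow_add (hlam k), ← Complex.ofReal_inv]
    norm_num [Real.rpow_neg_one]
  have htrR : R.trace = ((∑ k, lam k ^ (-(1 / 2) : ℝ) : ℝ) : ℂ) := by
    rw [hR, Matrix.trace_mul_cycle, hWW, Matrix.one_mul, Matrix.trace_diagonal]
    push_cast
    rfl
  -- In this pairing `F` cancels from the inner product, leaving `tr R`, while the squared norms are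
  -- the transmit power and the total noise amplification.
  have h := trace_cauchy_schwarz Fᴴ (F⁻¹ * R)
  have e1 : Fᴴᴴ * (F⁻¹ * R) = R := by
    rw [Matrix.conjTranspose_conjTranspose, ← Matrix.mul_assoc, Matrix.mul_nonsing_inv _ hF,
      Matrix.one_mul]
  have e2 : (Fᴴᴴ * Fᴴ).trace = 1 := by
    rw [Matrix.conjTranspose_conjTranspose, Matrix.trace_mul_comm, htr]
  have e3 : ((F⁻¹ * R)ᴴ * (F⁻¹ * R)).trace = ((Fᴴ * Sig * F)⁻¹).trace := by
    rw [Matrix.trace_mul_comm, Matrix.conjTranspose_mul, hRH, Matrix.conjTranspose_nonsing_inv,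
      show F⁻¹ * R * (R * (Fᴴ)⁻¹) = F⁻¹ * ((R * R) * (Fᴴ)⁻¹) by simp only [Matrix.mul_assoc],
      hRR, Matrix.mul_inv_rev, Matrix.mul_inv_rev]
  rw [e1, e2, e3, htrR, Complex.one_re, one_mul, Complex.norm_real, Real.norm_eq_abs, sq_abs] at h
  exact h

lemma sum_rpow_pos [NeZero n] (hlam : ∀ k, 0 < lam k) :
    0 < ∑ k, lam k ^ (-(1 / 2) : ℝ) :=
  Finset.sum_pos (fun k _ => Real.rpow_pos_of_pos (hlam k) _) Finset.univ_nonempty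

/-- The Gram matrix of the optimal precoder with a weight commuting with the covariance. -/
lemma optPrecoder_conj (hW : W ∈ Matrix.unitaryGroup (Fin n) ℂ) [NeZero n]
    (hlam : ∀ k, 0 < lam k) (d : Fin n → ℝ) :
    (optPrecoder W lam)ᴴ * (W * Matrix.diagonal (fun k => (d k : ℂ)) * Wᴴ) * optPrecoder W lam
      = (dftMatrix n)ᴴ * Matrix.diagonal (fun k => ((lam k ^ (-(1 / 2) : ℝ) * d k /
        ∑ k, lam k ^ (-(1 / 2) : ℝ) : ℝ) : ℂ)) * dftMatrix n := by
  have hWW : Wᴴ * W = 1 := Matrix.mem_unitaryGroup_iff'.1 hW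
  have hτ := sum_rpow_pos hlam
  set τ := ∑ k, lam k ^ (-(1 / 2) : ℝ) with hτdef
  set D := Matrix.diagonal (fun k => ((lam k ^ (-(1 / 4) : ℝ) : ℝ) : ℂ)) with hD
  have hDH : Dᴴ = D := by
    rw [hD, Matrix.diagonal_conjTranspose]
    congr 1
    funext k
    simp
  rw [optPrecoder, ← hτdef, ← hD, Matrix.conjTranspose_smul, Matrix.smul_mul, Matrix.smul_mul,
    Matrix.mul_smul, smul_smul, Matrix.conjTranspose_mul, Matrix.conjTranspose_mul, hDH,
    show ∀ E : Matrix (Fin n) (Fin n) ℂ, (dftMatrix n)ᴴ * (D * Wᴴ) * (W * E * Wᴴ)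
        * (W * D * dftMatrix n) = (dftMatrix n)ᴴ * (D * (Wᴴ * W) * E * (Wᴴ * W) * D) * dftMatrix n
      by intro E; simp only [Matrix.mul_assoc], hWW, Matrix.mul_one, Matrix.mul_one, hD,
    Matrix.diagonal_mul_diagonal, Matrix.diagonal_mul_diagonal, ← Matrix.smul_mul,
    ← Matrix.mul_smul, ← Matrix.diagonal_smul]
  congr 3
  funext k
  have h1 : lam k ^ (-(1 / 4) : ℝ) * lam k ^ (-(1 / 4) : ℝ) = lam k ^ (-(1 / 2) : ℝ) := by
    rw [← Real.rpow_add (hlam k)]; norm_num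
  have h2 : 1 / Real.sqrt τ * (1 / Real.sqrt τ) = 1 / τ := by
    rw [div_mul_div_comm, one_mul, Real.mul_self_sqrt hτ.le]
  simp only [Pi.smul_apply, smul_eq_mul, RCLike.star_def, Complex.conj_ofReal,
    ← Complex.ofReal_mul]
  congr 1
  rw [h2, ← h1]
  ring

lemma trace_optPrecoder (hW : W ∈ Matrix.unitaryGroup (Fin n) ℂ) [NeZero n]
    (hlam : ∀ k, 0 < lam k) : ((optPrecoder W lam)ᴴ * optPrecoder W lam).trace = 1 := by
  have hWW' : W * Wᴴ = 1 := Matrix.mem_unitaryGroup_iff.1 hW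
  have hV : dftMatrix n * (dftMatrix n)ᴴ = 1 := mul_eq_one_comm.1 (dft_unitary (NeZero.ne n))
  have hτ := sum_rpow_pos hlam
  -- With constant weight 1 the middle factor is `W * Wᴴ = 1`.
  have h := optPrecoder_conj hW hlam fun _ => 1
  simp only [Complex.ofReal_one, Matrix.diagonal_one, hWW', mul_one] at h
  rw [h, Matrix.trace_mul_cycle, hV, Matrix.one_mul, Matrix.trace_diagonal, ← Complex.ofReal_sum,
    ← Finset.sum_div, div_self hτ.ne', Complex.ofReal_one]

/-- The transformed covariance is `Vᴴ D V`, with `D` proportional to `Λ^(1/2)`. Its inverse is `Vᴴ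
D⁻¹ V`, whose diagonal entries all equal the mean of the entries of `D⁻¹`. -/
lemma optPrecoder_cov (hW : W ∈ Matrix.unitaryGroup (Fin n) ℂ) [NeZero n]
    (hlam : ∀ k, 0 < lam k)
    (hdec : Sig = W * Matrix.diagonal (fun k => (lam k : ℂ)) * Wᴴ) (k : Fin n) :
    (((optPrecoder W lam)ᴴ * Sig * optPrecoder W lam)⁻¹ k k).re
      = (∑ k, lam k ^ (-(1 / 2) : ℝ)) ^ 2 / n := by
  have hV : dftMatrix n * (dftMatrix n)ᴴ = 1 := mul_eq_one_comm.1 (dft_unitary (NeZero.ne n))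
  have hτ := sum_rpow_pos hlam
  have hs := spectral_inv (U := (dftMatrix n)ᴴ) (by rwa [Matrix.conjTranspose_conjTranspose])
    (d := fun k => ((lam k ^ (-(1 / 2) : ℝ) * lam k / ∑ k, lam k ^ (-(1 / 2) : ℝ) : ℝ) : ℂ))
    (fun k => by
      have := hlam k
      have := Real.rpow_pos_of_pos (hlam k) (-(1 / 2))
      exact_mod_cast (by positivity))
  rw [Matrix.conjTranspose_conjTranspose] at hs
  rw [hdec, optPrecoder_conj hW hlam, hs, Matrix.mul_apply]
  have hterm : ∀ j, ((dftMatrix n)ᴴ * Matrix.diagonal fun k =>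
      (((lam k ^ (-(1 / 2) : ℝ) * lam k / ∑ k, lam k ^ (-(1 / 2) : ℝ) : ℝ) : ℂ))⁻¹) k j
        * dftMatrix n j k
      = ((lam j ^ (-(1 / 2) : ℝ) * (∑ k, lam k ^ (-(1 / 2) : ℝ)) / n : ℝ) : ℂ) := fun j => by
    rw [Matrix.mul_diagonal, Matrix.conjTranspose_apply, RCLike.star_def, mul_right_comm,
      dft_norm_sq (NeZero.ne n), ← Complex.ofReal_inv, ← Complex.ofReal_mul]
    congr 1
    have h1 : lam j ^ (-(1 / 2) : ℝ) * lam j ^ (-(1 / 2) : ℝ) * lam j = 1 := by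
      rw [← Real.rpow_add (hlam j), ← Real.rpow_add_one (hlam j).ne']
      norm_num
    have h2 : (lam j ^ (-(1 / 2) : ℝ) * lam j)⁻¹ = lam j ^ (-(1 / 2) : ℝ) :=
      inv_eq_of_mul_eq_one_left (by rw [← mul_assoc]; exact h1)
    rw [inv_div, one_div, div_eq_mul_inv, h2]
    ring
  rw [Finset.sum_congr rfl fun j _ => hterm j, ← Complex.ofReal_sum, Complex.ofReal_re,
    ← Finset.sum_div, ← Finset.sum_mul, sq]

end Precoder

/-! ### Consequences of the eigenvalue constraint -/

section Optimality

variable {Nt : ℕ} {Sig W : Matrix (Fin Nt) (Fin Nt) ℂ} {lam : Fin Nt → ℝ}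

lemma isUnit_det_of_minEigGram_pos {F : Matrix (Fin Nt) (Fin Nt) ℂ} (h : 0 < minEigGram F) :
    IsUnit F.det := by
  have h1 : (((minEigGram F : ℝ) : ℂ) • (1 : Matrix (Fin Nt) (Fin Nt) ℂ)).PosDef :=
    Matrix.PosDef.one.smul (by exact_mod_cast h)
  have h2 := (Matrix.PosDef.posSemidef_add (posSemidef_gram_sub F) h1).isUnit
  rw [sub_add_cancel, Matrix.isUnit_iff_isUnit_det, Matrix.det_mul] at h2
  exact isUnit_of_mul_isUnit_right h2

lemma posDef_congr (hSig : Sig.PosDef) {F : Matrix (Fin Nt) (Fin Nt) ℂ} (hF : IsUnit F.det) :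
    (Fᴴ * Sig * F).PosDef :=
  hSig.conjTranspose_mul_mul_same
    (Matrix.mulVec_injective_of_isUnit ((Matrix.isUnit_iff_isUnit_det F).2 hF))

lemma isUnit_det_optPrecoder (hW : W ∈ Matrix.unitaryGroup (Fin Nt) ℂ) [NeZero Nt]
    (hlam : ∀ k, 0 < lam k) : IsUnit (optPrecoder W lam).det := by
  have h1 : W.det ≠ 0 := ((Matrix.isUnit_iff_isUnit_det W).1
    (IsUnit.of_mul_eq_one_right _ (Matrix.mem_unitaryGroup_iff'.1 hW))).ne_zero
  have h2 : (dftMatrix Nt).det ≠ 0 := ((Matrix.isUnit_iff_isUnit_det _).1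
    (IsUnit.of_mul_eq_one_right _ (dft_unitary (NeZero.ne Nt)))).ne_zero
  have h3 : ∏ k, ((lam k ^ (-(1 / 4) : ℝ) : ℝ) : ℂ) ≠ 0 := Finset.prod_ne_zero_iff.2 fun k _ => by
    exact_mod_cast (Real.rpow_pos_of_pos (hlam k) _).ne'
  have h4 : ((1 / Real.sqrt (∑ k, lam k ^ (-(1 / 2) : ℝ)) : ℝ) : ℂ) ≠ 0 := by
    have := Real.sqrt_pos.2 (sum_rpow_pos hlam)
    exact_mod_cast (one_div_pos.2 this).ne'
  rw [optPrecoder, Matrix.det_smul, Matrix.det_mul, Matrix.det_mul, Matrix.det_diagonal]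
  exact (mul_ne_zero (pow_ne_zero _ h4) (mul_ne_zero (mul_ne_zero h1 h3) h2)).isUnit

/-- The smallest eigenvalue of the Gram matrix bounds the noise amplification of each stream. -/
lemma noise_amplification_le (hSig : Sig.PosDef) (hW : W ∈ Matrix.unitaryGroup (Fin Nt) ℂ)
    (hdec : Sig = W * Matrix.diagonal (fun k => (lam k : ℂ)) * Wᴴ)
    {l : ℝ} (hl : 0 < l) (hle : ∀ k, l ≤ lam k)
    {F : Matrix (Fin Nt) (Fin Nt) ℂ} (hF : 0 < minEigGram F) (k : Fin Nt) :
    ((Fᴴ * Sig * F)⁻¹ k k).re ≤ 1 / (l * minEigGram F) := by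
  refine inv_diag_le (posDef_congr hSig (isUnit_det_of_minEigGram_pos hF)) (mul_pos hl hF) ?_ k
  -- `FᴴΣF - l ζ₁` splits as `Fᴴ (Σ - l) F + l (FᴴF - ζ₁)`, a sum of positive semidefinite matrices.
  have h1 := (posSemidef_sub_of_le hW hle).conjTranspose_mul_mul_same F
  have h2 := (posSemidef_gram_sub F).smul (show (0 : ℂ) ≤ (l : ℂ) by exact_mod_cast hl.le)
  convert! h1.add h2 using 1
  rw [← hdec, Matrix.mul_sub, Matrix.sub_mul, Matrix.mul_smul, Matrix.mul_one, Matrix.smul_mul,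
    smul_sub, smul_smul, sub_add_sub_cancel, Complex.ofReal_mul]

lemma T_pos {mod : Modulation} {M : ℕ} {η : ℝ} {Nr : ℕ} (hM : mod.ValidSize M) (hη : 0 < η)
    (hN : Nt < Nr) : 0 < mod.T M η Nr Nt := by
  have hκ := craigConst_pos hM
  have h : (0 : ℝ) < (Nr : ℝ) - Nt := sub_pos.2 (by exact_mod_cast hN)
  rw [T_eq]
  positivity

end Optimality

/-! ### Average error probability and the final comparison -/

section Model

variable {Ω : Type*} [MeasurableSpace Ω] {P : Measure Ω}
  {mod : Modulation} {M : ℕ} {Nr Nt : ℕ} {σ η : ℝ} {Sig W : Matrix (Fin Nt) (Fin Nt) ℂ}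
  {lam : Fin Nt → ℝ} {H : Ω → Matrix (Fin Nr) (Fin Nt) ℂ} {s : Ω → Fin Nt → ℂ}
  {ξ : Ω → Fin Nr → ℂ} {δ : ℂ → ℂ}

lemma IsMIMOModel.avgSEP_eq (hM : mod.ValidSize M)
    (h : IsMIMOModel P Sig σ (mod.constellation M) H s ξ) (hN : Nt ≤ Nr) (hσ : 0 < σ)
    (hη : η = 1 / σ ^ 2) (hδ : IsMinDistDetector (mod.constellation M) δ)
    {F : Matrix (Fin Nt) (Fin Nt) ℂ} (hC : (Fᴴ * Sig * F).PosDef) :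
    avgSEP P δ H s ξ F = 1 / (Nt : ℝ) * ∑ k, mod.G M η Nr Nt ((Fᴴ * Sig * F)⁻¹ k k).re := by
  rw [avgSEP]
  congr 1
  exact Finset.sum_congr rfl fun k _ => h.stream_sep hM hN hσ hη hδ hC k

lemma IsMIMOModel.avgSEP_optPrecoder [NeZero Nt] (hM : mod.ValidSize M)
    (h : IsMIMOModel P Sig σ (mod.constellation M) H s ξ) (hN : Nt ≤ Nr) (hσ : 0 < σ)
    (hη : η = 1 / σ ^ 2) (hδ : IsMinDistDetector (mod.constellation M) δ) (hSig : Sig.PosDef)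
    (hW : W ∈ Matrix.unitaryGroup (Fin Nt) ℂ)
    (hdec : Sig = W * Matrix.diagonal (fun k => (lam k : ℂ)) * Wᴴ) :
    avgSEP P δ H s ξ (optPrecoder W lam)
      = mod.G M η Nr Nt ((∑ k, lam k ^ (-(1 / 2) : ℝ)) ^ 2 / Nt) := by
  have hlam := lam_pos hSig hW hdec
  rw [h.avgSEP_eq hM hN hσ hη hδ (posDef_congr hSig (isUnit_det_optPrecoder hW hlam))]
  simp_rw [optPrecoder_cov hW hlam hdec]
  rw [Finset.sum_const, Finset.card_univ, Fintype.card_fin, nsmul_eq_mul, ← mul_assoc,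
    one_div_mul_cancel (by exact_mod_cast NeZero.ne Nt), one_mul]

lemma IsMIMOModel.le_avgSEP [NeZero Nt] (hM : mod.ValidSize M)
    (h : IsMIMOModel P Sig σ (mod.constellation M) H s ξ) (hN : Nt < Nr) (hσ : 0 < σ)
    (hη : η = 1 / σ ^ 2) (hδ : IsMinDistDetector (mod.constellation M) δ) (hSig : Sig.PosDef)
    (hW : W ∈ Matrix.unitaryGroup (Fin Nt) ℂ)
    (hdec : Sig = W * Matrix.diagonal (fun k => (lam k : ℂ)) * Wᴴ) (hmono : Monotone lam)
    {F : Matrix (Fin Nt) (Fin Nt) ℂ} (hF : F ∈ feasible (lam 0) (mod.T M η Nr Nt)) :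
    mod.G M η Nr Nt ((∑ k, lam k ^ (-(1 / 2) : ℝ)) ^ 2 / Nt) ≤ avgSEP P δ H s ξ F := by
  have hlam := lam_pos hSig hW hdec
  have hη0 : 0 < η := by rw [hη]; positivity
  have hNt : (0 : ℝ) < Nt := by exact_mod_cast Nat.pos_of_ne_zero (NeZero.ne Nt)
  have hT := T_pos (mod := mod) hM hη0 hN
  have hl := hlam 0
  -- The threshold `1 / (λ₁ T)` is positive, so a feasible precoder is invertible.
  have hζ : 0 < minEigGram F := lt_of_lt_of_le (by positivity) hF.1
  have hdet := isUnit_det_of_minEigGram_pos hζ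
  have hC := posDef_congr hSig hdet
  have hx0 : ∀ k, 0 < ((Fᴴ * Sig * F)⁻¹ k k).re := fun k =>
    (Complex.lt_def.1 (hC.inv.diag_pos (i := k))).1
  have hxT : ∀ k, ((Fᴴ * Sig * F)⁻¹ k k).re ≤ mod.T M η Nr Nt := fun k => by
    refine (noise_amplification_le hSig hW hdec hl (fun k => hmono (Fin.zero_le k)) hζ k).trans ?_
    rw [div_le_comm₀ (by positivity) hT, mul_comm, ← div_le_iff₀ hl, div_div, mul_comm]
    exact hF.1
  have htr := trace_inv_ge hW hlam hdec hdet hF.2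
  rw [Matrix.trace, Complex.re_sum] at htr
  rw [h.avgSEP_eq hM hN.le hσ hη hδ hC]
  -- Jensen bounds the mean of the `G (x k)` below by `G` of the mean of the `x k`; monotonicity
  -- then uses the trace bound.
  refine (G_mono hM hη0 hN.le (by have := sum_rpow_pos hlam; positivity) ?_).trans
    (G_jensen hM hη0 hN hx0 hxT)
  rw [div_eq_mul_one_div, mul_comm]
  gcongr
  exact htr

end Model

end ZFPrecoding

theorem theorem1 {Ω : Type*} [MeasurableSpace Ω] (P : Measure Ω) [IsProbabilityMeasure P]
    (mod : Modulation) (M : ℕ) (hM : mod.ValidSize M)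
    (Nr Nt : ℕ) [NeZero Nt] (hN : Nt < Nr)
    (σ η : ℝ) (hσ : 0 < σ) (hη : η = 1 / σ ^ 2)
    -- channel covariance and its eigenvalue decomposition
    (Sig W : Matrix (Fin Nt) (Fin Nt) ℂ) (lam : Fin Nt → ℝ)
    (hSig : Sig.PosDef) (hW : W ∈ Matrix.unitaryGroup (Fin Nt) ℂ) (hlam : Monotone lam)
    (hdec : Sig = W * Matrix.diagonal (fun k => (lam k : ℂ)) * Wᴴ)
    -- channel, symbols, noise, and the hard-decision rule
    (H : Ω → Matrix (Fin Nr) (Fin Nt) ℂ) (s : Ω → Fin Nt → ℂ) (ξ : Ω → Fin Nr → ℂ)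
    (hmodel : IsMIMOModel P Sig σ (mod.constellation M) H s ξ)
    (δ : ℂ → ℂ) (hδ : IsMinDistDetector (mod.constellation M) δ) :
    ((optPrecoder W lam)ᴴ * optPrecoder W lam).trace = 1 ∧
    avgSEP P δ H s ξ (optPrecoder W lam) =
      mod.G M η Nr Nt ((∑ k, lam k ^ (-(1 / 2) : ℝ)) ^ 2 / Nt) ∧
    (∀ F ∈ feasible (lam 0) (mod.T M η Nr Nt),
      avgSEP P δ H s ξ (optPrecoder W lam) ≤ avgSEP P δ H s ξ F) ∧
    (optPrecoder W lam ∈ feasible (lam 0) (mod.T M η Nr Nt) →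
      IsLeast (avgSEP P δ H s ξ '' feasible (lam 0) (mod.T M η Nr Nt))
        (mod.G M η Nr Nt ((∑ k, lam k ^ (-(1 / 2) : ℝ)) ^ 2 / Nt))) := by
  have hopt := hmodel.avgSEP_optPrecoder hM hN.le hσ hη hδ hSig hW hdec
  have hle : ∀ F ∈ feasible (lam 0) (mod.T M η Nr Nt),
      mod.G M η Nr Nt ((∑ k, lam k ^ (-(1 / 2) : ℝ)) ^ 2 / Nt) ≤ avgSEP P δ H s ξ F :=
    fun F hF => hmodel.le_avgSEP hM hN hσ hη hδ hSig hW hdec hlam hF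
  refine ⟨trace_optPrecoder hW (lam_pos hSig hW hdec), hopt, fun F hF => hopt.trans_le (hle F hF),
    fun hmem => ⟨⟨_, hmem, hopt⟩, ?_⟩⟩
  rintro _ ⟨F, hF, rfl⟩
  exact hle F hF
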